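/- Let $\alpha=(\alpha(z))_{z\in Z}$ be positive real numbers, $Z$ a set of $m$ causes, and let $\beta(w_i\mid z)\ge 0$ ($1\le i\le n$, $z\in Z$) be the probabilities with which cause $z$ produces the observation $w_i$, where $n\ge 1$. (Only the nonnegativity of the numbers $\beta(w_i\mid z)$ is used; observations are counted by their index $i$.) Let $\theta$ have the Dirichlet prior $\mathrm{Dir}(\alpha)$ on the simplex $\Delta=\{\theta\in[0,1]^Z:\sum_z\theta(z)=1\}$, with density $\theta^{\alpha-1}/B(\alpha)$, where $\theta^{\alpha-1}=\prod_z\theta(z)^{\alpha(z)-1}$ and $B(\alpha)=\prod_z\Gamma(\alpha(z))/\Gamma(\sum_z\alpha(z))$, assume that $$p(w_1,\dots,w_n\mid\alpha,\beta)=\int_\Delta \frac{\theta^{\alpha-1}}{B(\alpha)}\prod_{i=1}^n\sum_{z\in Z}\beta(w_i\mid z)\,\theta(z)\,d\theta$$ is positive, and let $$\mathbb E[\theta_z\mid w_1,\dots,w_n]=\frac{1}{p(w_1,\dots,w_n\mid\alpha,\beta)}\int_\Delta\theta(z)\,\frac{\theta^{\alpha-1}}{B(\alpha)}\prod_{i=1}^n\sum_{z'\in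 Z}\beta(w_i\mid z')\,\theta(z')\,d\theta$$ be the posterior means. The interaction graph has the observations $1,\dots,n$ as vertices, and $i\ne j$ are joined if $\beta(w_i\mid z)>0$ and $\beta(w_j\mid z)>0$ for some cause $z$. A tree decomposition of a graph is a tree $T$ with a set $V_t$ of vertices for each node $t$ such that every vertex lies in some $V_t$, every clique is contained in some $V_t$, and $V_{t_1}\cap V_{t_3}\subseteq V_{t_2}$ whenever $t_2$ lies on the path from $t_1$ to $t_3$ in $T$; its width is $\max_t|V_t|-1$, and the tree width of the graph is the least width of a tree decomposition. There are a single program for a real random access machine (unit cost for each arithmetic operation and comparison of real numbers, for each addition, truncated subtraction and comparison of natural numbers, and for each memory access) and a constant $C$ such that the following holds for all $n$, $m$, $w$, $\alpha$, $\beta$ as above. If the interaction graph has tree width $w$, then it has a tree decomposition of width $w$ with at most $n$ nodes; and, given $\alpha$, $\beta$ and any such tree decomposition (as a list of the edges of the tree and a list of the elements of each $V_t$), the program computes all the posterior means $\mathbb E[\theta_z\mid w_1,\dots,w_n]$, $z\in Z$, exactly, in time at most $C\,(n\cdot 3^w+m\cdot n\cdot 2^w)$. -/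

import Mathlib

open MeasureTheory

/-! ### The model: Dirichlet prior, evidence, posterior mean -/

namespace LDA

noncomputable section

/-- Lebesgue measure on the simplex `{θ : Fin m → ℝ | 0 ≤ θ j, ∑ j, θ j = 1}`, in the coordinates
given by all entries but the last (for `m = 1` this is the point mass at `θ = (1)`). -/
def simplexMeasure : (m : ℕ) → Measure (Fin m → ℝ)
  | 0 => 0
  | k + 1 =>
    ((volume : Measure (Fin k → ℝ)).restrict {x | (∀ j, 0 ≤ x j) ∧ ∑ j, x j ≤ 1}).map
      (fun x => Fin.snoc (α := fun _ => ℝ) x (1 - ∑ j, x j))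

/-- The normalising constant `B(α) = (∏ j, Γ(α j)) / Γ(∑ j, α j)`. -/
def multiBeta {m : ℕ} (α : Fin m → ℝ) : ℝ :=
  (∏ j, Real.Gamma (α j)) / Real.Gamma (∑ j, α j)

/-- The Dirichlet distribution with density `θ ^ (α - 1) / B(α)` on the simplex. -/
def dirichlet {m : ℕ} (α : Fin m → ℝ) : Measure (Fin m → ℝ) :=
  (simplexMeasure m).withDensity
    (fun θ => ENNReal.ofReal ((∏ j, θ j ^ (α j - 1)) / multiBeta α))

/-- `p(w₁, …, wₙ | θ, β) = ∏ i, ∑ z, β(wᵢ | z) θ(z)`, where `β i z` stands for `β(wᵢ | z)`. -/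
def likelihood {n m : ℕ} (β : Fin n → Fin m → ℝ) (θ : Fin m → ℝ) : ℝ :=
  ∏ i, ∑ z, β i z * θ z

/-- `p(w₁, …, wₙ | α, β)`. -/
def evidence {n m : ℕ} (α : Fin m → ℝ) (β : Fin n → Fin m → ℝ) : ℝ :=
  ∫ θ, likelihood β θ ∂(dirichlet α)

/-- The posterior mean `E[θ(z) | w₁, …, wₙ]`. -/
def posteriorMean {n m : ℕ} (α : Fin m → ℝ) (β : Fin n → Fin m → ℝ) (z : Fin m) : ℝ :=
  (∫ θ, θ z * likelihood β θ ∂(dirichlet α)) / evidence α β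

/-- The interaction graph: two observations are joined if some cause can generate both. -/
def interactionGraph {n m : ℕ} (β : Fin n → Fin m → ℝ) : SimpleGraph (Fin n) where
  Adj i j := i ≠ j ∧ ∃ z, 0 < β i z ∧ 0 < β j z
  symm := ⟨fun _ _ h => ⟨h.1.symm, h.2.imp fun _ hz => ⟨hz.2, hz.1⟩⟩⟩
  loopless := ⟨fun _ h => h.1 rfl⟩

end

end LDA

/-! ### Tree decompositions -/

/-- A tree decomposition of `G` whose tree has the `N` nodes `Fin N`. -/
structure TreeDecomposition {n : ℕ} (G : SimpleGraph (Fin n)) (N : ℕ) where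
  tree : SimpleGraph (Fin N)
  isTree : tree.IsTree
  bag : Fin N → Finset (Fin n)
  cover : ∀ v, ∃ t, v ∈ bag t
  clique : ∀ K : Finset (Fin n), G.IsClique (K : Set (Fin n)) → ∃ t, K ⊆ bag t
  path : ∀ (t₁ t₂ t₃ : Fin N) (p : tree.Walk t₁ t₃), p.IsPath → t₂ ∈ p.support →
    bag t₁ ∩ bag t₃ ⊆ bag t₂

namespace TreeDecomposition

/-- The width `max |bag t| - 1` (used for graphs with at least one vertex, where the maximum is
positive). -/
def width {n : ℕ} {G : SimpleGraph (Fin n)} {N : ℕ} (D : TreeDecomposition G N) : ℕ :=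
  (Finset.univ.sup fun t => (D.bag t).card) - 1

/-- A way to write a tree decomposition down: the edges of the tree, each listed once, in any order
and in any orientation, and for every node its bag as a list without repetitions, in any order. -/
structure Listing {n : ℕ} {G : SimpleGraph (Fin n)} {N : ℕ} (D : TreeDecomposition G N) where
  edges : List (Fin N × Fin N)
  edges_nodup : (edges.map fun e => s(e.1, e.2)).Nodup
  mem_edges : ∀ e, e ∈ (edges.map fun e => s(e.1, e.2)) ↔ e ∈ D.tree.edgeSet
  bags : Fin N → List (Fin n)
  bags_nodup : ∀ t, (bags t).Nodup
  mem_bags : ∀ t v, v ∈ bags t ↔ v ∈ D.bag t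

end TreeDecomposition

/-- The tree width: the least width of a tree decomposition. -/
noncomputable def treeWidth {n : ℕ} (G : SimpleGraph (Fin n)) : ℕ :=
  sInf {k | ∃ (N : ℕ) (D : TreeDecomposition G N), D.width = k}

/-! ### A real random access machine with unit costs

A program uses finitely many arrays of natural numbers and finitely many arrays of real numbers,
with indirect addressing (a scalar variable is cell `0` of an array). The operations are addition
and truncated subtraction of natural numbers, the four arithmetic operations on real numbers, and
comparisons; each of them, each constant and each access to a cell costs one unit of time. There is
no conversion from real to natural numbers. Division by zero gives zero. -/

namespace RealRAM

/-- Expressions with natural values; `get a i` is cell `i` of array `a`. -/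
inductive NatExp : Type
  | lit : ℕ → NatExp
  | get : ℕ → NatExp → NatExp
  | add : NatExp → NatExp → NatExp
  | sub : NatExp → NatExp → NatExp

/-- Expressions with real values; `get a i` is cell `i` of array `a`. -/
inductive RealExp : Type
  | lit : ℕ → RealExp
  | get : ℕ → NatExp → RealExp
  | add : RealExp → RealExp → RealExp
  | sub : RealExp → RealExp → RealExp
  | mul : RealExp → RealExp → RealExp
  | div : RealExp → RealExp → RealExp

/-- Tests. -/
inductive Test : Type
  | natLt : NatExp → NatExp → Test
  | natEq : NatExp → NatExp → Test
  | realLt : RealExp → RealExp → Test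
  | not : Test → Test
  | and : Test → Test → Test

/-- Programs; `setNat a i e` and `setReal a i e` store the value of `e` in cell `i` of array `a`. -/
inductive Program : Type
  | skip : Program
  | setNat : ℕ → NatExp → NatExp → Program
  | setReal : ℕ → NatExp → RealExp → Program
  | seq : Program → Program → Program
  | ite : Test → Program → Program → Program
  | loop : Test → Program → Program

/-- The memory: cell `i` of array `a` holds `nat a i`, respectively `real a i`. -/
structure State where
  nat : ℕ → ℕ → ℕ
  real : ℕ → ℕ → ℝ

namespace NatExp

def eval (s : State) : NatExp → ℕ
  | lit c => c
  | get a i => s.nat a (i.eval s)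
  | add e f => e.eval s + f.eval s
  | sub e f => e.eval s - f.eval s

def cost : NatExp → ℕ
  | lit _ => 1
  | get _ i => i.cost + 1
  | add e f => e.cost + f.cost + 1
  | sub e f => e.cost + f.cost + 1

end NatExp

namespace RealExp

noncomputable def eval (s : State) : RealExp → ℝ
  | lit c => c
  | get a i => s.real a (i.eval s)
  | add e f => e.eval s + f.eval s
  | sub e f => e.eval s - f.eval s
  | mul e f => e.eval s * f.eval s
  | div e f => e.eval s / f.eval s

def cost : RealExp → ℕ
  | lit _ => 1
  | get _ i => i.cost + 1
  | add e f => e.cost + f.cost + 1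
  | sub e f => e.cost + f.cost + 1
  | mul e f => e.cost + f.cost + 1
  | div e f => e.cost + f.cost + 1

end RealExp

namespace Test

def Holds (s : State) : Test → Prop
  | natLt e f => e.eval s < f.eval s
  | natEq e f => e.eval s = f.eval s
  | realLt e f => e.eval s < f.eval s
  | not b => ¬ b.Holds s
  | and b c => b.Holds s ∧ c.Holds s

def cost : Test → ℕ
  | natLt e f => e.cost + f.cost + 1
  | natEq e f => e.cost + f.cost + 1
  | realLt e f => e.cost + f.cost + 1
  | not b => b.cost + 1
  | and b c => b.cost + c.cost + 1

end Test

namespace State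

/-- Store the natural number `x` in cell `i` of array `a`. -/
def putNat (s : State) (a i x : ℕ) : State :=
  { s with nat := Function.update s.nat a (Function.update (s.nat a) i x) }

/-- Store the real number `x` in cell `i` of array `a`. -/
def putReal (s : State) (a i : ℕ) (x : ℝ) : State :=
  { s with real := Function.update s.real a (Function.update (s.real a) i x) }

end State

/-- `Runs P s k s'`: the program `P`, started in `s`, halts in `s'` after `k` units of time. -/
inductive Runs : Program → State → ℕ → State → Prop
  | skip (s : State) : Runs .skip s 1 s
  | setNat (s : State) (a : ℕ) (i e : NatExp) :
      Runs (.setNat a i e) s (i.cost + e.cost + 1) (s.putNat a (i.eval s) (e.eval s))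
  | setReal (s : State) (a : ℕ) (i : NatExp) (e : RealExp) :
      Runs (.setReal a i e) s (i.cost + e.cost + 1) (s.putReal a (i.eval s) (e.eval s))
  | seq {P Q : Program} {s₁ s₂ s₃ : State} {k l : ℕ} :
      Runs P s₁ k s₂ → Runs Q s₂ l s₃ → Runs (.seq P Q) s₁ (k + l) s₃
  | ite_true {b : Test} {P Q : Program} {s s' : State} {k : ℕ} :
      b.Holds s → Runs P s k s' → Runs (.ite b P Q) s (b.cost + k + 1) s'
  | ite_false {b : Test} {P Q : Program} {s s' : State} {k : ℕ} :
      ¬ b.Holds s → Runs Q s k s' → Runs (.ite b P Q) s (b.cost + k + 1) s'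
  | loop_true {b : Test} {P : Program} {s₁ s₂ s₃ : State} {k l : ℕ} :
      b.Holds s₁ → Runs P s₁ k s₂ → Runs (.loop b P) s₂ l s₃ →
      Runs (.loop b P) s₁ (b.cost + k + l + 1) s₃
  | loop_false {b : Test} {P : Program} {s : State} :
      ¬ b.Holds s → Runs (.loop b P) s (b.cost + 1) s

/-- The memory at the start. Arrays of natural numbers: array `0` is `(n, m, N)`; array `1` is
`(u₀, v₀, u₁, v₁, …)` for the tree edges `(u₀, v₀), (u₁, v₁), …`; array `3` lists the bags of the
nodes `0, …, N - 1` one after the other; cell `t` of array `2`, for `t ≤ N`, is the position in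
array `3` at which the bag of node `t` begins (ends, for node `t - 1`). Arrays of real numbers:
array `0` is `α`, and array `1` is the matrix `β` row by row. All other cells are zero. -/
noncomputable def input {n m : ℕ} (α : Fin m → ℝ) (β : Fin n → Fin m → ℝ)
    {G : SimpleGraph (Fin n)} {N : ℕ} {D : TreeDecomposition G N} (L : D.Listing) : State where
  nat a := match a with
    | 0 => fun i => [n, m, N].getD i 0
    | 1 => fun i => (L.edges.flatMap fun e => [e.1.val, e.2.val]).getD i 0
    | 2 => fun t => if t ≤ N then
        (((List.finRange N).take t).map fun u => (L.bags u).length).sum else 0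
    | 3 => fun i => ((List.finRange N).flatMap fun t => (L.bags t).map Fin.val).getD i 0
    | _ => fun _ => 0
  real a := match a with
    | 0 => fun i => if h : i < m then α ⟨i, h⟩ else 0
    | 1 => fun i => if h : i < n * m then
        β (finProdFinEquiv.symm ⟨i, h⟩).1 (finProdFinEquiv.symm ⟨i, h⟩).2 else 0
    | _ => fun _ => 0

end RealRAM

/-! ### Set functions under disjoint-union convolution -/

/-! Put `ℓ_z = ∑ᵢ β(wᵢ | z) xᵢ`. The integral of `∏_{i ∈ A} ∑_z β(wᵢ | z) θ(z)` against the prior,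
times the rising factorial of `∑ α` of length `|A|`, is the coefficient of `∏_{i ∈ A} xᵢ` in `∏_z (1
- ℓ_z)^(-α z)` (`rising_mul_integral`). Both sides satisfy the same recursion in `A`: on the left
because `θ(z)` times the density of `Dir(α)` is a multiple of the density of `Dir(α + e_z)`, on the
right because the logarithmic derivative in `x_v` is `∑_z α(z) β(w_v | z) (1 - ℓ_z)⁻¹`. A factor
`θ(z)` under the integral amounts to the constant `α z` and one more factor `(1 - ℓ_z)⁻¹`, and the
evidence is the sum of the numerators because `∑ θ = 1`; so the posterior means are quotients of
such coefficients (`posteriorMean_eq`). Only squarefree monomials occur, so power series are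
replaced by set functions under disjoint-union convolution.

The observations that a cause can produce form a clique, hence lie in one bag, the home of the
cause. Grouping the causes by home turns the generating function into a product of one factor per
node, supported in the bag of that node. The coefficient at the set of all observations is found by
elimination: a vertex in the bag of a leaf but not in that of its neighbour lies in no other
remaining bag, so it has to be used up at the leaf, and the leaf can be replaced by a contracted
table multiplied into its neighbour (`mul_union_apply`). A downward pass provides at every node the
contracted product of all other tables (`down_correct`), so that a coefficient of the product with a
further factor supported in one bag is read off at that bag (`pull_mul_prod_apply`,
`homeWeight_eq`).

For the running time let `K = w + 1`. The vertices are coloured with `K` colours, injectively on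
each bag, so a table has `2^K` cells addressed by bit masks of colours, and one list of the `3^K`
pairs of disjoint masks serves every convolution and contraction. Each tree edge needs a bounded
number of these; the downward pass undoes the upward multiplications from saved copies, so that
degrees in the tree do not matter. Multiplying the factors of the causes one by one would cost `m *
3^K`. Instead their logarithmic derivatives are added, at `2^K` steps per cause (`addLog_spec`), and
each node is exponentiated once in `3^K` steps (`expNode_spec`). The weight of a cause is a single
coefficient of a product of two tables and takes `2^K` steps (`weightProgram_spec`).

A decomposition with at most `n` nodes comes from listing the bags of an optimal one by pruning
leaves and discarding bags contained in later ones (`RunningInter.exists_short`): every bag kept has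
a vertex that no later bag has. -/

/-- Real functions on finite sets, multiplied by disjoint-union convolution. -/
def SetAlg : Type := Finset ℕ → ℝ

namespace SetAlg

instance : AddCommGroup SetAlg := inferInstanceAs (AddCommGroup (Finset ℕ → ℝ))

instance : Mul SetAlg := ⟨fun f g A => ∑ B ∈ A.powerset, f B * g (A \ B)⟩

instance : One SetAlg := ⟨fun A => if A = ∅ then 1 else 0⟩

theorem mul_apply (f g : SetAlg) (A : Finset ℕ) :
    (f * g) A = ∑ B ∈ A.powerset, f B * g (A \ B) := rfl

theorem one_apply (A : Finset ℕ) : (1 : SetAlg) A = if A = ∅ then 1 else 0 := rfl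

theorem add_apply (f g : SetAlg) (A : Finset ℕ) : (f + g) A = f A + g A := rfl

theorem zero_apply (A : Finset ℕ) : (0 : SetAlg) A = 0 := rfl

@[ext] theorem ext {f g : SetAlg} (h : ∀ A, f A = g A) : f = g := funext h

protected theorem mul_comm (f g : SetAlg) : f * g = g * f := by
  ext A
  refine Finset.sum_bij' (fun B _ => A \ B) (fun B _ => A \ B) ?_ ?_ ?_ ?_ ?_
  · intro B _; simp
  · intro B _; simp
  · intro B hB; simpa using hB
  · intro B hB; simpa using hB
  · intro B hB
    rw [Finset.sdiff_sdiff_eq_self (Finset.mem_powerset.1 hB), _root_.mul_comm]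

protected theorem one_mul (f : SetAlg) : 1 * f = f := by
  ext A
  rw [mul_apply, Finset.sum_eq_single ∅]
  · simp [one_apply]
  · intro B _ hB; simp [one_apply, hB]
  · simp

/-- Both sides sum over the ordered partitions of `A` into three parts; the bijection exchanges the
two ways to record one by nested subsets. -/
protected theorem mul_assoc (f g h : SetAlg) : f * g * h = f * (g * h) := by
  ext A
  simp only [mul_apply, Finset.sum_mul, Finset.mul_sum]
  rw [Finset.sum_sigma', Finset.sum_sigma']
  refine Finset.sum_bij' (fun x _ => ⟨x.2, x.1 \ x.2⟩) (fun x _ => ⟨x.1 ∪ x.2, x.1⟩)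
    ?_ ?_ ?_ ?_ ?_
  · rintro ⟨B, C⟩ h
    simp only [Finset.mem_sigma, Finset.mem_powerset] at h ⊢
    exact ⟨h.2.trans h.1, Finset.sdiff_subset_sdiff h.1 le_rfl⟩
  · rintro ⟨B, C⟩ h
    simp only [Finset.mem_sigma, Finset.mem_powerset] at h ⊢
    exact ⟨Finset.union_subset h.1 (h.2.trans Finset.sdiff_subset), Finset.subset_union_left⟩
  · rintro ⟨B, C⟩ h
    simp only [Finset.mem_sigma, Finset.mem_powerset] at h
    simp [Finset.union_sdiff_of_subset h.2]
  · rintro ⟨B, C⟩ h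
    simp only [Finset.mem_sigma, Finset.mem_powerset] at h
    have : Disjoint C B := (Finset.subset_sdiff.1 h.2).2
    simp [Finset.union_sdiff_left, Finset.sdiff_eq_self_of_disjoint this]
  · rintro ⟨B, C⟩ h
    simp only [Finset.mem_sigma, Finset.mem_powerset] at h
    simp only [_root_.mul_assoc]
    rw [Finset.sdiff_sdiff_left', ← Finset.sdiff_union_distrib, Finset.union_sdiff_of_subset h.2]

protected theorem add_mul (f g h : SetAlg) : (f + g) * h = f * h + g * h := by
  ext A
  simp only [mul_apply, add_apply, _root_.add_mul, Finset.sum_add_distrib]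

protected theorem zero_mul (f : SetAlg) : 0 * f = 0 := by
  ext A
  simp [mul_apply, zero_apply]

instance : CommRing SetAlg where
  mul_comm := SetAlg.mul_comm
  one_mul := SetAlg.one_mul
  mul_one f := by rw [SetAlg.mul_comm, SetAlg.one_mul]
  mul_assoc := SetAlg.mul_assoc
  right_distrib := SetAlg.add_mul
  left_distrib f g h := by
    rw [SetAlg.mul_comm, SetAlg.add_mul, SetAlg.mul_comm g, SetAlg.mul_comm h]
  zero_mul := SetAlg.zero_mul
  mul_zero f := by rw [SetAlg.mul_comm, SetAlg.zero_mul]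
  zsmul := zsmulRec
  neg_add_cancel := neg_add_cancel

/-- A convolution at `A` sees subsets of `A` only. This allows substituting identities that hold
only on sets avoiding a given vertex. -/
theorem mul_congr_left {f f' : SetAlg} (g : SetAlg) {A : Finset ℕ} (h : ∀ B ⊆ A, f B = f' B) :
    (f * g) A = (f' * g) A :=
  Finset.sum_congr rfl fun B hB => by rw [h B (Finset.mem_powerset.1 hB)]

/-- Multiplication by a real number. -/
def scale (c : ℝ) (f : SetAlg) : SetAlg := fun A => c * f A

theorem scale_mul_apply (c : ℝ) (f g : SetAlg) (A : Finset ℕ) :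
    (scale c f * g) A = c * (f * g) A := by
  simp only [mul_apply, scale, Finset.mul_sum, _root_.mul_assoc]

/-- The values on the sets enlarged by `v`. -/
def shift (v : ℕ) (f : SetAlg) : SetAlg := fun A => f (insert v A)

theorem sum_apply {ι : Type*} (s : Finset ι) (f : ι → SetAlg) (A : Finset ℕ) :
    (∑ i ∈ s, f i) A = ∑ i ∈ s, f i A := by
  classical
  induction s using Finset.induction_on with
  | empty => rfl
  | insert i s hi ih => rw [Finset.sum_insert hi, Finset.sum_insert hi, add_apply, ih]

/-- The Leibniz rule: `shift v` acts as the derivative in `x_v`, and in a partition of `insert v A`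
the vertex `v` goes to exactly one of the two parts. -/
theorem mul_insert (f g : SetAlg) {v : ℕ} {A : Finset ℕ} (hv : v ∉ A) :
    (f * g) (insert v A) =
      (shift v f * g) A + (f * shift v g) A := by
  simp only [mul_apply, shift]
  rw [Finset.sum_powerset_insert hv, add_comm]
  congr 1
  · refine Finset.sum_congr rfl fun B hB => ?_
    rw [Finset.insert_sdiff_insert, Finset.sdiff_insert_of_notMem hv]
  · refine Finset.sum_congr rfl fun B hB => ?_
    rw [Finset.insert_sdiff_of_notMem]
    exact fun h => hv (Finset.mem_powerset.1 hB h)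

/-- Logarithmic derivatives add up. -/
theorem prod_insert_apply {ι : Type*} (s : Finset ι) (f d : ι → SetAlg) (v : ℕ)
    (h : ∀ i ∈ s, ∀ B, v ∉ B → f i (insert v B) = (d i * f i) B) {A : Finset ℕ} (hv : v ∉ A) :
    (∏ i ∈ s, f i) (insert v A) = ((∑ i ∈ s, d i) * ∏ i ∈ s, f i) A := by
  classical
  induction s using Finset.induction_on generalizing A with
  | empty => simp [one_apply, zero_apply]
  | insert i s hi ih =>
    rw [Finset.prod_insert hi, Finset.sum_insert hi, mul_insert _ _ hv,
      mul_congr_left (f := shift v (f i)) (f' := d i * f i) _ fun B hB => h i (Finset.mem_insert_self _ _) B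
        fun hvB => hv (hB hvB), _root_.mul_comm (f i),
      mul_congr_left (f := shift v (∏ i ∈ s, f i)) (f' := (∑ i ∈ s, d i) * ∏ i ∈ s, f i) _ fun B hB =>
        ih (fun j hj => h j (Finset.mem_insert_of_mem hj)) fun hvB => hv (hB hvB), ← add_apply]
    exact congrArg (fun F : SetAlg => F A) (by ring)

/-- The rising factorial `a (a + 1) ⋯ (a + k - 1)`. -/
def rising (a : ℝ) : ℕ → ℝ
  | 0 => 1
  | k + 1 => a * rising (a + 1) k

theorem rising_succ' (a : ℝ) (k : ℕ) : rising a (k + 1) = rising a k * (a + k) := by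
  induction k generalizing a with
  | zero => simp [rising]
  | succ k ih =>
    rw [rising, ih, rising]
    push_cast
    ring

theorem rising_pos {a : ℝ} (ha : 0 < a) (k : ℕ) : 0 < rising a k := by
  induction k generalizing a with
  | zero => simp [rising]
  | succ k ih => exact mul_pos ha (ih (by linarith))

/-- The squarefree coefficients of the power series `(1 - ∑ i, b i x_i) ^ (-a)`. -/
def invPow (a : ℝ) (b : ℕ → ℝ) : SetAlg := fun A => rising a A.card * ∏ i ∈ A, b i

theorem invPow_empty (a : ℝ) (b : ℕ → ℝ) : invPow a b ∅ = 1 := by simp [invPow, rising]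

theorem invPow_insert (a : ℝ) (b : ℕ → ℝ) {v : ℕ} {A : Finset ℕ} (hv : v ∉ A) :
    invPow a b (insert v A) = a * b v * invPow (a + 1) b A := by
  simp only [invPow, Finset.card_insert_of_notMem hv, Finset.prod_insert hv, rising]
  ring

/-- The exponent law for `(1 - ℓ)^(-a)`. Differentiating in `x_v` raises one exponent by one, so by
induction the two Leibniz terms are `a * b v` and `a' * b v` times the same coefficient. -/
theorem invPow_mul (a a' : ℝ) (b : ℕ → ℝ) : invPow a b * invPow a' b = invPow (a + a') b := by
  ext A
  induction A using Finset.induction_on generalizing a a' with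
  | empty => rw [mul_apply, Finset.powerset_empty, Finset.sum_singleton, Finset.empty_sdiff, invPow_empty,
      invPow_empty, invPow_empty, _root_.mul_one]
  | insert v A hv ih =>
    rw [mul_insert _ _ hv, invPow_insert _ _ hv,
      mul_congr_left (f := shift v (invPow a b)) (f' := scale (a * b v) (invPow (a + 1) b)) _ fun B hB =>
        invPow_insert _ _ fun h => hv (hB h), _root_.mul_comm (invPow a b),
      mul_congr_left (f := shift v (invPow a' b)) (f' := scale (a' * b v) (invPow (a' + 1) b)) _ fun B hB =>
        invPow_insert _ _ fun h => hv (hB h), scale_mul_apply, scale_mul_apply, ih, ih,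
        show a + 1 + a' = a + a' + 1 by ring, show a' + 1 + a = a + a' + 1 by ring]
    ring

/-- The generating function of the Dirichlet-multinomial weights. -/
def genFun (s : Finset ℕ) (α : ℕ → ℝ) (β : ℕ → ℕ → ℝ) : SetAlg :=
  ∏ z ∈ s, invPow (α z) fun i => β i z

/-- The logarithmic derivative of `(1 - ℓ_z)^(-α z)` in `x_v` is `α z * β v z * (1 - ℓ_z)⁻¹`. This
recursion is also the one by which the program builds the tables of the nodes. -/
theorem genFun_insert (s : Finset ℕ) (α : ℕ → ℝ) (β : ℕ → ℕ → ℝ) {v : ℕ} {A : Finset ℕ}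
    (hv : v ∉ A) : genFun s α β (insert v A) =
      ((∑ z ∈ s, scale (α z * β v z) (invPow 1 fun i => β i z)) *
        genFun s α β) A := by
  refine prod_insert_apply s _ _ v (fun z _ B hB => ?_) hv
  rw [scale_mul_apply, invPow_mul, invPow_insert _ _ hB, add_comm]

theorem invPow_mul_genFun {s : Finset ℕ} (α : ℕ → ℝ) (β : ℕ → ℕ → ℝ) {z : ℕ} (hz : z ∈ s) :
    invPow 1 (fun i => β i z) * genFun s α β = genFun s (α + Pi.single z 1) β := by
  rw [genFun, genFun, ← Finset.mul_prod_erase _ (fun z' => invPow (α z') fun i => β i z') hz,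
    ← Finset.mul_prod_erase s (fun z' => invPow ((α + (Pi.single z 1 : ℕ → ℝ)) z') fun i => β i z') hz,
    ← _root_.mul_assoc, invPow_mul]
  congr 1
  · rw [add_comm]; simp
  · refine Finset.prod_congr rfl fun z' hz' => ?_
    simp [(Finset.mem_erase.1 hz').1]

/-- The same recursion with the factor `(1 - ℓ_z)⁻¹` absorbed into the parameters; in this form it
matches the recursion for Dirichlet moments. -/
theorem genFun_insert_eq_sum (s : Finset ℕ) (α : ℕ → ℝ) (β : ℕ → ℕ → ℝ) {v : ℕ} {A : Finset ℕ}
    (hv : v ∉ A) : genFun s α β (insert v A) =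
      ∑ z ∈ s, α z * β v z * genFun s (α + Pi.single z 1) β A := by
  rw [genFun_insert s α β hv, Finset.sum_mul, sum_apply]
  refine Finset.sum_congr rfl fun z hz => ?_
  rw [scale_mul_apply, invPow_mul_genFun α β hz]

theorem genFun_empty (s : Finset ℕ) (α : ℕ → ℝ) (β : ℕ → ℕ → ℝ) : genFun s α β ∅ = 1 := by
  have h : ∀ s : Finset ℕ, (∏ z ∈ s, invPow (α z) fun i => β i z) ∅ = 1 := by
    intro s
    induction s using Finset.induction_on with
    | empty => simp [one_apply]
    | insert z s hz ih => 
      rw [Finset.prod_insert hz, mul_apply, Finset.powerset_empty, Finset.sum_singleton,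
        Finset.empty_sdiff, ih, invPow_empty, _root_.mul_one]
  exact h s

end SetAlg

/-! ### Moments of the Dirichlet distribution -/

namespace LDA

open SetAlg

/-- The substitution `x ↦ r * x` reduces this to the normalised Beta density. -/
theorem lintegral_beta_scaled {a b r : ℝ} (ha : 0 < a) (hb : 0 < b) (hr : 0 < r) :
    ∫⁻ x in Set.Ioo 0 r, ENNReal.ofReal (x ^ (a - 1)) * ENNReal.ofReal ((r - x) ^ (b - 1)) =
      ENNReal.ofReal (r ^ (a + b - 1) * ProbabilityTheory.beta a b) := by
  have hB := ProbabilityTheory.beta_pos ha hb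
  have himg : (fun x : ℝ => r * x) '' Set.Ioo 0 1 = Set.Ioo 0 r := by
    rw [Set.image_mul_left_Ioo hr]; simp
  have h1 := ProbabilityTheory.lintegral_betaPDF_eq_one ha hb
  rw [ProbabilityTheory.lintegral_betaPDF] at h1
  rw [← himg, lintegral_image_eq_lintegral_abs_deriv_mul measurableSet_Ioo
    (f' := fun _ => r) (fun x _ => by simpa using ((hasDerivAt_id x).const_mul r).hasDerivWithinAt)
    (fun x _ y _ h => by simpa [hr.ne'] using h)]
  have h2 : ∀ x ∈ Set.Ioo (0 : ℝ) 1, ENNReal.ofReal |r| *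
      (ENNReal.ofReal ((r * x) ^ (a - 1)) * ENNReal.ofReal ((r - r * x) ^ (b - 1))) =
      ENNReal.ofReal (r ^ (a + b - 1) * ProbabilityTheory.beta a b) *
        ENNReal.ofReal (1 / ProbabilityTheory.beta a b * x ^ (a - 1) * (1 - x) ^ (b - 1)) := by
    intro x hx
    have hx1 : 0 < 1 - x := by linarith [hx.2]
    rw [abs_of_pos hr, ← ENNReal.ofReal_mul (Real.rpow_nonneg (mul_nonneg hr.le hx.1.le) _),
      ← ENNReal.ofReal_mul hr.le, ← ENNReal.ofReal_mul (by positivity)]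
    congr 1
    rw [show r - r * x = r * (1 - x) by ring, Real.mul_rpow hr.le hx.1.le,
      Real.mul_rpow hr.le hx1.le, show a + b - 1 = 1 + (a - 1) + (b - 1) by ring,
      Real.rpow_add hr, Real.rpow_add hr, Real.rpow_one]
    field_simp
  rw [setLIntegral_congr_fun measurableSet_Ioo h2, lintegral_const_mul', h1, mul_one]
  exact ENNReal.ofReal_ne_top

/-- The solid simplex of size `r`. -/
def solidSimplex (k : ℕ) (r : ℝ) : Set (Fin k → ℝ) := {x | (∀ j, 0 ≤ x j) ∧ ∑ j, x j ≤ r}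

theorem measurableSet_solidSimplex (k : ℕ) (r : ℝ) : MeasurableSet (solidSimplex k r) := by
  have h : solidSimplex k r = (⋂ j, {x | 0 ≤ x j}) ∩ {x | ∑ j, x j ≤ r} := by
    ext x; simp [solidSimplex]
  rw [h]
  exact (MeasurableSet.iInter fun j =>
    measurableSet_le measurable_const (measurable_pi_apply j)).inter
      (measurableSet_le (by fun_prop) measurable_const)

/-- The unnormalised Dirichlet density on the solid simplex of size `r`. -/
noncomputable def solidDensity (k : ℕ) (a : Fin k → ℝ) (b r : ℝ) (x : Fin k → ℝ) : ENNReal :=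
  (solidSimplex k r).indicator
    (fun x => ENNReal.ofReal ((∏ j, x j ^ (a j - 1)) * (r - ∑ j, x j) ^ (b - 1))) x

theorem measurable_solidDensity (k : ℕ) (a : Fin k → ℝ) (b r : ℝ) :
    Measurable (solidDensity k a b r) := by
  refine Measurable.indicator ?_ (measurableSet_solidSimplex k r)
  refine ENNReal.measurable_ofReal.comp (Measurable.mul ?_ ?_)
  · exact Finset.measurable_prod _ fun j _ => (measurable_pi_apply j).pow_const _
  · exact Measurable.pow_const (by fun_prop) _

/-- Fixing the first coordinate leaves a solid simplex of size `r - x₀`, which is why the size is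
kept variable. -/
theorem solidDensity_cons {k : ℕ} (a : Fin (k + 1) → ℝ) (b r x₀ : ℝ) (y : Fin k → ℝ) :
    solidDensity (k + 1) a b r (Fin.cons x₀ y) =
      (Set.Ici 0).indicator (fun x => ENNReal.ofReal (x ^ (a 0 - 1))) x₀ *
        solidDensity k (Fin.tail a) b (r - x₀) y := by
  have hmem : (Fin.cons x₀ y : Fin (k + 1) → ℝ) ∈ solidSimplex (k + 1) r ↔
      0 ≤ x₀ ∧ y ∈ solidSimplex k (r - x₀) := by
    simp only [solidSimplex, Set.mem_ofPred_eq, Fin.forall_fin_succ, Fin.cons_zero, Fin.cons_succ,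
      Fin.sum_univ_succ, le_sub_iff_add_le', and_assoc]
  unfold solidDensity
  by_cases h0 : 0 ≤ x₀
  · by_cases hy : y ∈ solidSimplex k (r - x₀)
    · rw [Set.indicator_of_mem (hmem.2 ⟨h0, hy⟩), Set.indicator_of_mem (Set.mem_Ici.2 h0),
        Set.indicator_of_mem hy, ← ENNReal.ofReal_mul (Real.rpow_nonneg h0 _)]
      congr 1
      simp only [Fin.prod_univ_succ, Fin.cons_zero, Fin.cons_succ, Fin.sum_univ_succ, Fin.tail]
      rw [sub_sub, mul_assoc]
    · rw [Set.indicator_of_notMem (fun h => hy (hmem.1 h).2), Set.indicator_of_notMem hy, mul_zero]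
  · rw [Set.indicator_of_notMem (fun h => h0 (hmem.1 h).1),
      Set.indicator_of_notMem (mt Set.mem_Ici.1 h0), zero_mul]

/-- The first coordinate is integrated last: the induction hypothesis leaves a power of `r - x₀`,
and the remaining integral is a scaled Beta integral whose Gamma factors telescope. -/
theorem lintegral_solidDensity (k : ℕ) (a : Fin k → ℝ) (b r : ℝ) (ha : ∀ j, 0 < a j) (hb : 0 < b)
    (hr : 0 < r) : ∫⁻ x, solidDensity k a b r x =
      ENNReal.ofReal (r ^ ((∑ j, a j) + b - 1) *
        ((∏ j, Real.Gamma (a j)) * Real.Gamma b / Real.Gamma ((∑ j, a j) + b))) := by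
  induction k generalizing r with
  | zero =>
    have hx : ∀ x : Fin 0 → ℝ, x ∈ solidSimplex 0 r := fun x => ⟨fun j => j.elim0, by simpa using hr.le⟩
    have : ∀ x, solidDensity 0 a b r x = ENNReal.ofReal (r ^ (b - 1)) := by
      intro x; simp [solidDensity, hx x]
    have hG := (Real.Gamma_pos_of_pos hb).ne'
    simp [this, hG, volume_pi]
  | succ k ih =>
    have hm : Measurable fun p : ℝ × (Fin k → ℝ) => solidDensity (k + 1) a b r
        ((MeasurableEquiv.piFinSuccAbove (fun _ => ℝ) 0).symm p) :=
      (measurable_solidDensity _ _ _ _).comp (MeasurableEquiv.measurable _)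
    rw [← (volume_preserving_piFinSuccAbove (fun _ => ℝ) 0).symm.lintegral_comp
      (measurable_solidDensity _ _ _ _), Measure.volume_eq_prod, lintegral_prod _ hm.aemeasurable]
    have hs : 0 ≤ ∑ j, Fin.tail a j := Finset.sum_nonneg fun j _ => (ha _).le
    set c := (∏ j, Real.Gamma (Fin.tail a j)) * Real.Gamma b /
      Real.Gamma ((∑ j, Fin.tail a j) + b) with hc
    have hc0 : 0 < c := by
      have := Finset.prod_pos fun j (_ : j ∈ Finset.univ) =>
        Real.Gamma_pos_of_pos (ha (Fin.succ j))
      exact div_pos (mul_pos this (Real.Gamma_pos_of_pos hb)) (Real.Gamma_pos_of_pos (by linarith))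
    have key : ∀ᵐ x₀ : ℝ, (∫⁻ y : Fin k → ℝ, solidDensity (k + 1) a b r
        ((MeasurableEquiv.piFinSuccAbove (fun _ => ℝ) 0).symm (x₀, y))) =
        (Set.Ioo 0 r).indicator (fun x => ENNReal.ofReal (x ^ (a 0 - 1)) *
          ENNReal.ofReal ((r - x) ^ ((∑ j, Fin.tail a j) + b - 1)) * ENNReal.ofReal c) x₀ := by
      -- The endpoints are a null set. At `0` the two indicators disagree, and at `r` the remaining
      -- simplex has size zero, which the induction hypothesis does not cover.
      have hne : ∀ᵐ x₀ : ℝ, x₀ ≠ 0 ∧ x₀ ≠ r := by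
        filter_upwards [(measure_singleton (0 : ℝ) : volume {(0 : ℝ)} = 0) |> compl_mem_ae_iff.2,
          (measure_singleton r : volume {r} = 0) |> compl_mem_ae_iff.2] with x h1 h2
        exact ⟨h1, h2⟩
      filter_upwards [hne] with x₀ hx₀
      have : ∀ y : Fin k → ℝ, (MeasurableEquiv.piFinSuccAbove (fun _ => ℝ) 0).symm (x₀, y) =
          (Fin.cons x₀ y : Fin (k + 1) → ℝ) := by
        intro y
        simp [MeasurableEquiv.piFinSuccAbove, Fin.insertNthEquiv]
      simp_rw [this, solidDensity_cons]
      rw [lintegral_const_mul _ (measurable_solidDensity _ _ _ _)]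
      by_cases h0 : 0 ≤ x₀
      · by_cases h1 : x₀ < r
        · rw [Set.indicator_of_mem (Set.mem_Ici.2 h0),
            Set.indicator_of_mem (Set.mem_Ioo.2 ⟨lt_of_le_of_ne h0 (Ne.symm hx₀.1), h1⟩),
            ih (Fin.tail a) _ (fun j => ha _) (sub_pos.2 h1), ENNReal.ofReal_mul, mul_assoc]
          exact Real.rpow_nonneg (by linarith) _
        · have : ∀ y : Fin k → ℝ, solidDensity k (Fin.tail a) b (r - x₀) y = 0 := by
            intro y
            refine Set.indicator_of_notMem (fun hy => ?_) _
            have h2 := Finset.sum_nonneg fun j (_ : j ∈ Finset.univ) => hy.1 j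
            have h3 := hy.2
            exact hx₀.2 (le_antisymm (by linarith) (not_lt.1 h1))
          rw [Set.indicator_of_notMem (s := Set.Ioo 0 r) (fun h => h1 h.2)]
          simp [this]
      · rw [Set.indicator_of_notMem (mt Set.mem_Ici.1 h0), Set.indicator_of_notMem (fun h => h0 h.1.le),
          zero_mul]
    rw [lintegral_congr_ae key, lintegral_indicator measurableSet_Ioo,
      lintegral_mul_const' _ _ ENNReal.ofReal_ne_top,
      lintegral_beta_scaled (ha 0) (by linarith) hr, ← ENNReal.ofReal_mul
      (mul_nonneg (Real.rpow_nonneg hr.le _) (ProbabilityTheory.beta_pos (ha 0) (by linarith)).le)]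
    congr 1
    have hG := (Real.Gamma_pos_of_pos (show 0 < (∑ j, Fin.tail a j) + b by linarith)).ne'
    have e : ∑ j, a j = a 0 + ∑ j, Fin.tail a j := Fin.sum_univ_succ a
    have e' : ∏ j, Real.Gamma (a j) = Real.Gamma (a 0) * ∏ j, Real.Gamma (Fin.tail a j) :=
      Fin.prod_univ_succ _
    rw [hc, ProbabilityTheory.beta, e, e', ← add_assoc]
    field_simp

theorem multiBeta_pos {m : ℕ} {α : Fin (m + 1) → ℝ} (hα : ∀ z, 0 < α z) : 0 < multiBeta α :=
  div_pos (Finset.prod_pos fun j _ => Real.Gamma_pos_of_pos (hα j))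
    (Real.Gamma_pos_of_pos (Finset.sum_pos (fun j _ => hα j) Finset.univ_nonempty))

theorem measurable_snoc (k : ℕ) : Measurable (fun x : Fin k → ℝ =>
    (Fin.snoc (α := fun _ => ℝ) x (1 - ∑ j, x j) : Fin (k + 1) → ℝ)) := by
  refine measurable_pi_iff.2 fun j => ?_
  refine Fin.lastCases ?_ (fun j => ?_) j
  · simp only [Fin.snoc_last]; fun_prop
  · simp only [Fin.snoc_castSucc]; fun_prop

/-- The density of the Dirichlet distribution. -/
noncomputable def density {m : ℕ} (α : Fin m → ℝ) (θ : Fin m → ℝ) : ENNReal :=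
  ENNReal.ofReal ((∏ j, θ j ^ (α j - 1)) / multiBeta α)

theorem measurable_density {m : ℕ} (α : Fin m → ℝ) : Measurable (density α) :=
  ENNReal.measurable_ofReal.comp <| Measurable.div_const
    (Finset.measurable_prod _ fun j _ => (measurable_pi_apply j).pow_const _) _

/-- The size is `r = 1` and the last parameter plays the role of `b`, since the last coordinate is
one minus the sum of the others. -/
theorem isProbabilityMeasure_dirichlet {k : ℕ} {α : Fin (k + 1) → ℝ} (hα : ∀ z, 0 < α z) :
    IsProbabilityMeasure (dirichlet α) := by
  constructor
  have hB := multiBeta_pos hα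
  rw [dirichlet, withDensity_apply _ MeasurableSet.univ, Measure.restrict_univ]
  change ∫⁻ θ, density α θ ∂_ = 1
  rw [simplexMeasure, lintegral_map (measurable_density α) (measurable_snoc k)]
  change ∫⁻ x in solidSimplex k 1, _ = 1
  rw [← lintegral_indicator (measurableSet_solidSimplex k 1)]
  have : ∀ x : Fin k → ℝ, (solidSimplex k 1).indicator (fun x => density α
      (Fin.snoc (α := fun _ => ℝ) x (1 - ∑ j, x j))) x =
      solidDensity k (fun j => α j.castSucc) (α (Fin.last k)) 1 x *
        ENNReal.ofReal (multiBeta α)⁻¹ := by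
    intro x
    by_cases hx : x ∈ solidSimplex k 1
    · rw [solidDensity, Set.indicator_of_mem hx, Set.indicator_of_mem hx, density,
        Fin.prod_univ_castSucc, div_eq_mul_inv,
        ENNReal.ofReal_mul' (inv_nonneg.2 hB.le)]
      simp
    · rw [solidDensity, Set.indicator_of_notMem hx, Set.indicator_of_notMem hx, zero_mul]
  rw [lintegral_congr this, lintegral_mul_const' _ _ ENNReal.ofReal_ne_top,
    lintegral_solidDensity _ _ _ _ (fun j => hα _) (hα _) one_pos, Real.one_rpow, one_mul,
    ← Fin.prod_univ_castSucc (fun j => Real.Gamma (α j)), ← Fin.sum_univ_castSucc α]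
  change ENNReal.ofReal (multiBeta α) * _ = 1
  rw [← ENNReal.ofReal_mul hB.le, mul_inv_cancel₀ hB.ne', ENNReal.ofReal_one]

theorem ae_simplexMeasure_mem (m : ℕ) :
    ∀ᵐ θ ∂(simplexMeasure m), θ ∈ stdSimplex ℝ (Fin m) := by
  cases m with
  | zero => simp [simplexMeasure]
  | succ k =>
    have hmeas : MeasurableSet (stdSimplex ℝ (Fin (k + 1))) := (isClosed_stdSimplex ℝ _).measurableSet
    refine (ae_map_iff (measurable_snoc k).aemeasurable hmeas).2 ?_
    filter_upwards [ae_restrict_mem (measurableSet_solidSimplex k 1)] with x hx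
    refine ⟨fun j => ?_, ?_⟩
    · refine Fin.lastCases ?_ (fun j => ?_) j
      · simpa using hx.2
      · simpa using hx.1 j
    · rw [Fin.sum_univ_castSucc]; simp

theorem ae_dirichlet_mem {m : ℕ} (α : Fin m → ℝ) :
    ∀ᵐ θ ∂(dirichlet α), θ ∈ stdSimplex ℝ (Fin m) :=
  (withDensity_absolutelyContinuous _ _).ae_le (ae_simplexMeasure_mem m)

/-- The measure is finite and carried by the compact simplex, on which a continuous function is
bounded. -/
theorem integrable_dirichlet {k : ℕ} {α : Fin (k + 1) → ℝ} (hα : ∀ z, 0 < α z)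
    {f : (Fin (k + 1) → ℝ) → ℝ} (hf : Continuous f) : Integrable f (dirichlet α) := by
  have := isProbabilityMeasure_dirichlet hα
  have h : (dirichlet α).restrict (stdSimplex ℝ (Fin (k + 1))) = dirichlet α :=
    Measure.restrict_eq_self_of_ae_mem (ae_dirichlet_mem α)
  rw [← h]
  exact hf.continuousOn.integrableOn_compact (isCompact_stdSimplex ℝ _)

theorem multiBeta_add_single {m : ℕ} {α : Fin (m + 1) → ℝ} (hα : ∀ z, 0 < α z) (z : Fin (m + 1)) :
    multiBeta (α + Pi.single z 1) = α z / (∑ j, α j) * multiBeta α := by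
  have hs : 0 < ∑ j, α j := Finset.sum_pos (fun j _ => hα j) Finset.univ_nonempty
  have h1 : ∑ j, (α + Pi.single z 1 : Fin (m + 1) → ℝ) j = (∑ j, α j) + 1 := by
    simp [Finset.sum_add_distrib]
  have h2 : ∏ j, Real.Gamma ((α + Pi.single z 1 : Fin (m + 1) → ℝ) j) =
      α z * ∏ j, Real.Gamma (α j) := by
    rw [← Finset.mul_prod_erase _ _ (Finset.mem_univ z), ← Finset.mul_prod_erase _
      (fun j => Real.Gamma (α j)) (Finset.mem_univ z), ← mul_assoc]
    congr 1
    · simp [Real.Gamma_add_one (hα z).ne']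
    · refine Finset.prod_congr rfl fun j hj => ?_
      simp [(Finset.mem_erase.1 hj).1]
  have hG := (Real.Gamma_pos_of_pos hs).ne'
  rw [multiBeta, multiBeta, h1, h2, Real.Gamma_add_one hs.ne']
  field_simp

/-- Tilting: multiplying the density by `θ z` raises one exponent by one, and `Γ(x + 1) = x Γ(x)`
gives the ratio of the two normalising constants. -/
theorem integral_mul_dirichlet {m : ℕ} {α : Fin (m + 1) → ℝ} (hα : ∀ z, 0 < α z) (z : Fin (m + 1))
    (g : (Fin (m + 1) → ℝ) → ℝ) : ∫ θ, θ z * g θ ∂(dirichlet α) =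
      α z / (∑ j, α j) * ∫ θ, g θ ∂(dirichlet (α + Pi.single z 1)) := by
  have hB := multiBeta_pos hα
  have hs : 0 < ∑ j, α j := Finset.sum_pos (fun j _ => hα j) Finset.univ_nonempty
  have hint : ∀ (α : Fin (m + 1) → ℝ) (g : (Fin (m + 1) → ℝ) → ℝ),
      ∫ θ, g θ ∂(dirichlet α) = ∫ θ, (density α θ).toReal • g θ ∂(simplexMeasure (m + 1)) :=
    fun α g => integral_withDensity_eq_integral_toReal_smul (measurable_density α)
      (Filter.Eventually.of_forall fun _ => ENNReal.ofReal_lt_top) g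
  rw [hint, hint, ← integral_const_mul]
  refine integral_congr_ae ?_
  filter_upwards [ae_simplexMeasure_mem (m + 1)] with θ hθ
  have hnn : ∀ α : Fin (m + 1) → ℝ, 0 ≤ ∏ j, θ j ^ (α j - 1) := fun α =>
    Finset.prod_nonneg fun j _ => Real.rpow_nonneg (hθ.1 j) _
  have hα' : ∀ j, 0 < (α + Pi.single z 1 : Fin (m + 1) → ℝ) j := fun j =>
    add_pos_of_pos_of_nonneg (hα j) (by
      by_cases h : j = z
      · subst h; simp
      · simp [h])
  have hprod : ∏ j, θ j ^ ((α + Pi.single z 1 : Fin (m + 1) → ℝ) j - 1) =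
      (∏ j, θ j ^ (α j - 1)) * θ z := by
    rw [← Finset.mul_prod_erase _ _ (Finset.mem_univ z), ← Finset.mul_prod_erase _
      (fun j => θ j ^ (α j - 1)) (Finset.mem_univ z), mul_right_comm]
    congr 1
    · have h0 : (α + Pi.single z 1 : Fin (m + 1) → ℝ) z - 1 = α z := by simp
      rw [h0]
      -- On the face `θ z = 0` the law `x ^ (a - 1) * x = x ^ a` is checked directly: both sides
      -- vanish because `α z` is positive.
      rcases (hθ.1 z).eq_or_lt with h | h
      · rw [← h, Real.zero_rpow (hα z).ne', mul_zero]
      · rw [← Real.rpow_add_one h.ne', sub_add_cancel]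
    · refine Finset.prod_congr rfl fun j hj => ?_
      simp [(Finset.mem_erase.1 hj).1]
  simp only [smul_eq_mul, density]
  rw [ENNReal.toReal_ofReal (div_nonneg (hnn _) hB.le),
    ENNReal.toReal_ofReal (div_nonneg (hnn _) (multiBeta_pos hα').le), hprod,
    multiBeta_add_single hα]
  have := (hα z).ne'
  field_simp

/-- Induction on `A`, for all parameters at once: the factor of `v` is expanded over the causes,
each `θ z` is removed by tilting to `α + e_z`, and the sum becomes `genFun_insert_eq_sum`. The total
of the parameters grows by one, in step with the rising factorial. -/
theorem rising_mul_integral {m : ℕ} (β : ℕ → ℕ → ℝ) (A : Finset ℕ) (α : ℕ → ℝ)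
    (hα : ∀ z < m + 1, 0 < α z) :
    rising (∑ z ∈ Finset.range (m + 1), α z) A.card *
      ∫ θ, ∏ i ∈ A, ∑ z : Fin (m + 1), β i z * θ z ∂(dirichlet fun z : Fin (m + 1) => α z) =
      genFun (Finset.range (m + 1)) α β A := by
  induction A using Finset.induction_on generalizing α with
  | empty =>
    have := isProbabilityMeasure_dirichlet (α := fun z : Fin (m + 1) => α z) fun z => hα z z.2
    simp [rising, genFun_empty]
  | insert v A hv ih =>
    have hα' : ∀ z : Fin (m + 1), 0 < (fun z : Fin (m + 1) => α z) z := fun z => hα z z.2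
    have hs : 0 < ∑ z ∈ Finset.range (m + 1), α z :=
      Finset.sum_pos (fun z hz => hα z (Finset.mem_range.1 hz)) ⟨0, by simp⟩
    rw [genFun_insert_eq_sum _ _ _ hv, Finset.sum_range fun z =>
      α z * β v z * genFun (Finset.range (m + 1)) (α + (Pi.single z 1 : ℕ → ℝ)) β A]
    have hsum : ∀ θ : Fin (m + 1) → ℝ, ∏ i ∈ insert v A, ∑ z : Fin (m + 1), β i z * θ z =
        ∑ z : Fin (m + 1), β v z * (θ z * ∏ i ∈ A, ∑ z : Fin (m + 1), β i z * θ z) := by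
      intro θ
      rw [Finset.prod_insert hv, Finset.sum_mul]
      simp only [mul_assoc]
    simp_rw [hsum]
    rw [integral_finsetSum _ fun z _ => integrable_dirichlet hα' (by fun_prop), Finset.mul_sum]
    refine Finset.sum_congr rfl fun z _ => ?_
    have hshift : ((fun z : Fin (m + 1) => α z) + (Pi.single z 1 : Fin (m + 1) → ℝ)) =
        fun z' : Fin (m + 1) => (α + (Pi.single (z : ℕ) 1 : ℕ → ℝ)) z' := by
      ext z'
      simp [Pi.single_apply, Fin.ext_iff]
    have hsum' : ∑ z' ∈ Finset.range (m + 1), (α + (Pi.single (z : ℕ) 1 : ℕ → ℝ)) z' =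
        (∑ z' ∈ Finset.range (m + 1), α z') + 1 := by
      simp [Finset.sum_add_distrib, Pi.single_apply]
      exact Nat.le_of_lt_succ z.2
    rw [integral_const_mul, integral_mul_dirichlet hα', hshift, ← ih (α + Pi.single (z : ℕ) 1)
      (fun z' hz' => add_pos_of_pos_of_nonneg (hα z' hz')
        (by rw [Pi.single_apply]; split_ifs <;> norm_num)), hsum',
      Finset.card_insert_of_notMem hv, rising, Finset.sum_range α]
    rw [Finset.sum_range] at hs
    field_simp

/-- The numerators of the posterior means, up to a common factor. -/
noncomputable def weight (n m : ℕ) (α : ℕ → ℝ) (β : ℕ → ℕ → ℝ) (z : ℕ) : ℝ :=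
  α z * (invPow 1 (fun i => β i z) * genFun (Finset.range m) α β) (Finset.range n)

/-- All numerators carry the same constant, and the evidence is their sum because `∑ θ = 1` almost
everywhere; the constant cancels, so the machine never has to evaluate it. -/
theorem posteriorMean_eq {n m : ℕ} (α : ℕ → ℝ) (β : ℕ → ℕ → ℝ) (hα : ∀ z < m, 0 < α z)
    (z : Fin m) :
    posteriorMean (fun z : Fin m => α z) (fun (i : Fin n) (z : Fin m) => β i z) z =
      weight n m α β z / ∑ z ∈ Finset.range m, weight n m α β z := by
  obtain ⟨m, rfl⟩ : ∃ k, m = k + 1 := ⟨m - 1, by have := z.2; omega⟩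
  set s := ∑ z ∈ Finset.range (m + 1), α z with hs
  have hs0 : 0 < s :=
    Finset.sum_pos (fun z hz => hα z (Finset.mem_range.1 hz)) ⟨0, by simp⟩
  have hα' : ∀ z : Fin (m + 1), 0 < (fun z : Fin (m + 1) => α z) z := fun z => hα z z.2
  -- The factor `s` comes from tilting by `θ z`, and `rising (s + 1) n` belongs to the tilted
  -- parameters, whose total is `s + 1`.
  set c := s * rising (s + 1) n
  have hc : c ≠ 0 := (mul_pos hs0 (rising_pos (by linarith) n)).ne'
  have hlik : ∀ θ : Fin (m + 1) → ℝ, likelihood (fun (i : Fin n) (z : Fin (m + 1)) => β i z) θ =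
      ∏ i ∈ Finset.range n, ∑ z : Fin (m + 1), β i z * θ z := fun θ => by
    rw [Finset.prod_range]; rfl
  have hnum : ∀ z : Fin (m + 1), ∫ θ, θ z * likelihood (fun (i : Fin n) (z : Fin (m + 1)) => β i z) θ
      ∂(dirichlet fun z : Fin (m + 1) => α z) = weight n (m + 1) α β z / c := by
    intro z
    have hshift : ((fun z : Fin (m + 1) => α z) + (Pi.single z 1 : Fin (m + 1) → ℝ)) =
        fun z' : Fin (m + 1) => (α + (Pi.single (z : ℕ) 1 : ℕ → ℝ)) z' := by
      ext z'
      simp [Pi.single_apply, Fin.ext_iff]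
    have hsum' : ∑ z' ∈ Finset.range (m + 1), (α + (Pi.single (z : ℕ) 1 : ℕ → ℝ)) z' = s + 1 := by
      simp [Finset.sum_add_distrib, Pi.single_apply, hs]
      exact Nat.le_of_lt_succ z.2
    simp_rw [hlik]
    rw [integral_mul_dirichlet hα', hshift, weight,
      invPow_mul_genFun α β (Finset.mem_range.2 z.2), ← rising_mul_integral β _ (α + Pi.single (z : ℕ) 1)
      (fun z' hz' => add_pos_of_pos_of_nonneg (hα z' hz')
        (by rw [Pi.single_apply]; split_ifs <;> norm_num)), hsum', Finset.card_range,
      ← Finset.sum_range α, ← hs]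
    have := (rising_pos (show 0 < s + 1 by linarith) n).ne'
    simp only [c]
    field_simp
  have hev : evidence (fun z : Fin (m + 1) => α z) (fun (i : Fin n) (z : Fin (m + 1)) => β i z) =
      ∑ z ∈ Finset.range (m + 1), weight n (m + 1) α β z / c := by
    rw [Finset.sum_range, ← Finset.sum_congr rfl fun z _ => hnum z, ← integral_finsetSum]
    · refine integral_congr_ae ?_
      filter_upwards [ae_dirichlet_mem _] with θ hθ
      rw [← Finset.sum_mul, hθ.2, one_mul]
    · intro z _
      refine integrable_dirichlet hα' ?_
      simp_rw [hlik]
      fun_prop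
  rw [posteriorMean, hnum, hev, ← Finset.sum_div, div_div_div_cancel_right₀ hc]

end LDA

/-! ### Elimination along a tree decomposition -/

namespace SetAlg

/-- `f` vanishes outside the subsets of `S`. -/
def Supp (f : SetAlg) (S : Finset ℕ) : Prop := ∀ A, ¬ A ⊆ S → f A = 0

theorem Supp.mono {f : SetAlg} {S S' : Finset ℕ} (h : Supp f S) (hS : S ⊆ S') : Supp f S' :=
  fun A hA => h A fun h' => hA (h'.trans hS)

theorem supp_one (S : Finset ℕ) : Supp 1 S := fun A hA => by
  rw [one_apply, if_neg]
  rintro rfl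
  simp at hA

theorem Supp.mul {f g : SetAlg} {S : Finset ℕ} (hf : Supp f S) (hg : Supp g S) :
    Supp (f * g) S := fun A hA => by
  rw [mul_apply]
  refine Finset.sum_eq_zero fun B hB => ?_
  by_cases h : B ⊆ S
  · rw [hg, mul_zero]
    intro h'
    refine hA fun x hx => ?_
    by_cases hxB : x ∈ B
    · exact h hxB
    · exact h' (Finset.mem_sdiff.2 ⟨hx, hxB⟩)
  · rw [hf B h, zero_mul]

theorem supp_prod {ι : Type*} {s : Finset ι} {f : ι → SetAlg} {S : Finset ℕ}
    (h : ∀ i ∈ s, Supp (f i) S) : Supp (∏ i ∈ s, f i) S := by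
  classical
  induction s using Finset.induction_on with
  | empty => exact supp_one S
  | insert i s hi ih =>
    rw [Finset.prod_insert hi]
    exact (h i (by simp)).mul (ih fun j hj => h j (by simp [hj]))

/-- The set function on subsets of `V` obtained from a function on sets of colours. -/
def pull (col : ℕ → ℕ) (V : Finset ℕ) (φ : SetAlg) : SetAlg :=
  fun A => if A ⊆ V then φ (A.image col) else 0

theorem pull_apply (col : ℕ → ℕ) {V A : Finset ℕ} (φ : SetAlg) (h : A ⊆ V) :
    pull col V φ A = φ (A.image col) := if_pos h

theorem supp_pull (col : ℕ → ℕ) (V : Finset ℕ) (φ : SetAlg) : Supp (pull col V φ) V :=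
  fun _ hA => if_neg hA

theorem image_sdiff_of_injOn {col : ℕ → ℕ} {V A B : Finset ℕ} (hc : Set.InjOn col V)
    (hA : A ⊆ V) (hB : B ⊆ V) : (A \ B).image col = A.image col \ B.image col := by
  ext c
  simp only [Finset.mem_image, Finset.mem_sdiff]
  constructor
  · rintro ⟨x, ⟨hx, hxB⟩, rfl⟩
    refine ⟨⟨x, hx, rfl⟩, ?_⟩
    rintro ⟨y, hy, hxy⟩
    exact hxB (hc (hB hy) (hA hx) hxy ▸ hy)
  · rintro ⟨⟨x, hx, rfl⟩, h⟩
    exact ⟨x, ⟨hx, fun hxB => h ⟨x, hxB, rfl⟩⟩, rfl⟩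

/-- Since the colouring is injective on `V`, partitions of a subset of `V` correspond to partitions
of its set of colours, so convolutions can be carried out on colours. -/
theorem pull_mul {col : ℕ → ℕ} {V : Finset ℕ} (hc : Set.InjOn col V) (φ ψ : SetAlg) :
    pull col V (φ * ψ) = pull col V φ * pull col V ψ := by
  ext A
  by_cases hA : A ⊆ V
  · rw [pull_apply _ _ hA, mul_apply, mul_apply]
    symm
    refine Finset.sum_bij (fun B _ => B.image col) ?_ ?_ ?_ ?_
    · intro B hB
      exact Finset.mem_powerset.2 (Finset.image_subset_image (Finset.mem_powerset.1 hB))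
    · intro B hB B' hB' h
      ext x
      have key : ∀ {B B' : Finset ℕ}, B ⊆ A → B' ⊆ A → B.image col = B'.image col → x ∈ B → x ∈ B' := by
        intro B B' hB hB' h hx
        obtain ⟨y, hy, hyx⟩ := Finset.mem_image.1 (h ▸ Finset.mem_image_of_mem col hx)
        exact hc (hA (hB' hy)) (hA (hB hx)) hyx ▸ hy
      exact ⟨key (Finset.mem_powerset.1 hB) (Finset.mem_powerset.1 hB') h,
        key (Finset.mem_powerset.1 hB') (Finset.mem_powerset.1 hB) h.symm⟩
    · intro C hC
      obtain ⟨B, hB, rfl⟩ := Finset.subset_image_iff.1 (Finset.mem_powerset.1 hC)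
      exact ⟨B, Finset.mem_powerset.2 (by exact_mod_cast hB), rfl⟩
    · intro B hB
      have hB' := Finset.mem_powerset.1 hB
      rw [pull_apply _ _ (hB'.trans hA), pull_apply _ _ (Finset.sdiff_subset.trans hA),
        image_sdiff_of_injOn hc hA (hB'.trans hA)]
  · rw [supp_pull _ _ _ _ hA, ((supp_pull col V φ).mul (supp_pull col V ψ)) _ hA]

theorem pull_one (col : ℕ → ℕ) (V : Finset ℕ) : pull col V 1 = 1 := by
  ext A
  by_cases hA : A ⊆ V
  · rw [pull_apply _ _ hA, one_apply, one_apply]; simp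
  · rw [supp_pull _ _ _ _ hA, supp_one V _ hA]

theorem pull_prod {ι : Type*} {col : ℕ → ℕ} {V : Finset ℕ} (hc : Set.InjOn col V) (s : Finset ι)
    (φ : ι → SetAlg) : pull col V (∏ i ∈ s, φ i) = ∏ i ∈ s, pull col V (φ i) := by
  classical
  induction s using Finset.induction_on with
  | empty => simp [pull_one]
  | insert i s hi ih => rw [Finset.prod_insert hi, Finset.prod_insert hi, pull_mul hc, ih]

/-- The function obtained by requiring that the sets contain `V \ P`. -/
def restr (V P : Finset ℕ) (f : SetAlg) : SetAlg :=
  fun A => if A ⊆ V ∩ P then f (A ∪ (V \ P)) else 0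

theorem supp_restr (V P : Finset ℕ) (f : SetAlg) : Supp (restr V P f) (V ∩ P) :=
  fun _ hA => if_neg hA

/-- The elimination step. The vertices of `V \ P` lie outside `W`, so in a nonzero term they all
belong to the part given to `f`; only the share of `V ∩ P` is free, and everything else in `W` goes
to `g`. -/
theorem mul_union_apply {f g : SetAlg} {V W P : Finset ℕ} (hf : Supp f V) (hg : Supp g W)
    (hPW : P ⊆ W) (hVW : V ∩ W ⊆ P) : (f * g) (V ∪ W) = (restr V P f * g) W := by
  have h1 : (restr V P f * g) W =
      ∑ A ∈ (V ∩ P).powerset, f (A ∪ (V \ P)) * g (W \ A) := by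
    rw [mul_apply]
    symm
    refine Finset.sum_subset_zero_on_sdiff
      (Finset.powerset_mono.2 (Finset.inter_subset_right.trans hPW)) ?_ ?_
    · intro A hA
      rw [supp_restr, zero_mul]
      exact fun h => (Finset.mem_sdiff.1 hA).2 (Finset.mem_powerset.2 h)
    · intro A hA
      rw [restr, if_pos (Finset.mem_powerset.1 hA)]
  have hdis : ∀ x ∈ V, x ∈ W → x ∈ P := fun x h1 h2 => hVW (Finset.mem_inter.2 ⟨h1, h2⟩)
  rw [h1, mul_apply]
  symm
  refine Finset.sum_of_injOn (fun A => A ∪ (V \ P)) ?_ ?_ ?_ ?_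
  · intro A hA B hB h
    simp only [Finset.coe_powerset, Set.mem_preimage, Set.mem_powerset_iff, Finset.coe_subset]
      at hA hB
    ext x
    have := Finset.ext_iff.1 h x
    have hA' := @hA x
    have hB' := @hB x
    simp only [Finset.mem_union, Finset.mem_sdiff, Finset.mem_inter] at this hA' hB'
    tauto
  · intro A hA
    simp only [Finset.coe_powerset, Set.mem_preimage, Set.mem_powerset_iff, Finset.coe_subset]
      at hA ⊢
    intro x hx
    have hA' := @hA x
    simp only [Finset.mem_union, Finset.mem_sdiff, Finset.mem_inter] at hx hA' ⊢
    tauto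
  · intro B hB hnot
    by_cases hBV : B ⊆ V
    · rw [hg, mul_zero]
      intro hsub
      refine hnot ⟨B ∩ P, ?_, ?_⟩
      · exact Finset.mem_coe.2 (Finset.mem_powerset.2 (Finset.inter_subset_inter_right hBV))
      · ext x
        have h1 := @hBV x
        have h2 := @hsub x
        have h3 := hdis x
        simp only [Finset.mem_union, Finset.mem_sdiff, Finset.mem_inter] at h1 h2 h3 ⊢
        tauto
    · rw [hf _ hBV, zero_mul]
  · intro A hA
    congr 2
    have hA' := Finset.mem_powerset.1 hA
    ext x
    have h1 := @hA' x
    have h2 := @hPW x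
    have h3 := hdis x
    simp only [Finset.mem_union, Finset.mem_sdiff, Finset.mem_inter] at h1 h2 h3 ⊢
    tauto

/-- The function obtained by requiring that the sets contain `Y` and removing `Y`. -/
def contract (Y : Finset ℕ) (f : SetAlg) : SetAlg :=
  fun C => if Disjoint C Y then f (C ∪ Y) else 0

/-- Contraction in terms of colours agrees with `restr` in terms of vertices, although the colouring
is injective only on each of `V` and `P` and colours may recur across them. -/
theorem pull_contract {col : ℕ → ℕ} {V P : Finset ℕ} (hV : Set.InjOn col V) (hP : Set.InjOn col P)
    {f : SetAlg} (hf : Supp f (V.image col)) :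
    pull col P (contract ((V \ P).image col) f) = restr V P (pull col V f) := by
  ext A
  by_cases hAP : A ⊆ P
  · rw [pull_apply _ _ hAP, contract, restr]
    by_cases hAV : A ⊆ V
    · rw [if_pos, if_pos (Finset.subset_inter hAV hAP),
        pull_apply _ _ (Finset.union_subset hAV Finset.sdiff_subset), Finset.image_union]
      rw [Finset.disjoint_left]
      intro c h1 h2
      obtain ⟨x, hx, rfl⟩ := Finset.mem_image.1 h1
      obtain ⟨y, hy, hxy⟩ := Finset.mem_image.1 h2
      obtain ⟨hyV, hyP⟩ := Finset.mem_sdiff.1 hy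
      exact hyP (hV hyV (hAV hx) hxy ▸ hAP hx)
    · rw [if_neg (c := A ⊆ V ∩ P) fun h => hAV (h.trans Finset.inter_subset_left)]
      split_ifs with hd
      -- A vertex of `A` outside `V` could share its colour with some `x ∈ V`. If `x ∈ P`,
      -- injectivity on `P` identifies the two; if not, the colour lies in the contracted set,
      -- against disjointness.
      · refine hf _ fun hsub => hAV fun v hv => ?_
        obtain ⟨x, hx, hxv⟩ := Finset.mem_image.1
          (hsub (Finset.mem_union_left _ (Finset.mem_image_of_mem col hv)))
        by_cases hxP : x ∈ P
        · exact hP hxP (hAP hv) hxv ▸ hx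
        · exact absurd (Finset.mem_image.2 ⟨x, Finset.mem_sdiff.2 ⟨hx, hxP⟩, hxv⟩)
            (Finset.disjoint_left.1 hd (Finset.mem_image_of_mem col hv))
      · rfl
  · rw [supp_pull _ _ _ _ hAP, (supp_restr V P _).mono Finset.inter_subset_right _ hAP]

theorem supp_contract {col : ℕ → ℕ} {V P : Finset ℕ}
    {f : SetAlg} (hf : Supp f (V.image col)) :
    Supp (contract ((V \ P).image col) f) (P.image col) := by
  intro C hC
  rw [contract]
  split_ifs with hd
  · refine hf _ fun hsub => hC fun c hc => ?_
    obtain ⟨x, hx, rfl⟩ := Finset.mem_image.1 (hsub (Finset.mem_union_left _ hc))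
    by_contra hxP
    refine Finset.disjoint_left.1 hd hc (Finset.mem_image_of_mem col (Finset.mem_sdiff.2 ⟨hx, ?_⟩))
    exact fun h => hxP (Finset.mem_image_of_mem col h)
  · rfl

end SetAlg

/-- An elimination ordering of the nodes of a tree decomposition: `Q i` is the node at position `i`,
`par t` the neighbour of `t` that is eliminated later, `V t` the bag of `t`. -/
structure ElimOrder (N : ℕ) (V : ℕ → Finset ℕ) (Q par : ℕ → ℕ) : Prop where
  inj : ∀ i j, i < N → j < N → Q i = Q j → i = j
  par_mem : ∀ i, i + 1 < N → ∃ j, i < j ∧ j < N ∧ par (Q i) = Q j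
  inter : ∀ i k, i < k → k < N → V (Q i) ∩ V (Q k) ⊆ V (par (Q i))

namespace ElimOrder

open SetAlg

variable {N : ℕ} {V : ℕ → Finset ℕ} {Q par : ℕ → ℕ}

/-- The tables after the elimination of the first `i` nodes. -/
noncomputable def up (V : ℕ → Finset ℕ) (Q par col : ℕ → ℕ) (E : ℕ → SetAlg) : ℕ → ℕ → SetAlg
  | 0 => E
  | i + 1 => Function.update (up V Q par col E i) (par (Q i))
      (up V Q par col E i (par (Q i)) *
        contract ((V (Q i) \ V (par (Q i))).image col) (up V Q par col E i (Q i)))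

/-- One step of the downward pass. -/
noncomputable def downStep (V : ℕ → Finset ℕ) (par col : ℕ → ℕ) (F H : ℕ → SetAlg) (u : ℕ) :
    ℕ → SetAlg :=
  Function.update
    (Function.update H (par u) (H (par u) * contract ((V u \ V (par u)).image col) (F u))) u
    (contract ((V (par u) \ V u).image col) (F (par u) * H (par u)))

/-- The complementary tables after `k` steps of the downward pass. -/
noncomputable def down (V : ℕ → Finset ℕ) (N : ℕ) (Q par col : ℕ → ℕ) (E : ℕ → SetAlg) :
    ℕ → ℕ → SetAlg
  | 0 => fun t => if t = Q (N - 1) then 1 else 0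
  | k + 1 => downStep V par col (up V Q par col E (N - 2 - k)) (down V N Q par col E k)
      (Q (N - 2 - k))

variable {col : ℕ → ℕ} {E : ℕ → SetAlg}

theorem supp_up (hE : ∀ t, Supp (E t) ((V t).image col)) (i t : ℕ) :
    Supp (up V Q par col E i t) ((V t).image col) := by
  induction i generalizing t with
  | zero => exact hE t
  | succ i ih =>
    rw [up]
    by_cases h : t = par (Q i)
    · subst h
      rw [Function.update_self]
      exact (ih _).mul (supp_contract (ih _))
    · rw [Function.update_of_ne h]
      exact ih t

theorem supp_down (hE : ∀ t, Supp (E t) ((V t).image col)) (k t : ℕ) :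
    Supp (down V N Q par col E k t) ((V t).image col) := by
  induction k generalizing t with
  | zero =>
    simp only [down]
    split_ifs
    · exact supp_one _
    · exact fun _ _ => rfl
  | succ k ih =>
    rw [down, downStep]
    by_cases h : t = Q (N - 2 - k)
    · subst h
      rw [Function.update_self]
      exact supp_contract ((supp_up hE _ _).mul (ih _))
    · rw [Function.update_of_ne h]
      by_cases h' : t = par (Q (N - 2 - k))
      · subst h'
        rw [Function.update_self]
        exact (ih _).mul (supp_contract (supp_up hE _ _))
      · rw [Function.update_of_ne h']
        exact ih t

/-- The vertices in the bags from position `i` on. -/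
def later (V : ℕ → Finset ℕ) (N : ℕ) (Q : ℕ → ℕ) (i : ℕ) : Finset ℕ :=
  (Finset.Ico i N).biUnion fun j => V (Q j)

theorem subset_later {i j : ℕ} (h : i ≤ j) (hj : j < N) : V (Q j) ⊆ later V N Q i :=
  Finset.subset_biUnion_of_mem (fun j => V (Q j)) (Finset.mem_Ico.2 ⟨h, hj⟩)

theorem later_eq {i : ℕ} (h : i < N) : later V N Q i = V (Q i) ∪ later V N Q (i + 1) := by
  rw [later, later, ← Finset.insert_Ico_add_one_left_eq_Ico h, Finset.biUnion_insert]

theorem inter_later (h : ElimOrder N V Q par) (i : ℕ) :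
    V (Q i) ∩ later V N Q (i + 1) ⊆ V (par (Q i)) := by
  intro x hx
  obtain ⟨h1, h2⟩ := Finset.mem_inter.1 hx
  obtain ⟨k, hk, hxk⟩ := Finset.mem_biUnion.1 h2
  obtain ⟨hk1, hk2⟩ := Finset.mem_Ico.1 hk
  exact h.inter i k hk1 hk2 (Finset.mem_inter.2 ⟨h1, hxk⟩)

/-- Induction on the number of downward steps, each of which brings back one eliminated node `u`.
The test function `X` at an arbitrary remaining node lets the induction hypothesis be applied at
another node, or with tables absorbed into `X`. -/
theorem down_correct (h : ElimOrder N V Q par) (hN : 0 < N) (hcol : ∀ t, Set.InjOn col (V t))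
    (hE : ∀ t, Supp (E t) ((V t).image col)) (k : ℕ) (hk : k < N) (j : ℕ) (hij : N - 1 - k ≤ j)
    (hj : j < N) (X : SetAlg) (hX : Supp X (V (Q j))) :
    (X * ∏ j' ∈ (Finset.Ico (N - 1 - k) N).erase j,
      pull col (V (Q j')) (up V Q par col E (N - 1 - k) (Q j'))) (later V N Q (N - 1 - k)) =
      (X * pull col (V (Q j)) (down V N Q par col E k (Q j))) (V (Q j)) := by
  induction k generalizing j X with
  | zero =>
    have hj' : j = N - 1 := by omega
    subst hj'
    have h1 : (Finset.Ico (N - 1 - 0) N).erase (N - 1) = ∅ := by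
      ext x; simp; omega
    have h2 : later V N Q (N - 1 - 0) = V (Q (N - 1)) := by
      have : Finset.Ico (N - 1 - 0) N = {N - 1} := by ext x; simp; omega
      rw [later, this, Finset.singleton_biUnion]
    simp only [h1, h2, down, if_true, pull_one, Finset.prod_empty]
  | succ k ih =>
    obtain ⟨i, rfl⟩ : ∃ i, N = i + k + 2 := ⟨N - (k + 2), by omega⟩
    have e1 : i + k + 2 - 1 - (k + 1) = i := by omega
    have e2 : i + k + 2 - 1 - k = i + 1 := by omega
    have e3 : i + k + 2 - 2 - k = i := by omega
    rw [e1] at hij ⊢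
    rw [e2] at ih
    set N := i + k + 2 with hNdef
    rw [down, e3]
    set F := up V Q par col E i with hF
    set H := down V N Q par col E k with hH
    set u := Q i with hu
    obtain ⟨jp, hjp1, hjp2, hjp⟩ := h.par_mem i (by omega)
    rw [← hu] at hjp
    have hne : par u ≠ u := fun he => by
      have := h.inj jp i hjp2 (by omega) (by rw [← hjp, ← hu, he])
      omega
    have hFsupp : ∀ t, Supp (F t) ((V t).image col) := supp_up hE i
    have hHsupp : ∀ t, Supp (H t) ((V t).image col) := supp_down hE k
    have hVp : V (par u) ⊆ later V N Q (i + 1) := by rw [hjp]; exact subset_later hjp1 hjp2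
    have hup : ∀ j', j' < N → Q j' ≠ par u → up V Q par col E (i + 1) (Q j') = F (Q j') := by
      intro j' _ hj'
      rw [up, Function.update_of_ne hj']
    have hupp : up V Q par col E (i + 1) (Q jp) = F (par u) *
        contract ((V u \ V (par u)).image col) (F u) := by
      rw [up, ← hjp, Function.update_self]
    have hM : pull col (V (par u)) (contract ((V u \ V (par u)).image col) (F u)) =
        restr (V u) (V (par u)) (pull col (V u) (F u)) :=
      pull_contract (hcol _) (hcol _) (hFsupp _)
    have hGsupp : Supp (F (par u) * H (par u)) ((V (par u)).image col) :=
      (hFsupp _).mul (hHsupp _)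
    have hprodsupp : ∀ s : Finset ℕ, s ⊆ Finset.Ico (i + 1) N →
        Supp (∏ j' ∈ s, pull col (V (Q j')) (F (Q j'))) (later V N Q (i + 1)) := by
      intro s hs
      refine supp_prod fun j' hj' => (supp_pull _ _ _).mono ?_
      obtain ⟨h1, h2⟩ := Finset.mem_Ico.1 (hs hj')
      exact subset_later h1 h2
    have hprod_ne : ∏ j' ∈ (Finset.Ico (i + 1) N).erase jp,
        pull col (V (Q j')) (up V Q par col E (i + 1) (Q j')) =
        ∏ j' ∈ (Finset.Ico (i + 1) N).erase jp, pull col (V (Q j')) (F (Q j')) := by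
      refine Finset.prod_congr rfl fun j' hj' => ?_
      obtain ⟨h1, h2⟩ := Finset.mem_erase.1 hj'
      have h3 := (Finset.mem_Ico.1 h2).2
      rw [hup j' h3]
      intro he
      exact h1 (h.inj j' jp h3 hjp2 (by rw [he, hjp]))
    have hmemjp : jp ∈ Finset.Ico (i + 1) N := Finset.mem_Ico.2 ⟨hjp1, hjp2⟩
    rw [later_eq (by omega : i < N)]
    by_cases hji : j = i
    · subst hji
      have herase : (Finset.Ico j N).erase j = Finset.Ico (j + 1) N := by
        rw [← Finset.insert_Ico_add_one_left_eq_Ico hj, Finset.erase_insert]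
        simp
      -- At `u` itself, `X` is contracted onto the bag of the parent and the induction hypothesis is
      -- used there. Both sides are then the coefficient of `X` times the two tables of the parent
      -- at the union of the two bags.
      rw [herase, mul_union_apply hX (hprodsupp _ le_rfl) hVp (h.inter_later j),
        ← Finset.mul_prod_erase _ _ hmemjp, ← hprod_ne, ← mul_assoc]
      have := ih (by omega) jp hjp1 hjp2 (restr (V (Q j)) (V (par (Q j))) X *
        pull col (V (Q jp)) (F (Q jp))) (((supp_restr _ _ _).mono (by
          rw [← hjp]; exact Finset.inter_subset_right)).mul (supp_pull _ _ _))
      rw [this, ← hjp, mul_assoc, ← pull_mul (hcol _), downStep, ← hu, Function.update_self,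
        pull_contract (hcol _) (hcol _) hGsupp, mul_comm X,
        ← mul_union_apply (V := V (par u)) (W := V u) (supp_pull _ _ _) hX le_rfl
          Finset.inter_subset_right,
        ← mul_union_apply (W := V (par u)) (V := V u) hX (supp_pull _ _ _) le_rfl
        Finset.inter_subset_right, mul_comm, Finset.union_comm]
    · have hij' : i + 1 ≤ j := by omega
      have herase : (Finset.Ico i N).erase j = insert i ((Finset.Ico (i + 1) N).erase j) := by
        rw [← Finset.insert_Ico_add_one_left_eq_Ico (by omega : i < N),
          Finset.erase_insert_of_ne (Ne.symm hji)]
      have hnotmem : i ∉ (Finset.Ico (i + 1) N).erase j := by simp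
      have hjne : Q j ≠ u := fun he => hji (h.inj j i hj (by omega) he)
      -- At any other node, the table of `u` is first contracted to a message on the bag of its
      -- parent.
      rw [herase, Finset.prod_insert hnotmem, ← hu, ← mul_assoc, mul_comm X, mul_assoc,
        mul_union_apply (supp_pull _ _ _) ((hX.mono (subset_later hij' hj)).mul
          (hprodsupp _ (Finset.erase_subset _ _))) hVp (h.inter_later i), ← hM]
      by_cases hjjp : j = jp
      -- At the parent, whose own factor is left out of the product, the message has to come from
      -- the complementary table, which is why `downStep` multiplies it in.
      · subst hjjp
        rw [downStep, Function.update_of_ne hjne, hjp, Function.update_self, ← hjp, ← hprod_ne,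
          ← mul_assoc, ih (by omega) j hij' hj _ (Supp.mul (by
            rw [← hjp]; exact supp_pull _ _ _) hX), ← hjp, pull_mul (hcol _)]
        exact congrArg (fun f : SetAlg => f (V (par u))) (by ring)
      · have hjnp : Q j ≠ par u := fun he => hjjp (h.inj j jp hj hjp2 (by rw [he, hjp]))
        rw [downStep, Function.update_of_ne hjne, Function.update_of_ne hjnp, ← ih (by omega) j hij'
          hj X hX]
        -- At all remaining nodes the message is absorbed by the factor of the parent, which makes
        -- it the table of upward stage `i + 1`.
        have hm2 : jp ∈ (Finset.Ico (i + 1) N).erase j :=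
          Finset.mem_erase.2 ⟨Ne.symm hjjp, hmemjp⟩
        have hprod2 : ∏ j' ∈ ((Finset.Ico (i + 1) N).erase j).erase jp,
            pull col (V (Q j')) (up V Q par col E (i + 1) (Q j')) =
            ∏ j' ∈ ((Finset.Ico (i + 1) N).erase j).erase jp, pull col (V (Q j')) (F (Q j')) := by
          refine Finset.prod_congr rfl fun j' hj' => ?_
          obtain ⟨h1, h2⟩ := Finset.mem_erase.1 hj'
          have h3 := (Finset.mem_Ico.1 (Finset.mem_erase.1 h2).2).2
          rw [hup j' h3]
          intro he
          exact h1 (h.inj j' jp h3 hjp2 (by rw [he, hjp]))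
        rw [← Finset.mul_prod_erase _ _ hm2, ← Finset.mul_prod_erase _ (fun j' =>
          pull col (V (Q j')) (up V Q par col E (i + 1) (Q j'))) hm2, hprod2, hupp,
          pull_mul (hcol _), ← hjp]
        exact congrArg (fun f : SetAlg => f (later V N Q (i + 1))) (by ring)

/-- A coefficient of the product of all tables is found at a single node. -/
theorem pull_mul_prod_apply (h : ElimOrder N V Q par) (hcol : ∀ t, Set.InjOn col (V t))
    (hE : ∀ t, Supp (E t) ((V t).image col)) (hQ : ∀ i < N, Q i < N) (t : ℕ) (ht : t < N)
    (φ : SetAlg) :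
    (pull col (V t) φ * ∏ t' ∈ Finset.range N, pull col (V t') (E t'))
      ((Finset.range N).biUnion V) =
      (φ * (E t * down V N Q par col E (N - 1) t)) ((V t).image col) := by
  have himg : (Finset.range N).image Q = Finset.range N := by
    refine Finset.eq_of_subset_of_card_le ?_ ?_
    · intro x hx
      obtain ⟨i, hi, rfl⟩ := Finset.mem_image.1 hx
      exact Finset.mem_range.2 (hQ i (Finset.mem_range.1 hi))
    · rw [Finset.card_image_of_injOn]
      intro i hi j hj hij
      exact h.inj i j (by simpa using hi) (by simpa using hj) hij
  obtain ⟨j, hj, rfl⟩ := Finset.mem_image.1 (himg.symm ▸ Finset.mem_range.2 ht :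
    t ∈ (Finset.range N).image Q)
  have hj' := Finset.mem_range.1 hj
  have hprod : ∏ t' ∈ Finset.range N, pull col (V t') (E t') =
      ∏ j ∈ Finset.range N, pull col (V (Q j)) (E (Q j)) := by
    conv_lhs => rw [← himg]
    rw [Finset.prod_image]
    intro i hi j hj hij
    exact h.inj i j (by simpa using hi) (by simpa using hj) hij
  have hU : (Finset.range N).biUnion V = later V N Q 0 := by
    conv_lhs => rw [← himg]
    rw [Finset.image_biUnion, later, Finset.range_eq_Ico]
  -- After `N - 1` downward steps no node is eliminated, so the tables in the product are the
  -- original ones; the missing factor `E t` is supplied through `X`.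
  have key := h.down_correct (by omega) hcol hE (N - 1) (by omega) j (by omega) hj'
    (pull col (V (Q j)) (φ * E (Q j))) (supp_pull _ _ _)
  rw [Nat.sub_self, up, ← pull_mul (hcol _), pull_apply _ _ le_rfl] at key
  rw [hprod, hU, ← Finset.mul_prod_erase _ _ hj, ← mul_assoc, ← pull_mul (hcol _),
    Finset.range_eq_Ico, key, mul_assoc]

end ElimOrder

/-! ### Pruning leaves of a tree -/

namespace SimpleGraph

/-- All paths of `T` between members of `S` stay in `S`. -/
def PathClosed {V : Type*} (T : SimpleGraph V) (S : Finset V) : Prop :=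
  ∀ a ∈ S, ∀ b ∈ S, ∀ p : T.Walk a b, p.IsPath → ∀ x ∈ p.support, x ∈ S

theorem pathClosed_univ {V : Type*} [Fintype V] {T : SimpleGraph V} : T.PathClosed Finset.univ := fun _ _ _ _ _ _ x _ => Finset.mem_univ x

/-- A path through `u` between other members of `S` enters and leaves `u` by two different
neighbours, both in `S`. -/
theorem PathClosed.erase {V : Type*} [DecidableEq V] {T : SimpleGraph V} [DecidableRel T.Adj]
    {S : Finset V} (hS : T.PathClosed S) {u : V}
    (hu : (S.filter (T.Adj u)).card ≤ 1) : T.PathClosed (S.erase u) := by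
  intro a ha b hb p hp x hx
  obtain ⟨hau, haS⟩ := Finset.mem_erase.1 ha
  obtain ⟨hbu, hbS⟩ := Finset.mem_erase.1 hb
  have hall := hS a haS b hbS p hp
  refine Finset.mem_erase.2 ⟨?_, hall x hx⟩
  rintro rfl
  have hnil1 : ¬ (p.takeUntil x hx).Nil := Walk.not_nil_of_ne hau
  have hnil2 : ¬ (p.dropUntil x hx).Nil := Walk.not_nil_of_ne hbu.symm
  have hadj1 := (p.takeUntil x hx).adj_penultimate hnil1
  have hadj2 := (p.dropUntil x hx).adj_snd hnil2
  have hmem1 : (p.takeUntil x hx).penultimate ∈ (p.takeUntil x hx).support :=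
    Walk.getVert_mem_support _ _
  have hmem2 : (p.dropUntil x hx).snd ∈ (p.dropUntil x hx).support.tail :=
    Walk.snd_mem_tail_support hnil2
  have hnd := hp.support_nodup
  rw [← p.take_spec hx, Walk.support_append] at hnd
  have hne : (p.takeUntil x hx).penultimate ≠ (p.dropUntil x hx).snd := fun he =>
    (List.disjoint_of_nodup_append hnd) hmem1 (he ▸ hmem2)
  refine absurd hu (not_le.2 (Finset.one_lt_card.2
    ⟨_, Finset.mem_filter.2 ⟨?_, hadj1.symm⟩, _, Finset.mem_filter.2 ⟨?_, hadj2⟩, hne⟩))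
  · exact hall _ (Walk.support_takeUntil_subset_support _ _ hmem1)
  · exact hall _ (Walk.support_dropUntil_subset_support _ _ (List.mem_of_mem_tail hmem2))

/-- A path-closed set induces a subtree, and a tree with at least two vertices has one of degree
one. -/
theorem PathClosed.exists_leaf {V : Type*} {T : SimpleGraph V} [DecidableRel T.Adj]
    (hT : T.IsTree) {S : Finset V} (hS : T.PathClosed S)
    (h2 : 2 ≤ S.card) : ∃ u ∈ S, (S.filter (T.Adj u)).card ≤ 1 := by
  classical
  have hne : Nonempty {x // x ∈ (S : Set V)} := by
    obtain ⟨x, hx⟩ := Finset.card_pos.1 (show 0 < S.card by omega)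
    exact ⟨⟨x, hx⟩⟩
  have hconn : (T.induce (S : Set V)).Connected := by
    refine ⟨fun a b => ?_⟩
    obtain ⟨p, hp⟩ := hT.connected.exists_isPath a.1 b.1
    exact ⟨p.induce _ fun x hx => hS a.1 a.2 b.1 b.2 p hp x hx⟩
  have htree : (T.induce (S : Set V)).IsTree := ⟨hconn, hT.isAcyclic.induce _⟩
  have : Nontrivial {x // x ∈ (S : Set V)} := by
    obtain ⟨a, ha, b, hb, hab⟩ := Finset.one_lt_card.1 h2
    exact ⟨⟨a, ha⟩, ⟨b, hb⟩, fun h => hab (congrArg Subtype.val h)⟩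
  obtain ⟨u, hu⟩ := htree.exists_vert_degree_one_of_nontrivial
  refine ⟨u.1, u.2, ?_⟩
  rw [← hu, ← card_neighborFinset_eq_degree]
  refine Finset.card_le_card_of_surjOn Subtype.val fun x hx => ?_
  obtain ⟨hxS, hxu⟩ := Finset.mem_filter.1 (Finset.mem_coe.1 hx)
  exact ⟨⟨x, hxS⟩, by simpa using hxu, rfl⟩

/-- The first step of a path from `u` to another member of `S` stays in `S`, so it leads to the only
neighbour that `u` has there. -/
theorem PathClosed.exists_parent {V : Type*} {T : SimpleGraph V} [DecidableRel T.Adj]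
    (hT : T.IsTree) {S : Finset V} (hS : T.PathClosed S) {u : V}
    (huS : u ∈ S) (hu : (S.filter (T.Adj u)).card ≤ 1) (h2 : 2 ≤ S.card) :
    ∃ q, S.filter (T.Adj u) = {q} ∧
      ∀ b ∈ S, b ≠ u → ∃ p : T.Walk u b, p.IsPath ∧ q ∈ p.support := by
  have hstep : ∀ b ∈ S, b ≠ u → ∃ p : T.Walk u b, p.IsPath ∧ ∃ q ∈ p.support, q ∈ S.filter (T.Adj u) := by
    intro b hb hbu
    obtain ⟨p, hp⟩ := hT.connected.exists_isPath u b
    have hnil : ¬ p.Nil := Walk.not_nil_of_ne hbu.symm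
    have hmem : p.snd ∈ p.support := Walk.getVert_mem_support _ _
    exact ⟨p, hp, p.snd, hmem, Finset.mem_filter.2 ⟨hS u huS b hb p hp _ hmem, p.adj_snd hnil⟩⟩
  obtain ⟨b, hb, hbu⟩ := Finset.exists_mem_ne (show 1 < S.card by omega) u
  obtain ⟨p, hp, q, hqp, hq⟩ := hstep b hb hbu
  have hall : ∀ q' ∈ S.filter (T.Adj u), q' = q := fun q' hq' =>
    Finset.card_le_one.1 hu q' hq' q hq
  refine ⟨q, Finset.eq_singleton_iff_unique_mem.2 ⟨hq, hall⟩, fun b hb hbu => ?_⟩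
  obtain ⟨p, hp, q', hqp, hq'⟩ := hstep b hb hbu
  exact ⟨p, hp, hall q' hq' ▸ hqp⟩

/-- A connected graph in which every vertex but the last is joined to a later one, and no other
edges, is a tree. -/
theorem isTree_of_parent {N : ℕ} (hN : 0 < N) (par : Fin N → Fin N)
    (hpar : ∀ t : Fin N, t.val + 1 < N → t < par t) :
    (SimpleGraph.fromRel fun a b : Fin N => a.val + 1 < N ∧ par a = b).IsTree := by
  classical
  set G := SimpleGraph.fromRel fun a b : Fin N => a.val + 1 < N ∧ par a = b with hG
  have hadj : ∀ a : Fin N, a.val + 1 < N → G.Adj a (par a) := fun a ha =>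
    (SimpleGraph.fromRel_adj _ _ _).2 ⟨(hpar a ha).ne, Or.inl ⟨ha, rfl⟩⟩
  have hreach : ∀ k : ℕ, ∀ a : Fin N, N - a.val ≤ k → G.Reachable a ⟨N - 1, by omega⟩ := by
    intro k
    induction k with
    | zero => intro a ha; have := a.2; omega
    | succ k ih =>
      intro a ha
      by_cases h : a.val + 1 < N
      · have h1 := hpar a h
        exact (hadj a h).reachable.trans (ih _ (by have := Fin.lt_def.1 h1; omega))
      · have : a = ⟨N - 1, by omega⟩ := Fin.ext (by have := a.2; simp; omega)
        rw [this]
  have : Nonempty (Fin N) := ⟨⟨0, hN⟩⟩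
  have hconn : G.Connected := ⟨fun a b => (hreach _ a le_rfl).trans (hreach _ b le_rfl).symm⟩
  refine isTree_iff_connected_and_card.2 ⟨hconn, le_antisymm ?_ ?_⟩
  -- Every edge comes from one of the vertices other than the last, so there are at most `N - 1` of
  -- them; a connected graph with so few edges is a tree.
  · have hsub : G.edgeSet ⊆ ↑((Finset.univ.filter fun a : Fin N => a.val + 1 < N).image
        fun a => s(a, par a)) := by
      intro e
      induction e with
      | _ a b =>
        intro he
        have h := ((SimpleGraph.fromRel_adj _ _ _).1 ((SimpleGraph.mem_edgeSet G).1 he)).2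
        rw [Finset.mem_coe, Finset.mem_image]
        rcases h with ⟨h1, h2⟩ | ⟨h1, h2⟩
        · exact ⟨a, by simpa using h1, by rw [h2]⟩
        · exact ⟨b, by simpa using h1, by rw [h2, Sym2.eq_swap]⟩
    have h1 := Set.ncard_le_ncard hsub (Finset.finite_toSet _)
    rw [Set.ncard_coe_finset] at h1
    have h2 : (Finset.univ.filter fun a : Fin N => a.val + 1 < N).card < N := by
      have := Finset.card_lt_card (s := Finset.univ.filter fun a : Fin N => a.val + 1 < N)
        (t := Finset.univ) (Finset.filter_ssubset.2 ⟨⟨N - 1, by omega⟩, Finset.mem_univ _, by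
          simp; omega⟩)
      simpa using this
    have h3 := Finset.card_image_le (s := Finset.univ.filter fun a : Fin N => a.val + 1 < N)
      (f := fun a => s(a, par a))
    rw [Nat.card_coe_set_eq, Nat.card_eq_fintype_card, Fintype.card_fin]
    omega
  · exact hconn.card_vert_le_card_edgeSet_add_one

end SimpleGraph

/-! ### Tree decompositions with few nodes -/

namespace TreeDecomposition

/-- The running intersection property of a list of bags. -/
def RunningInter {α : Type*} [DecidableEq α] : List (Finset α) → Prop
  | [] => True
  | V :: l => RunningInter l ∧ (l = [] ∨ ∃ W ∈ l, ∀ X ∈ l, V ∩ X ⊆ W)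

/-- A leaf of the remaining subtree is removed and its bag put in front. Every path from the leaf to
another remaining node passes through its neighbour, whose bag therefore contains all the
intersections. -/
theorem exists_runningInter {n N : ℕ} {G : SimpleGraph (Fin n)} (D : TreeDecomposition G N)
    (S : Finset (Fin N)) (hS : D.tree.PathClosed S) :
    ∃ l : List (Finset (Fin n)), RunningInter l ∧ ∀ V, V ∈ l ↔ ∃ t ∈ S, D.bag t = V := by
  classical
  induction hc : S.card using Nat.strong_induction_on generalizing S with
  | _ c ih =>
    rcases Nat.lt_or_ge S.card 2 with h | h
    · rcases Nat.lt_or_ge S.card 1 with h0 | h1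
      · have : S = ∅ := Finset.card_eq_zero.1 (by omega)
        subst this
        exact ⟨[], trivial, by simp⟩
      · obtain ⟨t, rfl⟩ := Finset.card_eq_one.1 (show S.card = 1 by omega)
        exact ⟨[D.bag t], ⟨trivial, Or.inl rfl⟩, by simp [eq_comm]⟩
    · obtain ⟨u, huS, hu⟩ := hS.exists_leaf D.isTree h
      obtain ⟨q, hq, hpath⟩ := hS.exists_parent D.isTree huS hu h
      obtain ⟨l, hl, hmem⟩ := ih (S.erase u).card
        (by rw [← hc]; exact Finset.card_lt_card (Finset.erase_ssubset huS)) (S.erase u)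
        (hS.erase hu) rfl
      have hqS : q ∈ S.filter (D.tree.Adj u) := by rw [hq]; simp
      have hqS' := Finset.mem_filter.1 hqS
      refine ⟨D.bag u :: l, ⟨hl, Or.inr ⟨D.bag q, (hmem _).2 ⟨q, Finset.mem_erase.2
        ⟨hqS'.2.ne', hqS'.1⟩, rfl⟩, fun X hX => ?_⟩⟩, fun V => ?_⟩
      · obtain ⟨t, ht, rfl⟩ := (hmem X).1 hX
        obtain ⟨htu, htS⟩ := Finset.mem_erase.1 ht
        obtain ⟨p, hp, hqp⟩ := hpath t htS htu
        exact D.path u q t p hp hqp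
      · rw [List.mem_cons, hmem]
        constructor
        · rintro (rfl | ⟨t, ht, rfl⟩)
          · exact ⟨u, huS, rfl⟩
          · exact ⟨t, Finset.mem_of_mem_erase ht, rfl⟩
        · rintro ⟨t, ht, rfl⟩
          by_cases htu : t = u
          · left; rw [htu]
          · right; exact ⟨t, Finset.mem_erase.2 ⟨htu, ht⟩, rfl⟩

/-- A bag contained in one already kept is dropped; any other bag brings a vertex that occurs in no
later bag, so the length is bounded by the number of vertices. -/
theorem RunningInter.exists_short {α : Type*} [DecidableEq α] (l : List (Finset α))
    (hl : RunningInter l) (hne : l ≠ []) : ∃ l' : List (Finset α), RunningInter l' ∧ l' ≠ [] ∧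
      (∀ V ∈ l', V ∈ l) ∧ (∀ V ∈ l, ∃ W ∈ l', V ⊆ W) ∧ ∀ U : Finset α, (∀ V ∈ l, V ⊆ U) →
        l'.length ≤ max U.card 1 := by
  induction l with
  | nil => exact absurd rfl hne
  | cons V l ih =>
    rcases eq_or_ne l [] with rfl | hl0
    · exact ⟨[V], ⟨trivial, Or.inl rfl⟩, by simp, by simp, by simp, fun U _ => by simp⟩
    obtain ⟨l', h1, h2, h3, h4, h5⟩ := ih hl.1 hl0
    by_cases hV : ∃ W ∈ l', V ⊆ W
    · refine ⟨l', h1, h2, fun W hW => List.mem_cons_of_mem _ (h3 W hW), ?_, ?_⟩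
      · intro W hW
        rcases List.mem_cons.1 hW with rfl | hW
        · exact hV
        · exact h4 W hW
      · exact fun U hU => h5 U fun W hW => hU W (List.mem_cons_of_mem _ hW)
    -- An empty bag must not be kept behind a nonempty one: `{v}` followed by `∅` would be two bags
    -- on a single vertex.
    by_cases hempty : ∀ W ∈ l, W = ∅
    · refine ⟨[V], ⟨trivial, Or.inl rfl⟩, by simp, by simp, ?_, fun U _ => by simp⟩
      intro W hW
      rcases List.mem_cons.1 hW with rfl | hW
      · exact ⟨W, by simp, le_rfl⟩
      · exact ⟨V, by simp, by rw [hempty W hW]; simp⟩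
    obtain ⟨W₀, hW₀, hW₀'⟩ : ∃ W ∈ l, W ≠ ∅ := by push Not at hempty; simpa [Finset.nonempty_iff_ne_empty] using hempty
    obtain ⟨W, hW, hVW⟩ := hl.2.resolve_left hl0
    obtain ⟨W', hW', hWW'⟩ := h4 W hW
    refine ⟨V :: l', ⟨h1, Or.inr ⟨W', hW', fun X hX => (hVW X (h3 X hX)).trans hWW'⟩⟩,
      by simp, ?_, ?_, ?_⟩
    · intro X hX
      rcases List.mem_cons.1 hX with rfl | hX
      · simp
      · exact List.mem_cons_of_mem _ (h3 X hX)
    · intro X hX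
      rcases List.mem_cons.1 hX with rfl | hX
      · exact ⟨X, by simp, le_rfl⟩
      · obtain ⟨Y, hY, hXY⟩ := h4 X hX
        exact ⟨Y, List.mem_cons_of_mem _ hY, hXY⟩
    · intro U hU
      -- By running intersection such a `v` is in no bag of the tail, so the tail lives in `U.erase
      -- v`. This set is nonempty because some later bag is, so the maximum with `1` in its bound
      -- plays no role.
      obtain ⟨v, hv, hvW⟩ : ∃ v ∈ V, v ∉ W' := by
        by_contra hcon
        push Not at hcon
        exact hV ⟨W', hW', hcon⟩
      have hnot : ∀ X ∈ l, v ∉ X := fun X hX hvX =>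
        hvW (hWW' (hVW X hX (Finset.mem_inter.2 ⟨hv, hvX⟩)))
      have h6 := h5 (U.erase v) fun X hX => Finset.subset_erase.2
        ⟨hU X (List.mem_cons_of_mem _ hX), hnot X hX⟩
      have h7 : v ∈ U := hU V (by simp) hv
      have h8 : 0 < (U.erase v).card := by
        obtain ⟨x, hx⟩ := Finset.nonempty_iff_ne_empty.2 hW₀'
        exact Finset.card_pos.2 ⟨x, Finset.mem_erase.2
          ⟨fun he => hnot W₀ hW₀ (he ▸ hx), hU W₀ (List.mem_cons_of_mem _ hW₀) hx⟩⟩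
      rw [Finset.card_erase_of_mem h7] at h6 h8
      rw [List.length_cons]
      omega

theorem RunningInter.exists_parent {α : Type*} [DecidableEq α] (l : List (Finset α))
    (hl : RunningInter l) (t : ℕ) (ht : t + 1 < l.length) :
    ∃ j, t < j ∧ j < l.length ∧ ∀ k, t < k → k < l.length →
      l.getD t ∅ ∩ l.getD k ∅ ⊆ l.getD j ∅ := by
  induction l generalizing t with
  | nil => simp at ht
  | cons V l ih =>
    rw [List.length_cons] at ht
    cases t with
    | zero =>
      have hl0 : l ≠ [] := by rintro rfl; simp at ht
      obtain ⟨W, hW, hVW⟩ := hl.2.resolve_left hl0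
      obtain ⟨j, hj, rfl⟩ := List.mem_iff_getElem.1 hW
      refine ⟨j + 1, by omega, by simpa using hj, fun k hk hkl => ?_⟩
      obtain ⟨k, rfl⟩ : ∃ k', k = k' + 1 := ⟨k - 1, by omega⟩
      rw [List.length_cons] at hkl
      have hk' : k < l.length := by omega
      rw [List.getD_cons_zero, List.getD_cons_succ, List.getD_cons_succ,
        List.getD_eq_getElem _ _ hj, List.getD_eq_getElem _ _ hk']
      exact hVW _ (List.getElem_mem hk')
    | succ t =>
      obtain ⟨j, h1, h2, h3⟩ := ih hl.1 t (by omega)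
      refine ⟨j + 1, by omega, by simpa using h2, fun k hk hkl => ?_⟩
      obtain ⟨k, rfl⟩ : ∃ k', k = k' + 1 := ⟨k - 1, by omega⟩
      rw [List.length_cons] at hkl
      simpa using h3 k (by omega) (by omega)

/-- Each position but the last is joined to the later position whose bag contains its intersections
with all later bags. -/
theorem exists_of_runningInter {n : ℕ} {G : SimpleGraph (Fin n)} (l : List (Finset (Fin n)))
    (hl : RunningInter l) (hne : l ≠ []) (hcover : ∀ v, ∃ V ∈ l, v ∈ V)
    (hclique : ∀ K : Finset (Fin n), G.IsClique (K : Set (Fin n)) → ∃ V ∈ l, K ⊆ V) :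
    ∃ D : TreeDecomposition G l.length, ∀ t, D.bag t ∈ l := by
  classical
  have hpos : 0 < l.length := List.length_pos_iff.2 hne
  have hex : ∀ t : Fin l.length, ∃ j : Fin l.length, t.val + 1 < l.length →
      t < j ∧ ∀ k : Fin l.length, t < k → l.get t ∩ l.get k ⊆ l.get j := by
    intro t
    by_cases ht : t.val + 1 < l.length
    · obtain ⟨j, h1, h2, h3⟩ := hl.exists_parent l t ht
      refine ⟨⟨j, h2⟩, fun _ => ⟨h1, fun k hk => ?_⟩⟩
      have := h3 k hk k.2
      rwa [List.getD_eq_getElem _ _ k.2, List.getD_eq_getElem _ _ h2,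
        List.getD_eq_getElem _ _ t.2] at this
    · exact ⟨t, fun h => absurd h ht⟩
  choose par hpar using hex
  have htree := SimpleGraph.isTree_of_parent hpos par fun t ht => (hpar t ht).1
  set T := SimpleGraph.fromRel fun a b : Fin l.length => a.val + 1 < l.length ∧ par a = b with hT
  have hmem : ∀ V, V ∈ l ↔ ∃ t : Fin l.length, l.get t = V := fun V => List.mem_iff_get
  refine ⟨⟨T, htree, l.get, fun v => ?_, fun K hK => ?_, ?_⟩, fun t => List.get_mem l t⟩
  · obtain ⟨V, hV, hv⟩ := hcover v
    obtain ⟨t, rfl⟩ := (hmem V).1 hV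
    exact ⟨t, hv⟩
  · obtain ⟨V, hV, hv⟩ := hclique K hK
    obtain ⟨t, rfl⟩ := (hmem V).1 hV
    exact ⟨t, hv⟩
  · intro t₁ t₂ t₃ p hp ht₂ v hv
    obtain ⟨hv1, hv3⟩ := Finset.mem_inter.1 hv
    -- The last bag that contains `v`. From any other bag with `v` the parent also contains `v`, so
    -- following parents leads to `top` through bags with `v` only.
    obtain ⟨top, htop, hmax⟩ := Finset.exists_max_image
      (Finset.univ.filter fun t : Fin l.length => v ∈ l.get t) id ⟨t₁, by simpa using hv1⟩
    have htop' : v ∈ l.get top := by simpa using htop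
    have hwalk : ∀ k : ℕ, ∀ t : Fin l.length, v ∈ l.get t → l.length - t.val ≤ k →
        ∃ q : T.Walk t top, ∀ x ∈ q.support, v ∈ l.get x := by
      intro k
      induction k with
      | zero => intro t _ ht; have := t.2; omega
      | succ k ih =>
        intro t ht hk
        rcases (hmax t (by simpa using ht)).eq_or_lt with h | h
        · have h' : t = top := h
          subst h'
          exact ⟨SimpleGraph.Walk.nil, by simpa using ht⟩
        · have h' : t < top := h
          have hlt : t.val + 1 < l.length := by have := Fin.lt_def.1 h'; omega
          obtain ⟨h1, h2⟩ := hpar t hlt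
          obtain ⟨q, hq⟩ := ih (par t) (h2 top h' (Finset.mem_inter.2 ⟨ht, htop'⟩))
            (by have := Fin.lt_def.1 h1; omega)
          have hadj : T.Adj t (par t) :=
            (SimpleGraph.fromRel_adj _ _ _).2 ⟨h1.ne, Or.inl ⟨hlt, rfl⟩⟩
          refine ⟨SimpleGraph.Walk.cons hadj q, fun x hx => ?_⟩
          rw [SimpleGraph.Walk.support_cons] at hx
          rcases List.mem_cons.1 hx with rfl | hx
          · exact ht
          · exact hq x hx
    obtain ⟨q1, hq1⟩ := hwalk _ t₁ hv1 le_rfl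
    obtain ⟨q3, hq3⟩ := hwalk _ t₃ hv3 le_rfl
    -- Paths in a tree are unique, so `p` uses only nodes of the walk from `t₁` to `top` and back to
    -- `t₃`.
    have heq := (htree.isAcyclic.subsingleton_path t₁ t₃).elim ⟨p, hp⟩ (q1.append q3.reverse).toPath
    have hp' : p = ((q1.append q3.reverse).toPath : T.Walk t₁ t₃) := congrArg Subtype.val heq
    have h2 : t₂ ∈ (q1.append q3.reverse).support := by
      rw [hp'] at ht₂
      exact SimpleGraph.Walk.support_toPath_subset_support _ ht₂
    rw [SimpleGraph.Walk.mem_support_append_iff, SimpleGraph.Walk.support_reverse,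
      List.mem_reverse] at h2
    rcases h2 with h2 | h2
    · exact hq1 _ h2
    · exact hq3 _ h2

theorem nodes_pos {n N : ℕ} {G : SimpleGraph (Fin n)} (D : TreeDecomposition G N) : 0 < N := by
  obtain ⟨t⟩ := D.isTree.connected.nonempty
  have := t.2
  omega

/-- A graph has a tree decomposition of least width with at most as many nodes as vertices. -/
theorem exists_width_eq_treeWidth {n : ℕ} (hn : 1 ≤ n) (G : SimpleGraph (Fin n)) :
    ∃ N ≤ n, ∃ D : TreeDecomposition G N, D.width = treeWidth G := by
  classical
  have hne : {k | ∃ (N : ℕ) (D : TreeDecomposition G N), D.width = k}.Nonempty := by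
    obtain ⟨D, -⟩ := exists_of_runningInter (G := G) [Finset.univ] ⟨trivial, Or.inl rfl⟩ (by simp)
      (by simp) (by simp)
    exact ⟨_, _, D, rfl⟩
  obtain ⟨N, D, hD⟩ := Nat.sInf_mem hne
  obtain ⟨l, hl, hmem⟩ := D.exists_runningInter Finset.univ SimpleGraph.pathClosed_univ
  have hl0 : l ≠ [] := by
    rintro rfl
    have := (hmem (D.bag ⟨0, D.nodes_pos⟩)).2 ⟨_, Finset.mem_univ _, rfl⟩
    simp at this
  -- Every bag in `l'` is a bag of the optimal decomposition, so the width does not grow; every bag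
  -- of the latter is contained in one of `l'`, so vertices and cliques remain covered.
  obtain ⟨l', h1, h2, h3, h4, h5⟩ := hl.exists_short l hl0
  obtain ⟨D', hD'⟩ := exists_of_runningInter (G := G) l' h1 h2
    (fun v => by
      obtain ⟨t, ht⟩ := D.cover v
      obtain ⟨W, hW, hVW⟩ := h4 _ ((hmem _).2 ⟨t, Finset.mem_univ _, rfl⟩)
      exact ⟨W, hW, hVW ht⟩)
    (fun K hK => by
      obtain ⟨t, ht⟩ := D.clique K hK
      obtain ⟨W, hW, hVW⟩ := h4 _ ((hmem _).2 ⟨t, Finset.mem_univ _, rfl⟩)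
      exact ⟨W, hW, ht.trans hVW⟩)
  refine ⟨l'.length, ?_, D', le_antisymm ?_ (Nat.sInf_le ⟨_, D', rfl⟩)⟩
  · have := h5 Finset.univ fun V _ => Finset.subset_univ V
    simp only [Finset.card_univ, Fintype.card_fin] at this
    omega
  · refine le_trans ?_ hD.le
    refine Nat.sub_le_sub_right (Finset.sup_le fun t _ => ?_) 1
    obtain ⟨t', -, ht'⟩ := (hmem _).1 (h3 _ (hD' t))
    rw [← ht']
    exact Finset.le_sup (f := fun t => (D.bag t).card) (Finset.mem_univ t')

end TreeDecomposition

/-! ### A program logic -/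

namespace RealRAM

namespace State

@[simp] theorem putNat_real (s : State) (a i x : ℕ) : (s.putNat a i x).real = s.real := rfl

@[simp] theorem putNat_nat_self (s : State) (a i x : ℕ) :
    (s.putNat a i x).nat a = Function.update (s.nat a) i x := Function.update_self _ _ _

@[simp] theorem putNat_nat_of_ne (s : State) {a b : ℕ} (i x : ℕ) (h : b ≠ a) :
    (s.putNat a i x).nat b = s.nat b := Function.update_of_ne h _ _

@[simp] theorem putReal_real_self (s : State) (a i : ℕ) (x : ℝ) :
    (s.putReal a i x).real a = Function.update (s.real a) i x := Function.update_self _ _ _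

@[simp] theorem putReal_real_of_ne (s : State) {a b : ℕ} (i : ℕ) (x : ℝ) (h : b ≠ a) :
    (s.putReal a i x).real b = s.real b := Function.update_of_ne h _ _

end State

namespace Program

/-- The effect of a program without loops. -/
noncomputable def exec : Program → State → State
  | skip, s => s
  | setNat a i e, s => s.putNat a (i.eval s) (e.eval s)
  | setReal a i e, s => s.putReal a (i.eval s) (e.eval s)
  | seq P Q, s => Q.exec (P.exec s)
  | ite b P Q, s => open Classical in if b.Holds s then P.exec s else Q.exec s
  | loop _ _, s => s

theorem exec_ite_pos {b : Test} {P Q : Program} {s : State} (h : b.Holds s) :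
    (ite b P Q).exec s = P.exec s := if_pos h

theorem exec_ite_neg {b : Test} {P Q : Program} {s : State} (h : ¬ b.Holds s) :
    (ite b P Q).exec s = Q.exec s := if_neg h

/-- Whether a program has no loops. -/
def straight : Program → Bool
  | skip => true
  | setNat _ _ _ => true
  | setReal _ _ _ => true
  | seq P Q => P.straight && Q.straight
  | ite _ P Q => P.straight && Q.straight
  | loop _ _ => false

/-- A bound for the running time of a program without loops. -/
def time : Program → ℕ
  | skip => 1
  | setNat _ i e => i.cost + e.cost + 1
  | setReal _ i e => i.cost + e.cost + 1
  | seq P Q => P.time + Q.time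
  | ite b P Q => b.cost + max P.time Q.time + 1
  | loop _ _ => 0

/-- Whether a program may write to the array `a` of natural numbers. -/
def writesNat (a : ℕ) : Program → Bool
  | skip => false
  | setNat b _ _ => decide (a = b)
  | setReal _ _ _ => false
  | seq P Q => P.writesNat a || Q.writesNat a
  | ite _ P Q => P.writesNat a || Q.writesNat a
  | loop _ P => P.writesNat a

/-- Whether a program may write to the array `a` of real numbers. -/
def writesReal (a : ℕ) : Program → Bool
  | skip => false
  | setNat _ _ _ => false
  | setReal b _ _ => decide (a = b)
  | seq P Q => P.writesReal a || Q.writesReal a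
  | ite _ P Q => P.writesReal a || Q.writesReal a
  | loop _ P => P.writesReal a

end Program

/-- The states `s` and `s'` differ only in arrays that `P` may write to. -/
structure Same (P : Program) (s s' : State) : Prop where
  nat : ∀ a, P.writesNat a = false → s'.nat a = s.nat a
  real : ∀ a, P.writesReal a = false → s'.real a = s.real a

theorem Same.refl (P : Program) (s : State) : Same P s s := ⟨fun _ _ => rfl, fun _ _ => rfl⟩

theorem Same.trans {P : Program} {s s' s'' : State} (h : Same P s s') (h' : Same P s' s'') :
    Same P s s'' :=
  ⟨fun a ha => (h'.nat a ha).trans (h.nat a ha), fun a ha => (h'.real a ha).trans (h.real a ha)⟩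

theorem Same.mono {P Q : Program} {s s' : State} (h : Same P s s')
    (hn : ∀ a, Q.writesNat a = false → P.writesNat a = false)
    (hr : ∀ a, Q.writesReal a = false → P.writesReal a = false) : Same Q s s' :=
  ⟨fun a ha => h.nat a (hn a ha), fun a ha => h.real a (hr a ha)⟩

/-- The frame rule. Which arrays may change is read off the program, so for a concrete program and
array the side condition is closed by `rfl`. -/
theorem Runs.same {P : Program} {s s' : State} {k : ℕ} (h : Runs P s k s') : Same P s s' := by
  induction h with
  | skip s => exact Same.refl _ _
  | setNat s b i e =>
    refine ⟨fun a ha => State.putNat_nat_of_ne _ _ _ ?_, fun _ _ => rfl⟩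
    rintro rfl
    simp [Program.writesNat] at ha
  | setReal s b i e =>
    refine ⟨fun _ _ => rfl, fun a ha => State.putReal_real_of_ne _ _ _ ?_⟩
    rintro rfl
    simp [Program.writesReal] at ha
  | seq _ _ h1 h2 =>
    exact (h1.mono (fun a ha => by simp_all [Program.writesNat])
      (fun a ha => by simp_all [Program.writesReal])).trans
      (h2.mono (fun a ha => by simp_all [Program.writesNat])
      (fun a ha => by simp_all [Program.writesReal]))
  | ite_true _ _ h1 =>
    exact h1.mono (fun a ha => by simp_all [Program.writesNat])
      (fun a ha => by simp_all [Program.writesReal])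
  | ite_false _ _ h1 =>
    exact h1.mono (fun a ha => by simp_all [Program.writesNat])
      (fun a ha => by simp_all [Program.writesReal])
  | loop_true _ _ _ h1 h2 =>
    exact (h1.mono (fun a ha => by simpa [Program.writesNat] using ha)
      (fun a ha => by simpa [Program.writesReal] using ha)).trans h2
  | loop_false _ => exact Same.refl _ _

/-- `P`, started in `s`, halts within time `c` in a state that satisfies `R`. -/
def Spec (P : Program) (s : State) (c : ℕ) (R : State → Prop) : Prop :=
  ∃ k s', Runs P s k s' ∧ k ≤ c ∧ R s'

namespace Spec

variable {P Q : Program} {s : State} {c c' : ℕ} {R R' : State → Prop}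

theorem weaken (h : Spec P s c R) (hc : c ≤ c') : Spec P s c' R := by
  obtain ⟨k, s', h1, h2, h3⟩ := h
  exact ⟨k, s', h1, h2.trans hc, h3⟩

theorem post (h : Spec P s c R) (hR : ∀ s', Same P s s' → R s' → R' s') : Spec P s c R' := by
  obtain ⟨k, s', h1, h2, h3⟩ := h
  exact ⟨k, s', h1, h2, hR s' h1.same h3⟩

theorem seq (h : Spec P s c R) (h' : ∀ s', Same P s s' → R s' → Spec Q s' c' R') :
    Spec (.seq P Q) s (c + c') R' := by
  obtain ⟨k, s', h1, h2, h3⟩ := h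
  obtain ⟨k', s'', h1', h2', h3'⟩ := h' s' h1.same h3
  exact ⟨_, s'', .seq h1 h1', add_le_add h2 h2', h3'⟩

/-- For code without loops, evaluating `exec` replaces derivations of `Runs`; the time bound takes
the longer branch of every test. -/
theorem straight (P : Program) (s : State) {R : State → Prop} (hP : P.straight = true)
    (hR : R (P.exec s)) : Spec P s P.time R := by
  have key : ∀ s, ∃ k, Runs P s k (P.exec s) ∧ k ≤ P.time := by
    clear hR
    induction P with
    | skip => exact fun s => ⟨_, .skip s, le_rfl⟩
    | setNat a i e => exact fun s => ⟨_, .setNat s a i e, le_rfl⟩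
    | setReal a i e => exact fun s => ⟨_, .setReal s a i e, le_rfl⟩
    | seq P Q ihP ihQ =>
      intro s
      simp only [Program.straight, Bool.and_eq_true] at hP
      obtain ⟨k, h1, h2⟩ := ihP hP.1 s
      obtain ⟨k', h1', h2'⟩ := ihQ hP.2 (P.exec s)
      exact ⟨_, .seq h1 h1', add_le_add h2 h2'⟩
    | ite b P Q ihP ihQ =>
      intro s
      simp only [Program.straight, Bool.and_eq_true] at hP
      by_cases hb : b.Holds s
      · obtain ⟨k, h1, h2⟩ := ihP hP.1 s
        refine ⟨_, ?_, (by simp only [Program.time]; omega : b.cost + k + 1 ≤ _)⟩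
        rw [Program.exec, if_pos hb]
        exact .ite_true hb h1
      · obtain ⟨k, h1, h2⟩ := ihQ hP.2 s
        refine ⟨_, ?_, (by simp only [Program.time]; omega : b.cost + k + 1 ≤ _)⟩
        rw [Program.exec, if_neg hb]
        exact .ite_false hb h1
    | loop b P => simp [Program.straight] at hP
  obtain ⟨k, h1, h2⟩ := key s
  exact ⟨k, _, h1, h2, hR⟩

end Spec

/-- The scalar variable `a`. -/
abbrev NatExp.var (a : ℕ) : NatExp := .get a (.lit 0)

/-- `for i < b do P`. -/
def Program.forN (i : ℕ) (b : NatExp) (P : Program) : Program :=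
  .seq (.setNat i (.lit 0) (.lit 0))
    (.loop (.natLt (.var i) b)
      (.seq P (.setNat i (.lit 0) (.add (.var i) (.lit 1)))))

/-- A round costs `b.cost + 4` for the successful test and 6 for the increment, besides the body;
setting the counter to zero and the failing test at the end make up `b.cost + 7`. The costs vary
with the round because several tables double or triple in every round. -/
theorem Spec.forN_of_cost {i : ℕ} {b : NatExp} {P : Program} {s : State} (n : ℕ) (c : ℕ → ℕ)
    (I : ℕ → State → Prop)
    (hi : P.writesNat i = false) (hb : ∀ s', Same (.forN i b P) s s' → b.eval s' = n)
    (h0 : I 0 (s.putNat i 0 0))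
    (hstep : ∀ j < n, ∀ s', Same (.forN i b P) s s' → s'.nat i 0 = j → I j s' →
      Spec P s' (c j) fun s'' => I (j + 1) (s''.putNat i 0 (j + 1))) :
    Spec (.forN i b P) s (∑ j ∈ Finset.range n, (c j + b.cost + 10) + b.cost + 7) (I n) := by
  have hput : ∀ s' x, Same (.forN i b P) s s' → Same (.forN i b P) s (s'.putNat i 0 x) := by
    intro s' x h
    refine h.trans ⟨fun a ha => State.putNat_nat_of_ne _ _ _ ?_, fun _ _ => rfl⟩
    rintro rfl
    simp [Program.forN, Program.writesNat] at ha
  have key : ∀ r j s', j + r = n → Same (.forN i b P) s s' → s'.nat i 0 = j → I j s' →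
      Spec (.loop (.natLt (.var i) b) (.seq P (.setNat i (.lit 0) (.add (.var i) (.lit 1))))) s'
        (∑ k ∈ Finset.Ico j n, (c k + b.cost + 10) + b.cost + 4) (I n) := by
    intro r
    induction r with
    | zero =>
      intro j s' hj hs hij hI
      have hnot : ¬ (Test.natLt (.var i) b).Holds s' := by
        simp only [Test.Holds, NatExp.eval, hij, hb s' hs]; omega
      refine ⟨_, s', .loop_false hnot, ?_, by rw [add_zero] at hj; subst hj; exact hI⟩
      simp only [Test.cost, NatExp.cost]; omega
    | succ r ih =>
      intro j s' hj hs hij hI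
      have hlt : (Test.natLt (.var i) b).Holds s' := by
        simp only [Test.Holds, NatExp.eval, hij, hb s' hs]; omega
      obtain ⟨k, s'', h1, h2, h3⟩ := hstep j (by omega) s' hs hij hI
      have hs2 : Same (.forN i b P) s s'' := hs.trans (h1.same.mono
        (fun a ha => by
          simp only [Program.forN, Program.writesNat, Bool.or_eq_false_iff] at ha; exact ha.2.1)
        (fun a ha => by
          simp only [Program.forN, Program.writesReal, Bool.or_eq_false_iff] at ha; exact ha.2.1))
      have hi2 : s''.nat i 0 = j := by rw [h1.same.nat i hi, hij]
      have hrun := Runs.setNat s'' i (.lit 0) (.add (.var i) (.lit 1))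
      simp only [NatExp.eval, hi2] at hrun
      obtain ⟨l, t, h1', h2', h3'⟩ := ih (j + 1) (s''.putNat i 0 (j + 1)) (by omega)
        (hput _ _ hs2) (by simp) h3
      refine ⟨_, t, .loop_true hlt (.seq h1 hrun) h1', ?_, h3'⟩
      simp only [Test.cost, NatExp.cost]
      rw [Finset.sum_eq_sum_Ico_succ_bot (by omega : j < n)]
      omega
  obtain ⟨k, s', h1, h2, h3⟩ := key n 0 (s.putNat i 0 0) (by omega) (hput _ _ (Same.refl _ _))
    (by simp) h0
  refine ⟨_, s', .seq (Runs.setNat s i (.lit 0) (.lit 0)) h1, ?_, h3⟩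
  simp only [NatExp.cost, ← Finset.range_eq_Ico] at h2 ⊢
  omega

theorem Spec.forN {i : ℕ} {b : NatExp} {P : Program} {s : State} (n c : ℕ) (I : ℕ → State → Prop)
    (hi : P.writesNat i = false) (hb : ∀ s', Same (.forN i b P) s s' → b.eval s' = n)
    (h0 : I 0 (s.putNat i 0 0))
    (hstep : ∀ j < n, ∀ s', Same (.forN i b P) s s' → s'.nat i 0 = j → I j s' →
      Spec P s' c fun s'' => I (j + 1) (s''.putNat i 0 (j + 1))) :
    Spec (.forN i b P) s (n * (c + b.cost + 10) + b.cost + 7) (I n) := by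
  refine (Spec.forN_of_cost n (fun _ => c) I hi hb h0 hstep).weaken ?_
  simp

/-- `for i < b do d[o + i] := e`. -/
def Program.fill (i : ℕ) (b : NatExp) (d : ℕ) (o : NatExp) (e : RealExp) : Program :=
  .forN i b (.setReal d (.add o (.var i)) e)

/-- The value of a round may be read from cells of `d` outside the block and from cells of the block
filled before; this is how a table is doubled in place. -/
theorem Spec.fill {i : ℕ} {b : NatExp} {d : ℕ} {o : NatExp} {e : RealExp} {s : State}
    (n D : ℕ) (val : ℕ → ℝ)
    (hb : ∀ s', (∀ a ≠ i, s'.nat a = s.nat a) → b.eval s' = n)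
    (h : ∀ j < n, ∀ s', (∀ a ≠ i, s'.nat a = s.nat a) → (∀ a ≠ d, s'.real a = s.real a) →
      (∀ x, x < D ∨ D + n ≤ x → s'.real d x = s.real d x) →
      (∀ x < j, s'.real d (D + x) = val x) →
      s'.nat i 0 = j → o.eval s' = D ∧ e.eval s' = val j) :
    Spec (.fill i b d o e) s (n * (o.cost + e.cost + b.cost + 14) + b.cost + 7) fun s' =>
      (∀ x < n, s'.real d (D + x) = val x) ∧
        ∀ x, x < D ∨ D + n ≤ x → s'.real d x = s.real d x := by
  have hsame : ∀ {s'}, Same (.fill i b d o e) s s' →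
      (∀ a ≠ i, s'.nat a = s.nat a) ∧ ∀ a ≠ d, s'.real a = s.real a := fun {s'} hs =>
    ⟨fun a ha => hs.nat a (by simp [Program.fill, Program.forN, Program.writesNat, ha]),
      fun a ha => hs.real a (by simp [Program.fill, Program.forN, Program.writesReal, ha])⟩
  refine (Spec.forN n (o.cost + e.cost + 4) (fun j s' => (∀ x < j, s'.real d (D + x) = val x) ∧
    ∀ x, x < D ∨ D + n ≤ x → s'.real d x = s.real d x) rfl (fun s' hs => hb s' (hsame hs).1)
    ⟨by simp, fun x _ => rfl⟩ fun j hj s' hs hij hI => ?_).weaken (le_of_eq (by ring))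
  obtain ⟨h1, h2⟩ := h j hj s' (hsame hs).1 (hsame hs).2 hI.2 hI.1 hij
  refine (Spec.straight _ _ rfl ?_).weaken (by simp only [Program.time, NatExp.cost]; omega)
  simp only [Program.exec, NatExp.eval, h1, h2, hij, State.putNat_real, State.putReal_real_self]
  refine ⟨fun x hx => ?_, fun x hx => ?_⟩
  · rcases Nat.lt_succ_iff_lt_or_eq.1 hx with hx | rfl
    · rw [Function.update_of_ne (by omega), hI.1 x hx]
    · rw [Function.update_self]
  · rw [Function.update_of_ne (by omega), hI.2 x hx]

/-- `for i < b do d[o + i] := e` for natural numbers. -/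
def Program.fillNat (i : ℕ) (b : NatExp) (d : ℕ) (o : NatExp) (e : NatExp) : Program :=
  .forN i b (.setNat d (.add o (.var i)) e)

/-- Here bound, offset and value may all read the array being written. The loop is unrolled by hand
so that the bound, too, is evaluated with the cells outside the block known to be intact, which the
frame in `Spec.forN` would not provide. -/
theorem Spec.fillNat {i : ℕ} {b : NatExp} {d : ℕ} {o : NatExp} {e : NatExp} {s : State}
    (n D : ℕ) (val : ℕ → ℕ) (hid : i ≠ d)
    (hb : ∀ s', (∀ a, a ≠ i → a ≠ d → s'.nat a = s.nat a) →
      (∀ x, x < D ∨ D + n ≤ x → s'.nat d x = s.nat d x) → b.eval s' = n)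
    (h : ∀ j < n, ∀ s', (∀ a, a ≠ i → a ≠ d → s'.nat a = s.nat a) →
      (∀ x, x < D ∨ D + n ≤ x → s'.nat d x = s.nat d x) →
      (∀ x < j, s'.nat d (D + x) = val x) →
      s'.nat i 0 = j → o.eval s' = D ∧ e.eval s' = val j) :
    Spec (.fillNat i b d o e) s (n * (o.cost + e.cost + b.cost + 14) + b.cost + 7) fun s' =>
      (∀ x < n, s'.nat d (D + x) = val x) ∧
        ∀ x, x < D ∨ D + n ≤ x → s'.nat d x = s.nat d x := by
  have hput : ∀ (s' : State) (x : ℕ), (s'.putNat i 0 x).nat d = s'.nat d := fun s' x =>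
    State.putNat_nat_of_ne _ _ _ hid.symm
  have key : ∀ r j s', j + r = n → (∀ a, a ≠ i → a ≠ d → s'.nat a = s.nat a) →
      (∀ x, x < D ∨ D + n ≤ x → s'.nat d x = s.nat d x) →
      (∀ x < j, s'.nat d (D + x) = val x) → s'.nat i 0 = j →
      Spec (.loop (.natLt (.var i) b) (.seq (.setNat d (.add o (.var i)) e)
        (.setNat i (.lit 0) (.add (.var i) (.lit 1))))) s'
        (r * (o.cost + e.cost + b.cost + 14) + b.cost + 4) fun s' =>
        (∀ x < n, s'.nat d (D + x) = val x) ∧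
        ∀ x, x < D ∨ D + n ≤ x → s'.nat d x = s.nat d x := by
    intro r
    induction r with
    | zero =>
      intro j s' hj h1 h2 h3 h4
      have hnot : ¬ (Test.natLt (.var i) b).Holds s' := by
        simp only [Test.Holds, NatExp.eval, h4, hb s' h1 h2]; omega
      refine ⟨_, s', .loop_false hnot, ?_, ?_⟩
      · simp only [Test.cost, NatExp.cost]; omega
      · rw [add_zero] at hj
        subst hj
        exact ⟨h3, h2⟩
    | succ r ih =>
      intro j s' hj h1 h2 h3 h4
      have hlt : (Test.natLt (.var i) b).Holds s' := by
        simp only [Test.Holds, NatExp.eval, h4, hb s' h1 h2]; omega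
      obtain ⟨ho, he⟩ := h j (by omega) s' h1 h2 h3 h4
      have hrun1 := Runs.setNat s' d (.add o (.var i)) e
      simp only [NatExp.eval, h4, ho, he] at hrun1
      have hrun2 := Runs.setNat (s'.putNat d (D + j) (val j)) i (.lit 0) (.add (.var i) (.lit 1))
      simp only [NatExp.eval, State.putNat_nat_of_ne _ _ _ hid, h4] at hrun2
      obtain ⟨l, t, h1', h2', h3'⟩ := ih (j + 1)
        ((s'.putNat d (D + j) (val j)).putNat i 0 (j + 1)) (by omega)
        (fun a ha ha' => by
          rw [State.putNat_nat_of_ne _ _ _ ha, State.putNat_nat_of_ne _ _ _ ha', h1 a ha ha'])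
        (fun x hx => by
          rw [hput, State.putNat_nat_self, Function.update_of_ne (by omega), h2 x hx])
        (fun x hx => by
          rw [hput, State.putNat_nat_self]
          rcases Nat.lt_succ_iff_lt_or_eq.1 hx with hx | rfl
          · rw [Function.update_of_ne (by omega), h3 x hx]
          · rw [Function.update_self]) (by simp)
      refine ⟨_, t, .loop_true hlt (.seq hrun1 hrun2) h1', ?_, h3'⟩
      simp only [Test.cost, NatExp.cost]
      rw [Nat.succ_mul]
      omega
  obtain ⟨k, s', h1, h2, h3⟩ := key n 0 (s.putNat i 0 0) (by omega)
    (fun a ha _ => State.putNat_nat_of_ne _ _ _ ha) (fun x _ => by rw [hput]) (by simp) (by simp)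
  refine ⟨_, s', .seq (Runs.setNat s i (.lit 0) (.lit 0)) h1, ?_, h3⟩
  simp only [NatExp.cost]
  omega

/-- `for i < b do if t then d[x] := d[x] + e`. -/
def Program.accum (i : ℕ) (b : NatExp) (t : Test) (d : ℕ) (x : NatExp) (e : RealExp) : Program :=
  .forN i b (.ite t (.setReal d x (.add (.get d x) e)) .skip)

/-- The expression `e` may read `d` itself, as long as it keeps to cells that are never a target;
`expNode` reads the lower part of a table while adding to the upper part. -/
theorem Spec.accum {i : ℕ} {b : NatExp} {t : Test} {d : ℕ} {x : NatExp} {e : RealExp} {s : State}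
    (n : ℕ) (cond : ℕ → Prop) [DecidablePred cond] (idx : ℕ → ℕ) (val : ℕ → ℝ)
    (hb : ∀ s', (∀ a ≠ i, s'.nat a = s.nat a) → b.eval s' = n)
    (h : ∀ j < n, ∀ s', (∀ a ≠ i, s'.nat a = s.nat a) → (∀ a ≠ d, s'.real a = s.real a) →
      (∀ y, (∀ j < n, y ≠ idx j) → s'.real d y = s.real d y) →
      s'.nat i 0 = j → x.eval s' = idx j ∧ e.eval s' = val j ∧ (t.Holds s' ↔ cond j)) :
    Spec (.accum i b t d x e) s (n * (2 * x.cost + e.cost + t.cost + b.cost + 14) + b.cost + 7)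
      fun s' => ∀ y, s'.real d y =
        s.real d y + ∑ j ∈ Finset.range n, if cond j ∧ idx j = y then val j else 0 := by
  have hsame : ∀ {s'}, Same (.accum i b t d x e) s s' →
      (∀ a ≠ i, s'.nat a = s.nat a) ∧ ∀ a ≠ d, s'.real a = s.real a := fun {s'} hs =>
    ⟨fun a ha => hs.nat a (by simp [Program.accum, Program.forN, Program.writesNat, ha]),
      fun a ha => hs.real a (by simp [Program.accum, Program.forN, Program.writesReal, ha])⟩
  refine (Spec.forN n (2 * x.cost + e.cost + t.cost + 4) (fun k s' => ∀ y, s'.real d y =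
    s.real d y + ∑ j ∈ Finset.range k, if cond j ∧ idx j = y then val j else 0) rfl
    (fun s' hs => hb s' (hsame hs).1) (fun y => by simp)
    fun j hj s' hs hij hI => ?_).weaken (le_of_eq (by ring))
  obtain ⟨h1, h2, h3⟩ := h j hj s' (hsame hs).1 (hsame hs).2 (fun y hy => by
    rw [hI, Finset.sum_eq_zero, add_zero]
    intro k hk
    rw [if_neg]
    exact fun hh => hy k ((Finset.mem_range.1 hk).trans hj) hh.2.symm) hij
  refine (Spec.straight _ _ rfl ?_).weaken
    (by simp only [Program.time, RealExp.cost]; omega)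
  intro y
  rw [State.putNat_real, Finset.sum_range_succ, ← add_assoc, ← hI y]
  by_cases hc : cond j
  · simp only [Program.exec, if_pos (h3.2 hc), RealExp.eval, h1, h2, State.putReal_real_self]
    by_cases hy : idx j = y
    · rw [← hy, Function.update_self, if_pos ⟨hc, rfl⟩]
    · rw [Function.update_of_ne (Ne.symm hy), if_neg (fun hh => hy hh.2), add_zero]
  · simp only [Program.exec, if_neg fun hh => hc (h3.1 hh)]
    rw [if_neg fun hh => hc hh.1, add_zero]

end RealRAM

/-! ### Tables indexed by bit masks -/

/-- The natural number whose binary digits are at the positions in `C`. -/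
def mask (C : Finset ℕ) : ℕ := ∑ c ∈ C, 2 ^ c

theorem mask_empty : mask ∅ = 0 := rfl

theorem mask_insert {c : ℕ} {C : Finset ℕ} (h : c ∉ C) : mask (insert c C) = 2 ^ c + mask C :=
  Finset.sum_insert h

theorem mask_union {C D : Finset ℕ} (h : Disjoint C D) : mask (C ∪ D) = mask C + mask D :=
  Finset.sum_union h

theorem mask_injective : Function.Injective mask := fun C D h => by
  rw [← Finset.toFinset_bitIndices_sum_two_pow C, ← Finset.toFinset_bitIndices_sum_two_pow D]
  exact congrArg (fun x : ℕ => x.bitIndices.toFinset) h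

theorem mask_lt {C : Finset ℕ} {K : ℕ} (h : C ⊆ Finset.range K) : mask C < 2 ^ K := by
  refine (Finset.sum_le_sum_of_subset h).trans_lt ?_
  rw [Nat.geomSum_eq le_rfl]
  have := Nat.one_le_two_pow (n := K)
  omega

theorem mask_mono {C D : Finset ℕ} (h : C ⊆ D) : mask C ≤ mask D := Finset.sum_le_sum_of_subset h

theorem mask_sdiff {C D : Finset ℕ} (h : C ⊆ D) : mask (D \ C) = mask D - mask C := by
  have := Finset.sum_sdiff (f := fun c => 2 ^ c) h
  simp only [mask]
  omega

theorem sum_mask {M : Type*} [AddCommMonoid M] (K : ℕ) (f : ℕ → M) :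
    ∑ x ∈ Finset.range (2 ^ K), f x = ∑ C ∈ (Finset.range K).powerset, f (mask C) := by
  induction K generalizing f with
  | zero => simp [mask_empty]
  | succ K ih =>
    rw [pow_succ, mul_two, Finset.sum_range_add, ih, ih, Finset.range_add_one,
      Finset.sum_powerset_insert Finset.notMem_range_self]
    congr 1
    refine Finset.sum_congr rfl fun C hC => ?_
    rw [mask_insert fun h => by simpa using Finset.mem_powerset.1 hC h]

/-- Summing the indicator of `x` by `sum_mask` gives one, so some set contributes. -/
theorem exists_mask_eq {K x : ℕ} (h : x < 2 ^ K) : ∃ C ⊆ Finset.range K, mask C = x := by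
  have := sum_mask K fun y => if y = x then 1 else 0
  rw [Finset.sum_ite_eq' (Finset.range (2 ^ K)) x, if_pos (Finset.mem_range.2 h)] at this
  obtain ⟨C, hC, hne⟩ := Finset.exists_ne_zero_of_sum_ne_zero (this ▸ one_ne_zero)
  refine ⟨C, Finset.mem_powerset.1 hC, ?_⟩
  by_contra hcon
  exact hne (if_neg hcon)

/-- The set function stored in the cells `b, b + 1, …` of an array. -/
noncomputable def tab (K : ℕ) (r : ℕ → ℝ) (b : ℕ) : SetAlg :=
  open Classical in fun C => if C ⊆ Finset.range K then r (b + mask C) else 0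

theorem tab_apply {K : ℕ} (r : ℕ → ℝ) (b : ℕ) {C : Finset ℕ} (h : C ⊆ Finset.range K) :
    tab K r b C = r (b + mask C) := if_pos h

theorem tab_of_not {K : ℕ} (r : ℕ → ℝ) (b : ℕ) {C : Finset ℕ} (h : ¬ C ⊆ Finset.range K) :
    tab K r b C = 0 := if_neg h

theorem tab_congr {K : ℕ} {r r' : ℕ → ℝ} {b b' : ℕ} (h : ∀ x < 2 ^ K, r (b + x) = r' (b' + x)) :
    tab K r b = tab K r' b' := by
  ext C
  by_cases hC : C ⊆ Finset.range K
  · rw [tab_apply _ _ hC, tab_apply _ _ hC, h _ (mask_lt hC)]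
  · rw [tab_of_not _ _ hC, tab_of_not _ _ hC]

theorem tab_eq {K : ℕ} {r : ℕ → ℝ} {b : ℕ} {f : SetAlg} (hf : SetAlg.Supp f (Finset.range K))
    (h : ∀ C ⊆ Finset.range K, r (b + mask C) = f C) : tab K r b = f := by
  ext C
  by_cases hC : C ⊆ Finset.range K
  · rw [tab_apply _ _ hC, h C hC]
  · rw [tab_of_not _ _ hC, hf C hC]

theorem supp_tab (K : ℕ) (r : ℕ → ℝ) (b : ℕ) : SetAlg.Supp (tab K r b) (Finset.range K) :=
  fun _ hC => tab_of_not _ _ hC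

/-- The first `3 ^ c` entries of `X`, `Y` are the pairs of masks of disjoint sets of colours below
`c`, for `c ≤ K`. -/
def TernTable (K : ℕ) (X Y : ℕ → ℕ) : Prop :=
  ∀ c ≤ K, ∀ φ : ℕ → ℕ → ℝ, ∑ i ∈ Finset.range (3 ^ c), φ (X i) (Y i) =
    ∑ C ∈ (Finset.range c).powerset, ∑ D ∈ (Finset.range c \ C).powerset, φ (mask C) (mask D)

/-- The new colour lies in neither set, in the second, or in the first. -/
theorem sum_range_powerset_succ (c : ℕ) (φ : Finset ℕ → Finset ℕ → ℝ) :
    ∑ C ∈ (Finset.range (c + 1)).powerset, ∑ D ∈ (Finset.range (c + 1) \ C).powerset, φ C D =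
      ∑ C ∈ (Finset.range c).powerset, ∑ D ∈ (Finset.range c \ C).powerset,
        (φ C D + φ C (insert c D) + φ (insert c C) D) := by
  rw [Finset.range_add_one, Finset.sum_powerset_insert Finset.notMem_range_self,
    ← Finset.sum_add_distrib]
  refine Finset.sum_congr rfl fun C hC => ?_
  have hcC : c ∉ C := fun h => by simpa using Finset.mem_powerset.1 hC h
  rw [Finset.insert_sdiff_of_notMem _ hcC, Finset.sum_powerset_insert (by simp),
    Finset.insert_sdiff_insert, Finset.sdiff_insert_of_notMem Finset.notMem_range_self,
    ← Finset.sum_add_distrib, ← Finset.sum_add_distrib]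

/-- The three blocks of length `3 ^ K` place colour `K` in neither set, in the first, or in the
second. The first block is the old list, so the shorter prefixes stay valid. -/
theorem TernTable.succ {K : ℕ} {X Y X' Y' : ℕ → ℕ} (h : TernTable K X Y)
    (hX0 : ∀ i < 3 ^ K, X' i = X i) (hY0 : ∀ i < 3 ^ K, Y' i = Y i)
    (hX1 : ∀ i < 3 ^ K, X' (3 ^ K + i) = X i + 2 ^ K) (hY1 : ∀ i < 3 ^ K, Y' (3 ^ K + i) = Y i)
    (hX2 : ∀ i < 3 ^ K, X' (3 ^ K + 3 ^ K + i) = X i)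
    (hY2 : ∀ i < 3 ^ K, Y' (3 ^ K + 3 ^ K + i) = Y i + 2 ^ K) : TernTable (K + 1) X' Y' := by
  have hold : ∀ c ≤ K, ∀ φ : ℕ → ℕ → ℝ, ∑ i ∈ Finset.range (3 ^ c), φ (X' i) (Y' i) =
      ∑ i ∈ Finset.range (3 ^ c), φ (X i) (Y i) := fun c hc φ =>
    Finset.sum_congr rfl fun i hi => by
      have : i < 3 ^ K := (Finset.mem_range.1 hi).trans_le (Nat.pow_le_pow_right (by omega) hc)
      rw [hX0 i this, hY0 i this]
  intro c hc φ
  rcases Nat.le_succ_iff.1 hc with hc | rfl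
  · rw [hold c hc, h c hc]
  · rw [show 3 ^ (K + 1) = 3 ^ K + 3 ^ K + 3 ^ K by ring, Finset.sum_range_add,
      Finset.sum_range_add, hold K le_rfl, sum_range_powerset_succ]
    have h1 : ∑ i ∈ Finset.range (3 ^ K), φ (X' (3 ^ K + i)) (Y' (3 ^ K + i)) =
        ∑ i ∈ Finset.range (3 ^ K), φ (X i + 2 ^ K) (Y i) := Finset.sum_congr rfl fun i hi => by
      rw [hX1 i (Finset.mem_range.1 hi), hY1 i (Finset.mem_range.1 hi)]
    have h2 : ∑ i ∈ Finset.range (3 ^ K), φ (X' (3 ^ K + 3 ^ K + i)) (Y' (3 ^ K + 3 ^ K + i)) =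
        ∑ i ∈ Finset.range (3 ^ K), φ (X i) (Y i + 2 ^ K) := Finset.sum_congr rfl fun i hi => by
      rw [hX2 i (Finset.mem_range.1 hi), hY2 i (Finset.mem_range.1 hi)]
    rw [h1, h2, h K le_rfl, h K le_rfl fun x y => φ (x + 2 ^ K) y, h K le_rfl fun x y => φ x (y + 2 ^ K),
      ← Finset.sum_add_distrib, ← Finset.sum_add_distrib]
    refine Finset.sum_congr rfl fun C hC => ?_
    have hC' : K ∉ C := fun h => by simpa using Finset.mem_powerset.1 hC h
    rw [← Finset.sum_add_distrib, ← Finset.sum_add_distrib]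
    refine Finset.sum_congr rfl fun D hD => ?_
    have hD' : K ∉ D := fun h => by simpa using Finset.mem_powerset.1 hD h
    rw [mask_insert hC', mask_insert hD', add_comm (mask C), add_comm (mask D)]
    ring

/-- A sum over disjoint pairs of masks with a prescribed sum is a convolution. -/
theorem TernTable.sum_conv {K : ℕ} {X Y : ℕ → ℕ} (h : TernTable K X Y) {c : ℕ} (hc : c ≤ K)
    (f g : ℕ → ℝ) {A : Finset ℕ} (hA : A ⊆ Finset.range c) :
    (∑ i ∈ Finset.range (3 ^ c), if X i + Y i = mask A then f (X i) * g (Y i) else 0) =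
      ∑ C ∈ A.powerset, f (mask C) * g (mask (A \ C)) := by
  rw [h c hc fun x y => if x + y = mask A then f x * g y else 0]
  -- Masks of disjoint sets add without carries, so the equation of numbers says that `C ∪ D = A`.
  have key : ∀ C D : Finset ℕ, D ⊆ Finset.range c \ C →
      (mask C + mask D = mask A ↔ C ⊆ A ∧ D = A \ C) := by
    intro C D hD
    have hdis : Disjoint C D := (Finset.subset_sdiff.1 hD).2.symm
    rw [← mask_union hdis, mask_injective.eq_iff]
    constructor
    · rintro rfl
      exact ⟨Finset.subset_union_left, by
        rw [Finset.union_sdiff_left, Finset.sdiff_eq_self_of_disjoint hdis.symm]⟩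
    · rintro ⟨h1, rfl⟩
      exact Finset.union_sdiff_of_subset h1
  symm
  refine Finset.sum_subset_zero_on_sdiff (Finset.powerset_mono.2 hA) ?_ ?_
  · intro C hC
    refine Finset.sum_eq_zero fun D hD => ?_
    rw [if_neg]
    intro he
    exact (Finset.mem_sdiff.1 hC).2
      (Finset.mem_powerset.2 ((key C D (Finset.mem_powerset.1 hD)).1 he).1)
  · intro C hC
    have hCA := Finset.mem_powerset.1 hC
    have hmem : A \ C ∈ (Finset.range c \ C).powerset :=
      Finset.mem_powerset.2 (Finset.sdiff_subset_sdiff hA le_rfl)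
    rw [Finset.sum_eq_single_of_mem _ hmem, if_pos]
    · exact (key C _ (Finset.mem_powerset.1 hmem)).2 ⟨hCA, rfl⟩
    · intro D hD hne
      rw [if_neg]
      exact fun he => hne ((key C D (Finset.mem_powerset.1 hD)).1 he).2

/-- A sum over disjoint pairs of masks with prescribed members has at most one term. -/
theorem TernTable.sum_single {K : ℕ} {X Y : ℕ → ℕ} (h : TernTable K X Y) (f : ℕ → ℝ)
    {C B : Finset ℕ} (hC : C ⊆ Finset.range K) (hB : B ⊆ Finset.range K) :
    (∑ i ∈ Finset.range (3 ^ K), if Y i = mask B ∧ X i = mask C then f (X i + Y i) else 0) =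
      open Classical in if Disjoint C B then f (mask (C ∪ B)) else 0 := by
  rw [h K le_rfl fun x y => if y = mask B ∧ x = mask C then f (x + y) else 0,
    Finset.sum_eq_single_of_mem C (Finset.mem_powerset.2 hC)]
  · split_ifs with hd
    · rw [Finset.sum_eq_single_of_mem B (Finset.mem_powerset.2 (Finset.subset_sdiff.2 ⟨hB, hd.symm⟩)),
        if_pos ⟨rfl, rfl⟩, mask_union hd]
      intro D _ hne
      rw [if_neg]
      exact fun he => hne (mask_injective he.1)
    · refine Finset.sum_eq_zero fun D hD => ?_
      rw [if_neg]
      rintro ⟨he, -⟩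
      rw [mask_injective he] at hD
      exact hd (Finset.subset_sdiff.1 (Finset.mem_powerset.1 hD)).2.symm
  · intro D _ hne
    refine Finset.sum_eq_zero fun D' _ => ?_
    rw [if_neg]
    exact fun he => hne (mask_injective he.2)

/-! ### Convolution, contraction and copying of tables on the machine -/

namespace RealRAM

/-- The size of the tables and the auxiliary tables of powers and of disjoint pairs. -/
structure Sized (K : ℕ) (s : State) : Prop where
  size : s.nat 4 0 = K
  pow2 : ∀ c ≤ K, s.nat 5 c = 2 ^ c
  pow3 : ∀ c ≤ K, s.nat 6 c = 3 ^ c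
  tern : TernTable K (s.nat 7) (s.nat 8)

theorem Sized.of_eq {K : ℕ} {s s' : State} (h : Sized K s) (h4 : s'.nat 4 = s.nat 4)
    (h5 : s'.nat 5 = s.nat 5) (h6 : s'.nat 6 = s.nat 6) (h7 : s'.nat 7 = s.nat 7)
    (h8 : s'.nat 8 = s.nat 8) : Sized K s' :=
  ⟨by rw [h4, h.size], fun c hc => by rw [h5, h.pow2 c hc], fun c hc => by rw [h6, h.pow3 c hc],
    by rw [h7, h8]; exact h.tern⟩

theorem one_le_three_pow (K : ℕ) : 1 ≤ 3 ^ K := Nat.one_le_pow _ _ (by omega)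

theorem two_pow_le_three_pow (K : ℕ) : 2 ^ K ≤ 3 ^ K := Nat.pow_le_pow_left (by omega) K

/-- The program that clears a table. -/
def clear (d : ℕ) (o : NatExp) : Program := .fill 32 (.get 5 (.var 4)) d o (.lit 0)

/-- An expression whose value and cost do not change in a loop with the counter `i`. -/
structure Stable (i : ℕ) (s : State) (e : NatExp) (x : ℕ) : Prop where
  eval : ∀ s', (∀ a ≠ i, s'.nat a = s.nat a) → e.eval s' = x
  cost : e.cost ≤ 3

theorem clear_spec {K : ℕ} {s : State} (hK : Sized K s) (d : ℕ) {o : NatExp} {D : ℕ}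
    (ho : Stable 32 s o D) :
    Spec (clear d o) s (40 * 3 ^ K) fun s' => (∀ x < 2 ^ K, s'.real d (D + x) = 0) ∧
      ∀ x, x < D ∨ D + 2 ^ K ≤ x → s'.real d x = s.real d x := by
  refine (Spec.fill (2 ^ K) D (fun _ => 0) (fun s' hs => ?_)
    (fun j _ s' hs _ _ _ _ => ⟨ho.eval s' hs, by simp [RealExp.eval]⟩)).weaken ?_
  · simp [NatExp.eval, hs 4, hs 5, hK.size, hK.pow2]
  · have h1 := two_pow_le_three_pow K
    have h2 := one_le_three_pow K
    have h3 := ho.cost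
    simp only [NatExp.cost, RealExp.cost]
    nlinarith

/-- The program that convolves two tables. -/
def conv (d f g : ℕ) (o p q : NatExp) : Program :=
  .seq (clear d o) (.accum 32 (.get 6 (.var 4)) (.natEq (.lit 0) (.lit 0)) d
    (.add o (.add (.get 7 (.var 32)) (.get 8 (.var 32))))
    (.mul (.get f (.add p (.get 7 (.var 32)))) (.get g (.add q (.get 8 (.var 32))))))

/-- The list is known only through sums over it. A pointwise bound follows by summing the indicator
of its failure: a vanishing sum of nonnegative terms vanishes termwise. -/
theorem tern_bounds {K : ℕ} {X Y : ℕ → ℕ} (h : TernTable K X Y) {c : ℕ} (hc : c ≤ K) {i : ℕ}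
    (hi : i < 3 ^ c) : X i + Y i < 2 ^ c := by
  by_contra hcon
  have h1 := h c hc fun x y => if x + y < 2 ^ c then 0 else 1
  have h2 : ∑ C ∈ (Finset.range c).powerset, ∑ D ∈ (Finset.range c \ C).powerset,
      (if mask C + mask D < 2 ^ c then (0 : ℝ) else 1) = 0 := by
    refine Finset.sum_eq_zero fun C hC => Finset.sum_eq_zero fun D hD => ?_
    rw [if_pos]
    have hD' := Finset.subset_sdiff.1 (Finset.mem_powerset.1 hD)
    rw [← mask_union hD'.2.symm]
    exact mask_lt (Finset.union_subset (Finset.mem_powerset.1 hC) hD'.1)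
  rw [h2] at h1
  have h3 := (Finset.sum_eq_zero_iff_of_nonneg (fun i _ => by split_ifs <;> norm_num)).1 h1 i
    (Finset.mem_range.2 hi)
  rw [if_neg hcon] at h3
  norm_num at h3

/-- One scan of the disjoint pairs: a pair contributes to the cell of its union, whose number is the
sum of the two masks, so no operations on bits are needed. -/
theorem conv_spec {K : ℕ} {s : State} (hK : Sized K s) {d f g : ℕ} {o p q : NatExp} {D F G : ℕ}
    (ho : Stable 32 s o D) (hp : Stable 32 s p F) (hq : Stable 32 s q G) (hf : f ≠ d) (hg : g ≠ d) :
    Spec (conv d f g o p q) s (140 * 3 ^ K) fun s' =>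
      tab K (s'.real d) D = tab K (s.real f) F * tab K (s.real g) G ∧
      ∀ x, x < D ∨ D + 2 ^ K ≤ x → s'.real d x = s.real d x := by
  refine (Spec.seq (c' := 100 * 3 ^ K) (clear_spec hK d ho)
    fun s₁ hs₁ h₁ => ?_).weaken (by omega)
  have hn : ∀ a ≠ 32, s₁.nat a = s.nat a := fun a ha =>
    hs₁.nat a (by simp [clear, Program.fill, Program.forN, Program.writesNat, ha])
  have hr : ∀ a ≠ d, s₁.real a = s.real a := fun a ha =>
    hs₁.real a (by simp [clear, Program.fill, Program.forN, Program.writesReal, ha])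
  have hK₁ : Sized K s₁ := hK.of_eq (hn _ (by decide)) (hn _ (by decide)) (hn _ (by decide))
    (hn _ (by decide)) (hn _ (by decide))
  have hb := fun {i : ℕ} (hi : i < 3 ^ K) => tern_bounds hK.tern le_rfl hi
  refine ((Spec.accum (3 ^ K) (fun _ => True) (fun i => D + (s.nat 7 i + s.nat 8 i))
    (fun i => s.real f (F + s.nat 7 i) * s.real g (G + s.nat 8 i)) (fun s' hs => ?_)
    (fun j hj s' hs hs' hy hij => ?_)).weaken ?_).post fun s' hs hx => ⟨?_, ?_⟩
  · simp [NatExp.eval, hs 4, hs 6, hn, hK.size, hK.pow3]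
  · have e := fun a ha => (hs a ha).trans (hn a ha)
    simp only [NatExp.eval, RealExp.eval, Test.Holds, ho.eval s' e, hp.eval s' e, hq.eval s' e, hij,
      e 7 (by decide), e 8 (by decide), hs' f hf, hs' g hg, hr f hf, hr g hg]
    simp
  · have h1 := one_le_three_pow K
    have h2 := ho.cost
    have h3 := hp.cost
    have h4 := hq.cost
    simp only [NatExp.cost, RealExp.cost, Test.cost]
    nlinarith
  · refine tab_eq ((supp_tab K _ _).mul (supp_tab K _ _)) fun A hA => ?_
    rw [hx, h₁.1 _ (mask_lt hA), zero_add, SetAlg.mul_apply]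
    have := hK.tern.sum_conv le_rfl (fun x => s.real f (F + x)) (fun x => s.real g (G + x)) hA
    simp only [true_and, add_right_inj]
    rw [this]
    refine Finset.sum_congr rfl fun C hC => ?_
    have hC' := Finset.mem_powerset.1 hC
    rw [tab_apply _ _ (hC'.trans hA), tab_apply _ _ (Finset.sdiff_subset.trans hA)]
  · intro x hxD
    rw [hx, h₁.2 x hxD, Finset.sum_eq_zero, add_zero]
    intro i hi
    rw [if_neg]
    rintro ⟨-, h⟩
    have := hb (Finset.mem_range.1 hi)
    omega

/-- The program that contracts a table. -/
def message (d f : ℕ) (o p y : NatExp) : Program :=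
  .seq (clear d o) (.accum 32 (.get 6 (.var 4)) (.natEq (.get 8 (.var 32)) y) d
    (.add o (.get 7 (.var 32)))
    (.get f (.add p (.add (.get 7 (.var 32)) (.get 8 (.var 32))))))

/-- The pairs whose second mask is that of `B` run through exactly the sets disjoint from `B`, so a
contraction is a filtered scan of the same list. -/
theorem message_spec {K : ℕ} {s : State} (hK : Sized K s) {d f : ℕ} {o p y : NatExp} {D F : ℕ}
    {B : Finset ℕ} (ho : Stable 32 s o D) (hp : Stable 32 s p F) (hy : Stable 32 s y (mask B))
    (hB : B ⊆ Finset.range K) (hf : f ≠ d) :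
    Spec (message d f o p y) s (140 * 3 ^ K) fun s' =>
      tab K (s'.real d) D = SetAlg.contract B (tab K (s.real f) F) ∧
      ∀ x, x < D ∨ D + 2 ^ K ≤ x → s'.real d x = s.real d x := by
  refine (Spec.seq (c' := 100 * 3 ^ K) (clear_spec hK d ho)
    fun s₁ hs₁ h₁ => ?_).weaken (by omega)
  have hn : ∀ a ≠ 32, s₁.nat a = s.nat a := fun a ha =>
    hs₁.nat a (by simp [clear, Program.fill, Program.forN, Program.writesNat, ha])
  have hr : ∀ a ≠ d, s₁.real a = s.real a := fun a ha =>
    hs₁.real a (by simp [clear, Program.fill, Program.forN, Program.writesReal, ha])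
  have hb := fun {i : ℕ} (hi : i < 3 ^ K) => tern_bounds hK.tern le_rfl hi
  refine ((Spec.accum (3 ^ K) (fun i => s.nat 8 i = mask B) (fun i => D + s.nat 7 i)
    (fun i => s.real f (F + (s.nat 7 i + s.nat 8 i))) (fun s' hs => ?_)
    (fun j hj s' hs hs' _ hij => ?_)).weaken ?_).post fun s' hs hx => ⟨?_, ?_⟩
  · simp [NatExp.eval, hs 4, hs 6, hn, hK.size, hK.pow3]
  · have e := fun a ha => (hs a ha).trans (hn a ha)
    simp only [NatExp.eval, RealExp.eval, Test.Holds, ho.eval s' e, hp.eval s' e, hy.eval s' e, hij,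
      e 7 (by decide), e 8 (by decide), hs' f hf, hr f hf]
    simp
  · have h1 := one_le_three_pow K
    have h2 := ho.cost
    have h3 := hp.cost
    have h4 := hy.cost
    simp only [NatExp.cost, RealExp.cost, Test.cost]
    nlinarith
  · refine tab_eq (fun C hC => ?_) fun C hC => ?_
    · rw [SetAlg.contract]
      split_ifs
      · exact tab_of_not _ _ fun h => hC (Finset.subset_union_left.trans h)
      · rfl
    · rw [hx, h₁.1 _ (mask_lt hC), zero_add]
      have := hK.tern.sum_single (fun x => s.real f (F + x)) hC hB
      simp only [add_right_inj]
      rw [this, SetAlg.contract]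
      split_ifs
      · rw [tab_apply _ _ (Finset.union_subset hC hB)]
      · rfl
  · intro x hxD
    rw [hx, h₁.2 x hxD, Finset.sum_eq_zero, add_zero]
    intro i hi
    rw [if_neg]
    rintro ⟨-, h⟩
    have := hb (Finset.mem_range.1 hi)
    omega

/-- The program that copies a table. -/
def copy (d f : ℕ) (o p : NatExp) : Program :=
  .fill 32 (.get 5 (.var 4)) d o (.get f (.add p (.var 32)))

theorem copy_spec {K : ℕ} {s : State} (hK : Sized K s) {d f : ℕ} {o p : NatExp} {D F : ℕ}
    (ho : Stable 32 s o D) (hp : Stable 32 s p F) (hf : f ≠ d) :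
    Spec (copy d f o p) s (40 * 3 ^ K) fun s' =>
      tab K (s'.real d) D = tab K (s.real f) F ∧
      ∀ x, x < D ∨ D + 2 ^ K ≤ x → s'.real d x = s.real d x := by
  refine ((Spec.fill (2 ^ K) D (fun x => s.real f (F + x)) (fun s' hs => ?_)
    (fun j _ s' hs hs' _ _ hj => ⟨ho.eval s' hs, ?_⟩)).weaken ?_).post
    fun s' _ h => ⟨tab_congr h.1, h.2⟩
  · simp [NatExp.eval, hs 4, hs 5, hK.size, hK.pow2]
  · simp [RealExp.eval, NatExp.eval, hp.eval s' hs, hs' f hf, hj]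
  · have h1 := two_pow_le_three_pow K
    have h2 := one_le_three_pow K
    have h3 := ho.cost
    have h4 := hp.cost
    simp only [NatExp.cost, RealExp.cost]
    nlinarith

end RealRAM

namespace RealRAM

/-! ### The input and the preliminary tables -/

/-- The input of the program, in terms of natural numbers. -/
structure Input (n m N : ℕ) (bg : ℕ → List ℕ) (α : ℕ → ℝ) (β : ℕ → ℕ → ℝ) (s : State) : Prop where
  verts : s.nat 0 0 = n
  causes : s.nat 0 1 = m
  nodes : s.nat 0 2 = N
  start : ∀ t < N, s.nat 2 (t + 1) = s.nat 2 t + (bg t).length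
  bag : ∀ t < N, ∀ j < (bg t).length, s.nat 3 (s.nat 2 t + j) = (bg t).getD j 0
  alpha : ∀ z < m, s.real 0 z = α z
  beta : ∀ i < n, ∀ z < m, s.real 1 (i * m + z) = β i z

theorem Input.of_eq {n m N : ℕ} {bg : ℕ → List ℕ} {α : ℕ → ℝ} {β : ℕ → ℕ → ℝ} {s s' : State}
    (h : Input n m N bg α β s) (h0 : s'.nat 0 = s.nat 0) (h2 : s'.nat 2 = s.nat 2)
    (h3 : s'.nat 3 = s.nat 3) (h0' : s'.real 0 = s.real 0) (h1' : s'.real 1 = s.real 1) :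
    Input n m N bg α β s' :=
  ⟨by rw [h0, h.verts], by rw [h0, h.causes], by rw [h0, h.nodes],
    fun t ht => by rw [h2, h.start t ht], fun t ht j hj => by rw [h2, h3, h.bag t ht j hj],
    fun z hz => by rw [h0', h.alpha z hz], fun i hi z hz => by rw [h1', h.beta i hi z hz]⟩

/-- The length of the bag of the node in the variable `t`. -/
abbrev bagLen (t : ℕ) : NatExp := .sub (.get 2 (.add (.var t) (.lit 1))) (.get 2 (.var t))

/-- Run `P` for each vertex `v`, stored in the variable `42`, in the bag of the node in the
variable `t`. -/
def Program.forBag (t : ℕ) (P : Program) : Program :=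
  .forN 33 (bagLen t) (.seq (.setNat 42 (.lit 0) (.get 3 (.add (.get 2 (.var t)) (.var 33)))) P)

/-- The loop itself changes the variables `33` and `42` outside of `P`; `hins` says that the
invariant does not depend on them. -/
theorem Spec.forBag {n m N : ℕ} {bg : ℕ → List ℕ} {α : ℕ → ℝ} {β : ℕ → ℕ → ℝ} {s : State}
    (hin : Input n m N bg α β s) {t u : ℕ} {P : Program} (hu : u < N) (ht : s.nat t 0 = u) (c : ℕ)
    (I : ℕ → State → Prop) (h33 : P.writesNat 33 = false)
    (h2 : P.writesNat 2 = false) (h3 : P.writesNat 3 = false) (htP : P.writesNat t = false)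
    (ht33 : t ≠ 33) (ht42 : t ≠ 42)
    (hins : ∀ j s' a x, a = 33 ∨ a = 42 → I j s' → I j (s'.putNat a 0 x)) (h0 : I 0 s)
    (hstep : ∀ j < (bg u).length, ∀ s', Same (.forBag t P) s s' → s'.nat 42 0 = (bg u).getD j 0 →
      I j s' → Spec P s' c (I (j + 1))) :
    Spec (.forBag t P) s ((bg u).length * (c + 28) + 16) (I (bg u).length) := by
  have hnat : ∀ {s'}, Same (.forBag t P) s s' → s'.nat 2 = s.nat 2 ∧ s'.nat 3 = s.nat 3 ∧
      s'.nat t = s.nat t := fun {s'} hs =>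
    ⟨hs.nat 2 (by simp [Program.forBag, Program.forN, Program.writesNat, h2]),
      hs.nat 3 (by simp [Program.forBag, Program.forN, Program.writesNat, h3]),
      hs.nat t (by simp [Program.forBag, Program.forN, Program.writesNat, htP, ht33, ht42])⟩
  refine (Spec.forN (bg u).length (c + 9) I ?_ ?_ ?_ ?_).weaken ?_
  · simp [Program.writesNat, h33]
  · intro s' hs
    obtain ⟨e2, e3, et⟩ := hnat hs
    simp [NatExp.eval, e2, et, ht, hin.start u hu]
  · exact hins _ _ _ _ (Or.inl rfl) h0
  · intro j hj s' hs hj' hI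
    obtain ⟨e2, e3, et⟩ := hnat hs
    have e : NatExp.eval s' (.get 3 (.add (.get 2 (.var t)) (.var 33))) = (bg u).getD j 0 := by
      simp [NatExp.eval, e2, e3, et, ht, hj', hin.bag u hu j hj]
    refine (Spec.seq (Spec.straight _ _ rfl (R := fun s'' =>
      s'' = s'.putNat 42 0 ((bg u).getD j 0)) (by rw [Program.exec, e]; rfl))
      fun s₁ _ hs₁ => ?_).weaken (le_of_eq ?_) (c := _ + c)
    · subst hs₁
      refine (hstep j hj _ (hs.trans ⟨fun a ha => State.putNat_nat_of_ne _ _ _ ?_,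
        fun _ _ => rfl⟩) (by simp) (hins _ _ _ _ (Or.inr rfl) hI)).post
        fun s₂ _ h => hins _ _ _ _ (Or.inl rfl) h
      rintro rfl
      simp [Program.forN, Program.writesNat] at ha
    · simp only [Program.time, NatExp.cost]; omega
  · simp only [NatExp.cost]
    apply le_of_eq
    ring

/-- The program that computes the size of the largest bag. -/
def sizeProgram : Program :=
  .forN 30 (.get 0 (.lit 2)) (.ite (.natLt (.var 4) (bagLen 30))
    (.setNat 4 (.lit 0) (bagLen 30)) .skip)

theorem sizeProgram_spec {n m N K : ℕ} {bg : ℕ → List ℕ} {α : ℕ → ℝ} {β : ℕ → ℕ → ℝ} {s : State}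
    (hin : Input n m N bg α β s) (h4 : s.nat 4 0 = 0) (hle : ∀ t < N, (bg t).length ≤ K)
    (hex : ∃ t < N, (bg t).length = K) :
    Spec sizeProgram s (60 * N + 9) fun s' => s'.nat 4 0 = K := by
  refine ((Spec.forN N 34 (fun j s' => s'.nat 4 0 ≤ K ∧ ∀ t < j, (bg t).length ≤ s'.nat 4 0) rfl
    (fun s' hs => ?_) ?_ fun j hj s' hs hj' hI => ?_).weaken ?_).post fun s' _ hI => ?_
  · simp [NatExp.eval, hs.nat 0 rfl, hin.nodes]
  · simp [h4]
  · have e : NatExp.eval s' (bagLen 30) = (bg j).length := by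
      simp [NatExp.eval, hj', hs.nat 2 rfl, hin.start j hj]
    refine (Spec.straight _ _ rfl ?_).weaken (by decide)
    have hiff : (Test.natLt (.var 4) (bagLen 30)).Holds s' ↔ s'.nat 4 0 < (bg j).length := by
      rw [Test.Holds, e]; rfl
    by_cases hlt : s'.nat 4 0 < (bg j).length
    · rw [Program.exec_ite_pos (hiff.2 hlt), Program.exec, e]
      simp only [NatExp.eval]
      refine ⟨by simpa using hle j hj, fun t ht => ?_⟩
      rcases Nat.lt_succ_iff_lt_or_eq.1 ht with ht | rfl
      · simpa using (hI.2 t ht).trans hlt.le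
      · simp
    · rw [Program.exec_ite_neg (mt hiff.1 hlt), Program.exec]
      refine ⟨by simpa using hI.1, fun t ht => ?_⟩
      rcases Nat.lt_succ_iff_lt_or_eq.1 ht with ht | rfl
      · simpa using hI.2 t ht
      · simpa using hlt
  · simp only [NatExp.cost]; omega
  · obtain ⟨t, ht, h⟩ := hex
    exact le_antisymm hI.1 (h ▸ hI.2 t ht)

/-- The program that computes the powers of two and three. -/
def powProgram : Program :=
  .seq (.seq (.setNat 5 (.lit 0) (.lit 1)) (.setNat 6 (.lit 0) (.lit 1)))
    (.seq (.fillNat 30 (.var 4) 5 (.lit 1) (.add (.get 5 (.var 30)) (.get 5 (.var 30))))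
      (.fillNat 30 (.var 4) 6 (.lit 1)
        (.add (.add (.get 6 (.var 30)) (.get 6 (.var 30))) (.get 6 (.var 30)))))

theorem powProgram_spec {K : ℕ} {s : State} (h4 : s.nat 4 0 = K) :
    Spec powProgram s (60 * K + 30) fun s' =>
      (∀ c ≤ K, s'.nat 5 c = 2 ^ c) ∧ ∀ c ≤ K, s'.nat 6 c = 3 ^ c := by
  refine (Spec.seq (Spec.straight _ _ rfl (R := fun s' => s'.nat 5 0 = 1 ∧ s'.nat 6 0 = 1 ∧
    s'.nat 4 0 = K) (by simp [Program.exec, NatExp.eval, h4])) fun s₁ _ h₁ =>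
    Spec.seq (Spec.fillNat (i := 30) (d := 5) K 1 (fun x => 2 ^ (x + 1)) (by decide)
      (fun s' hs _ => by simp [NatExp.eval, hs 4, h₁.2.2])
      (fun j hj s' hs h0 hlt hj' => ?_)) fun s₂ hs₂ h₂ =>
    (Spec.fillNat (i := 30) (d := 6) K 1 (fun x => 3 ^ (x + 1)) (by decide)
      (fun s' hs _ => by simp [NatExp.eval, hs 4, hs₂.nat 4 rfl, h₁.2.2])
      (fun j hj s' hs h0 hlt hj' => ?_)).post fun s₃ hs₃ h₃ => ?_).weaken ?_
  · have : s'.nat 5 j = 2 ^ j := by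
      rcases j with _ | j
      · rw [h0 0 (by simp), h₁.1, pow_zero]
      · rw [add_comm, hlt j (by omega)]; ring
    refine ⟨rfl, ?_⟩
    simp only [NatExp.eval, hj', this]
    ring
  · have : s'.nat 6 j = 3 ^ j := by
      rcases j with _ | j
      · rw [h0 0 (by simp), hs₂.nat 6 rfl, h₁.2.1, pow_zero]
      · rw [add_comm, hlt j (by omega)]; ring
    refine ⟨rfl, ?_⟩
    simp only [NatExp.eval, hj', this]
    ring
  · constructor
    · intro c hc
      rw [hs₃.nat 5 rfl]
      rcases c with _ | c
      · rw [h₂.2 0 (by simp), h₁.1, pow_zero]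
      · rw [add_comm, h₂.1 c (by omega)]; ring
    · intro c hc
      rcases c with _ | c
      · rw [h₃.2 0 (by simp), hs₂.nat 6 rfl, h₁.2.1, pow_zero]
      · rw [add_comm, h₃.1 c (by omega)]; ring
  · simp only [NatExp.cost, Program.time]; omega

/-- The program that lists the pairs of masks of disjoint sets. -/
def ternProgram : Program :=
  .forN 31 (.var 4)
    (.seq (.fillNat 32 (.get 6 (.var 31)) 7 (.get 6 (.var 31))
      (.add (.get 7 (.var 32)) (.get 5 (.var 31))))
    (.seq (.fillNat 32 (.get 6 (.var 31)) 8 (.get 6 (.var 31)) (.get 8 (.var 32)))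
    (.seq (.fillNat 32 (.get 6 (.var 31)) 7 (.add (.get 6 (.var 31)) (.get 6 (.var 31)))
      (.get 7 (.var 32)))
    (.fillNat 32 (.get 6 (.var 31)) 8 (.add (.get 6 (.var 31)) (.get 6 (.var 31)))
      (.add (.get 8 (.var 32)) (.get 5 (.var 31)))))))

theorem sum_three_pow_le (K : ℕ) : ∑ c ∈ Finset.range K, 3 ^ c ≤ 3 ^ K := by
  induction K with
  | zero => simp
  | succ K ih => rw [Finset.sum_range_succ, pow_succ]; omega

theorem le_three_pow (K : ℕ) : K ≤ 3 ^ K := (Nat.lt_pow_self (by omega)).le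

/-- Round `c` appends two modified copies of the current `3 ^ c` pairs; the lengths form a geometric
series, so the total stays proportional to `3 ^ K`. -/
theorem ternProgram_spec {K : ℕ} {s : State} (h4 : s.nat 4 0 = K) (h5 : ∀ c ≤ K, s.nat 5 c = 2 ^ c)
    (h6 : ∀ c ≤ K, s.nat 6 c = 3 ^ c) (h7 : s.nat 7 0 = 0) (h8 : s.nat 8 0 = 0) :
    Spec ternProgram s (220 * 3 ^ K) fun s' => TernTable K (s'.nat 7) (s'.nat 8) := by
  refine (Spec.forN_of_cost K (fun c => 3 ^ c * 110 + 40)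
    (fun c s' => TernTable c (s'.nat 7) (s'.nat 8)) rfl
    (fun s' hs => by simp [NatExp.eval, hs.nat 4 rfl, h4]) ?_ fun c hc s' hs hc' hI => ?_).weaken ?_
  · intro c hc φ
    obtain rfl : c = 0 := by omega
    simp [h7, h8, mask_empty]
  · have e5 : s'.nat 5 c = 2 ^ c := by rw [hs.nat 5 rfl, h5 c hc.le]
    have e6 : s'.nat 6 c = 3 ^ c := by rw [hs.nat 6 rfl, h6 c hc.le]
    refine (Spec.seq (Spec.fillNat (i := 32) (d := 7) (3 ^ c) (3 ^ c) (fun x => s'.nat 7 x + 2 ^ c)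
      (by decide) (fun t ht _ => by simp [NatExp.eval, ht 31, ht 6, hc', e6])
      (fun j hj t ht h0 hlt hj' => by
        simp [NatExp.eval, ht 31, ht 6, ht 5, hc', e6, e5, hj', h0 j (Or.inl hj)])) fun s₁ hs₁ h₁ =>
      Spec.seq (Spec.fillNat (i := 32) (d := 8) (3 ^ c) (3 ^ c) (fun x => s'.nat 8 x)
      (by decide) (fun t ht _ => by
        simp [NatExp.eval, ht 31, ht 6, hs₁.nat 31 rfl, hs₁.nat 6 rfl, hc', e6])
      (fun j hj t ht h0 hlt hj' => by
        simp [NatExp.eval, ht 31, ht 6, hs₁.nat 31 rfl, hs₁.nat 6 rfl, hs₁.nat 8 rfl, hc', e6, hj',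
          h0 j (Or.inl hj)])) fun s₂ hs₂ h₂ =>
      Spec.seq (Spec.fillNat (i := 32) (d := 7) (3 ^ c) (3 ^ c + 3 ^ c) (fun x => s'.nat 7 x)
      (by decide) (fun t ht _ => by
        simp [NatExp.eval, ht 31, ht 6, hs₁.nat 31 rfl, hs₁.nat 6 rfl, hs₂.nat 31 rfl, hs₂.nat 6 rfl,
          hc', e6])
      (fun j hj t ht h0 hlt hj' => by
        simp [NatExp.eval, ht 31, ht 6, hs₁.nat 31 rfl, hs₁.nat 6 rfl, hs₂.nat 31 rfl, hs₂.nat 6 rfl,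
          hs₂.nat 7 rfl, hc', e6, hj', h0 j (Or.inl (by omega)), h₁.2 j (Or.inl hj)]))
      fun s₃ hs₃ h₃ =>
      (Spec.fillNat (i := 32) (d := 8) (3 ^ c) (3 ^ c + 3 ^ c) (fun x => s'.nat 8 x + 2 ^ c)
      (by decide) (fun t ht _ => by
        simp [NatExp.eval, ht 31, ht 6, hs₁.nat 31 rfl, hs₁.nat 6 rfl, hs₂.nat 31 rfl, hs₂.nat 6 rfl,
          hs₃.nat 31 rfl, hs₃.nat 6 rfl, hc', e6])
      (fun j hj t ht h0 hlt hj' => by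
        simp [NatExp.eval, ht 31, ht 6, ht 5, hs₁.nat 31 rfl, hs₁.nat 6 rfl, hs₂.nat 31 rfl,
          hs₂.nat 6 rfl, hs₃.nat 31 rfl, hs₃.nat 6 rfl, hs₁.nat 5 rfl, hs₂.nat 5 rfl, hs₃.nat 5 rfl,
          hs₁.nat 8 rfl, hs₃.nat 8 rfl, hc', e6, e5, hj', h0 j (Or.inl (by omega)),
          h₂.2 j (Or.inl hj)])).post
      fun s₄ hs₄ h₄ => ?_).weaken ?_
    · rw [State.putNat_nat_of_ne _ _ _ (by decide), State.putNat_nat_of_ne _ _ _ (by decide)]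
      refine hI.succ ?_ ?_ ?_ ?_ ?_ ?_
      · intro i hi
        rw [hs₄.nat 7 rfl, h₃.2 i (Or.inl (by omega)), hs₂.nat 7 rfl, h₁.2 i (Or.inl hi)]
      · intro i hi
        rw [h₄.2 i (Or.inl (by omega)), hs₃.nat 8 rfl, h₂.2 i (Or.inl hi), hs₁.nat 8 rfl]
      · intro i hi
        rw [hs₄.nat 7 rfl, h₃.2 _ (Or.inl (by omega)), hs₂.nat 7 rfl, h₁.1 i hi]
      · intro i hi
        rw [h₄.2 _ (Or.inl (by omega)), hs₃.nat 8 rfl, h₂.1 i hi]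
      · intro i hi
        rw [hs₄.nat 7 rfl, h₃.1 i hi]
      · intro i hi
        rw [h₄.1 i hi]
    · simp only [NatExp.cost]; omega
  · have h1 := sum_three_pow_le K
    have h2 := le_three_pow K
    have h3 := one_le_three_pow K
    simp only [NatExp.cost, Finset.sum_add_distrib, ← Finset.sum_mul, Finset.sum_const,
      Finset.card_range, smul_eq_mul]
    omega

/-- The program that computes the sizes of the sets with a given mask. -/
def cardProgram : Program :=
  .forN 31 (.var 4) (.fill 32 (.get 5 (.var 31)) 5 (.get 5 (.var 31))
    (.add (.get 5 (.var 32)) (.lit 1)))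

theorem forall_subset_range_succ {c : ℕ} {p : Finset ℕ → Prop}
    (h0 : ∀ C ⊆ Finset.range c, p C) (h1 : ∀ C ⊆ Finset.range c, c ∉ C → p (insert c C)) :
    ∀ C ⊆ Finset.range (c + 1), p C := by
  intro C hC
  by_cases hc : c ∈ C
  · have hsub : C.erase c ⊆ Finset.range c := by
      intro x hx
      obtain ⟨h1, h2⟩ := Finset.mem_erase.1 hx
      have := Finset.mem_range.1 (hC h2)
      exact Finset.mem_range.2 (by omega)
    rw [← Finset.insert_erase hc]
    exact h1 _ hsub (Finset.notMem_erase _ _)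
  · refine h0 C fun x hx => ?_
    have := Finset.mem_range.1 (hC hx)
    have hne : x ≠ c := fun he => hc (he ▸ hx)
    exact Finset.mem_range.2 (by omega)

/-- The induction step needs `2 * (K + 1) ≤ 3 * K`, which fails for the first two values. The bound
covers both tables filled in `K` rounds and the quadratic cost of colouring a bag. -/
theorem mul_two_pow_le (K : ℕ) : K * 2 ^ K ≤ 3 ^ K := by
  induction K with
  | zero => simp
  | succ K ih =>
    rcases Nat.lt_or_ge K 2 with h | h
    · interval_cases K <;> simp
    · rw [pow_succ, pow_succ]
      have : (K + 1) * 2 ≤ K * 3 := by omega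
      calc (K + 1) * (2 ^ K * 2) = ((K + 1) * 2) * 2 ^ K := by ring
        _ ≤ (K * 3) * 2 ^ K := Nat.mul_le_mul_right _ this
        _ = K * 2 ^ K * 3 := by ring
        _ ≤ 3 ^ K * 3 := Nat.mul_le_mul_right _ ih

theorem cardProgram_spec {K : ℕ} {s : State} (hK : Sized K s) (h5 : s.real 5 0 = 0) :
    Spec cardProgram s (90 * 3 ^ K) fun s' => ∀ C ⊆ Finset.range K, s'.real 5 (mask C) = C.card := by
  refine (Spec.forN K (2 ^ K * 30 + 10)
    (fun c s' => ∀ C ⊆ Finset.range c, s'.real 5 (mask C) = C.card) rfl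
    (fun s' hs => by simp [NatExp.eval, hs.nat 4 rfl, hK.size]) ?_ fun c hc s' hs hc' hI => ?_).weaken ?_
  · intro C hC
    obtain rfl : C = ∅ := by simpa using hC
    simp [mask_empty, h5]
  · have e5 : s'.nat 5 c = 2 ^ c := by rw [hs.nat 5 rfl, hK.pow2 c hc.le]
    refine ((Spec.fill (2 ^ c) (2 ^ c) (fun x => s'.real 5 x + 1)
      (fun t ht => by simp [NatExp.eval, ht 31, ht 5, hc', e5])
      (fun j hj t ht htr h0 hlt hj' => by
        simp [NatExp.eval, RealExp.eval, ht 31, ht 5, hc', e5, hj', h0 j (Or.inl hj)])).post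
      fun s₁ hs₁ h₁ => ?_).weaken ?_
    · rw [State.putNat_real]
      refine forall_subset_range_succ (fun C hC => ?_) fun C hC hcC => ?_
      · rw [h₁.2 _ (Or.inl (mask_lt hC)), hI C hC]
      · rw [mask_insert hcC, h₁.1 _ (mask_lt hC), hI C hC, Finset.card_insert_of_notMem hcC]
        push_cast
        ring
    · have : 2 ^ c ≤ 2 ^ K := Nat.pow_le_pow_right (by omega) hc.le
      simp only [NatExp.cost, RealExp.cost]
      omega
  · have h1 := mul_two_pow_le K
    have h2 := le_three_pow K
    have h3 := one_le_three_pow K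
    simp only [NatExp.cost]
    nlinarith

/-- The program that computes the places of the tables and of the rows. -/
def placeProgram : Program :=
  .seq (.fillNat 30 (.get 0 (.lit 2)) 17 (.lit 1) (.add (.get 17 (.var 30)) (.get 5 (.var 4))))
    (.fillNat 30 (.get 0 (.lit 0)) 16 (.lit 1) (.add (.get 16 (.var 30)) (.get 0 (.lit 1))))

/-- The machine does not multiply natural numbers, so the offsets of tables and rows are tabulated
by repeated addition. -/
theorem placeProgram_spec {n m N K : ℕ} {bg : ℕ → List ℕ} {α : ℕ → ℝ} {β : ℕ → ℕ → ℝ} {s : State}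
    (hin : Input n m N bg α β s) (hK : Sized K s) (h17 : s.nat 17 0 = 0) (h16 : s.nat 16 0 = 0) :
    Spec placeProgram s (40 * N + 40 * n + 30) fun s' =>
      (∀ t ≤ N, s'.nat 17 t = t * 2 ^ K) ∧ ∀ i ≤ n, s'.nat 16 i = i * m := by
  refine (Spec.seq (Spec.fillNat (i := 30) (d := 17) N 1 (fun x => (x + 1) * 2 ^ K) (by decide)
      (fun s' hs _ => by simp [NatExp.eval, hs 0, hin.nodes])
      (fun j hj s' hs h0 hlt hj' => ?_)) fun s₂ hs₂ h₂ =>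
    (Spec.fillNat (i := 30) (d := 16) n 1 (fun x => (x + 1) * m) (by decide)
      (fun s' hs _ => by simp [NatExp.eval, hs 0, hs₂.nat 0 rfl, hin.verts])
      (fun j hj s' hs h0 hlt hj' => ?_)).post fun s₃ hs₃ h₃ => ?_).weaken ?_
  · have : s'.nat 17 j = j * 2 ^ K := by
      rcases j with _ | j
      · rw [h0 0 (by simp), h17, zero_mul]
      · rw [add_comm, hlt j (by omega), add_comm]
    refine ⟨rfl, ?_⟩
    simp only [NatExp.eval, hj', this, hs 4 (by decide) (by decide), hs 5 (by decide) (by decide),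
      hK.size, hK.pow2 K le_rfl]
    ring
  · have : s'.nat 16 j = j * m := by
      rcases j with _ | j
      · rw [h0 0 (by simp), hs₂.nat 16 rfl, h16, zero_mul]
      · rw [add_comm, hlt j (by omega), add_comm]
    refine ⟨rfl, ?_⟩
    simp only [NatExp.eval, hj', this, hs 0 (by decide) (by decide), hs₂.nat 0 rfl, hin.causes]
    ring
  · constructor
    · intro t ht
      rw [hs₃.nat 17 rfl]
      rcases t with _ | t
      · rw [h₂.2 0 (by simp), h17, zero_mul]
      · rw [add_comm, h₂.1 t (by omega), add_comm]
    · intro t ht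
      rcases t with _ | t
      · rw [h₃.2 0 (by simp), hs₂.nat 16 rfl, h16, zero_mul]
      · rw [add_comm, h₃.1 t (by omega), add_comm]
  · simp only [NatExp.cost]; omega

end RealRAM

/-! ### Computing an elimination ordering -/

/-- The nodes that are not among the first `i` entries of `Q`. -/
def alive (N : ℕ) (Q : ℕ → ℕ) (i : ℕ) : Finset (Fin N) :=
  Finset.univ.filter fun x => ∀ j < i, Q j ≠ x.val

theorem mem_alive {N : ℕ} {Q : ℕ → ℕ} {i : ℕ} {x : Fin N} :
    x ∈ alive N Q i ↔ ∀ j < i, Q j ≠ x.val := by simp [alive]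

theorem alive_congr {N : ℕ} {Q Q' : ℕ → ℕ} {i : ℕ} (h : ∀ j < i, Q j = Q' j) :
    alive N Q i = alive N Q' i := by
  ext x
  rw [mem_alive, mem_alive]
  exact forall₂_congr fun j hj => by rw [h j hj]

theorem alive_succ {N : ℕ} {Q : ℕ → ℕ} {i : ℕ} {u : Fin N} (hu : Q i = u.val) :
    alive N Q (i + 1) = (alive N Q i).erase u := by
  ext x
  rw [Finset.mem_erase, mem_alive, mem_alive]
  constructor
  · exact fun h => ⟨fun he => h i (by omega) (he ▸ hu), fun j hj => h j (by omega)⟩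
  · rintro ⟨h1, h2⟩ j hj
    rcases Nat.lt_succ_iff_lt_or_eq.1 hj with hj | rfl
    · exact h2 j hj
    · rw [hu]; exact fun he => h1 (Fin.ext he.symm)

theorem card_alive {N : ℕ} {Q : ℕ → ℕ} {i : ℕ} (hlt : ∀ j < i, Q j < N)
    (hinj : ∀ j k, j < i → k < i → Q j = Q k → j = k) : (alive N Q i).card = N - i := by
  induction i with
  | zero => simp [alive]
  | succ i ih =>
    have hu : Q i = (⟨Q i, hlt i (by omega)⟩ : Fin N).val := rfl
    rw [alive_succ hu, Finset.card_erase_of_mem, ih (fun j hj => hlt j (by omega))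
      fun j k hj hk => hinj j k (by omega) (by omega)]
    · omega
    · rw [mem_alive]
      intro j hj he
      have := hinj j i (by omega) (by omega) he
      omega

open Classical in
/-- The state of the leaf-pruning algorithm after `i` steps. -/
structure PruneInv {N n : ℕ} (T : SimpleGraph (Fin N)) (bag : Fin N → Finset (Fin n)) (i : ℕ)
    (deg nbr Q : ℕ → ℕ) (q : ℕ) (par : ℕ → ℕ) : Prop where
  closed : T.PathClosed (alive N Q i)
  deg_eq : ∀ x ∈ alive N Q i, deg x.val = ((alive N Q i).filter (T.Adj x)).card
  nbr_eq : ∀ x ∈ alive N Q i, nbr x.val = ∑ y ∈ (alive N Q i).filter (T.Adj x), y.val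
  le : i ≤ q
  lt : ∀ j < q, Q j < N
  inj : ∀ j k, j < q → k < q → Q j = Q k → j = k
  leaf : ∀ x ∈ alive N Q i, deg x.val ≤ 1 ↔ ∃ j < q, Q j = x.val
  done : ∀ j < i, ∃ u p : Fin N, Q j = u.val ∧ par u.val = p.val ∧ p ∈ alive N Q (j + 1) ∧
    ∀ b ∈ alive N Q (j + 1), bag u ∩ bag b ⊆ bag p

namespace PruneInv

variable {N n i q : ℕ} {G : SimpleGraph (Fin n)} {D : TreeDecomposition G N}
  {deg nbr Q par : ℕ → ℕ}

/-- For a leaf, the sum of the numbers of its live neighbours is its only live neighbour, so no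
adjacency lists are needed. Deleting the leaf changes the degree and the sum at that neighbour only.
-/
theorem exists_step (h : PruneInv D.tree D.bag i deg nbr Q q par) (hi : i + 1 < N) :
    i < q ∧ ∃ u p : Fin N, Q i = u.val ∧ nbr u.val = p.val ∧ p ≠ u ∧
      (∀ deg' nbr' Q' : ℕ → ℕ, ∀ q' : ℕ,
        deg' = Function.update deg p.val (deg p.val - 1) →
        nbr' = Function.update nbr p.val (nbr p.val - u.val) →
        (Q' = if deg p.val - 1 = 1 then Function.update Q q p.val else Q) →
        (q' = if deg p.val - 1 = 1 then q + 1 else q) →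
        PruneInv D.tree D.bag (i + 1) deg' nbr' Q' q' (Function.update par u.val p.val)) := by
  classical
  have hcard : (alive N Q i).card = N - i := card_alive (fun j hj => h.lt j (hj.trans_le h.le))
    fun j k hj hk => h.inj j k (hj.trans_le h.le) (hk.trans_le h.le)
  -- The live nodes form a subtree with at least two nodes, which has a leaf; this leaf is queued
  -- but not among the first `i` entries, so the queue is not exhausted.
  have hiq : i < q := by
    obtain ⟨u, hu, hu1⟩ := h.closed.exists_leaf D.isTree (by omega)
    have hu1' : deg u.val ≤ 1 := by
      rw [h.deg_eq u hu]
      convert hu1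
    obtain ⟨j, hj, hju⟩ := (h.leaf u hu).1 hu1'
    by_contra hcon
    exact mem_alive.1 hu j (by omega) hju
  set u : Fin N := ⟨Q i, h.lt i hiq⟩ with hu
  have huS : u ∈ alive N Q i := by
    rw [mem_alive]
    intro j hj he
    have := h.inj j i (by omega) hiq he
    omega
  have hu1 : ((alive N Q i).filter (D.tree.Adj u)).card ≤ 1 := by
    have := (h.leaf u huS).2 ⟨i, hiq, rfl⟩
    rw [h.deg_eq u huS] at this
    convert this
  obtain ⟨p, hp, hpath⟩ := h.closed.exists_parent D.isTree huS hu1 (by omega)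
  have hpmem : p ∈ (alive N Q i).filter (D.tree.Adj u) := by rw [hp]; simp
  obtain ⟨hpS, hup⟩ := Finset.mem_filter.1 hpmem
  have hpu : p ≠ u := hup.ne'
  have hnbr : nbr u.val = p.val := by
    rw [h.nbr_eq u huS]
    convert Finset.sum_singleton (fun y : Fin N => y.val) p
  refine ⟨hiq, u, p, rfl, hnbr, hpu, ?_⟩
  rintro deg' nbr' Q' q' hdeg' hnbr' hQ' hq'
  have hQlt : ∀ j < q, Q' j = Q j := by
    intro j hj
    rw [hQ']
    split_ifs
    · rw [Function.update_of_ne (by omega)]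
    · rfl
  have halive : alive N Q' (i + 1) = (alive N Q i).erase u := by
    rw [alive_congr (Q' := Q) fun j hj => hQlt j (by omega), alive_succ (u := u) rfl]
  have hadj : ∀ x ∈ alive N Q i, D.tree.Adj x u ↔ x = p := by
    intro x hx
    have : x ∈ (alive N Q i).filter (D.tree.Adj u) ↔ x = p := by rw [hp]; simp
    rw [Finset.mem_filter] at this
    rw [D.tree.adj_comm, ← this]
    simp [hx]
  have hfilter_ne : ∀ x ∈ alive N Q i, x ≠ p → ((alive N Q i).erase u).filter (D.tree.Adj x) =
      (alive N Q i).filter (D.tree.Adj x) := by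
    intro x hx hxp
    ext y
    simp only [Finset.mem_filter, Finset.mem_erase]
    constructor
    · exact fun hh => ⟨hh.1.2, hh.2⟩
    · exact fun hh => ⟨⟨fun he => hxp ((hadj x hx).1 (he ▸ hh.2)), hh.1⟩, hh.2⟩
  have hfilter_p : ((alive N Q i).erase u).filter (D.tree.Adj p) =
      ((alive N Q i).filter (D.tree.Adj p)).erase u := by
    ext y
    simp only [Finset.mem_filter, Finset.mem_erase]
    tauto
  have humem : u ∈ (alive N Q i).filter (D.tree.Adj p) :=
    Finset.mem_filter.2 ⟨huS, hup.symm⟩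
  have hdegp : deg p.val = ((alive N Q i).filter (D.tree.Adj p)).card := by
    rw [h.deg_eq p hpS]
  have hdegp1 : 1 ≤ deg p.val := by rw [hdegp]; exact Finset.card_pos.2 ⟨u, humem⟩
  have hdegv : ∀ x : Fin N, deg' x.val = if x = p then deg p.val - 1 else deg x.val := by
    intro x
    rw [hdeg']
    split_ifs with hx
    · rw [hx, Function.update_self]
    · rw [Function.update_of_ne fun he => hx (Fin.ext he)]
  have hsub : ∀ x, x ∈ (alive N Q i).erase u → x ∈ alive N Q i ∧ x ≠ u := fun x hx =>
    ⟨Finset.mem_of_mem_erase hx, Finset.ne_of_mem_erase hx⟩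
  have hqq : q ≤ q' := by rw [hq']; split_ifs <;> omega
  refine ⟨?_, ?_, ?_, ?_, ?_, ?_, ?_, ?_⟩
  · rw [halive]
    exact h.closed.erase hu1
  · intro x hx
    rw [halive] at hx ⊢
    obtain ⟨hxS, hxu⟩ := hsub x hx
    rw [hdegv]
    split_ifs with hxp
    · rw [hxp, hfilter_p, Finset.card_erase_of_mem humem, hdegp]
    · rw [hfilter_ne x hxS hxp, h.deg_eq x hxS]
  · intro x hx
    rw [halive] at hx ⊢
    obtain ⟨hxS, hxu⟩ := hsub x hx
    by_cases hxp : x = p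
    · have := Finset.add_sum_erase _ (fun y : Fin N => y.val) humem
      rw [hxp, hnbr', Function.update_self, hfilter_p, h.nbr_eq p hpS]
      omega
    · rw [hnbr', Function.update_of_ne fun he => hxp (Fin.ext he), hfilter_ne x hxS hxp,
        h.nbr_eq x hxS]
  · omega
  · intro j hj
    by_cases hjq : j < q
    · rw [hQlt j hjq]; exact h.lt j hjq
    · rw [hq'] at hj
      split_ifs at hj with hd
      · obtain rfl : j = q := by omega
        rw [hQ', if_pos hd, Function.update_self]
        exact p.2
      · omega
  -- A node is queued when its degree drops from two to one; with degree two it cannot have been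
  -- queued before. A drop to zero does not queue it again.
  · have hnew : deg p.val - 1 = 1 → ∀ j < q, Q j ≠ p.val := by
      intro hd j hj he
      have := (h.leaf p hpS).2 ⟨j, hj, he⟩
      omega
    intro j k hj hk he
    by_cases hd : deg p.val - 1 = 1
    · have hQq : Q' q = p.val := by rw [hQ', if_pos hd, Function.update_self]
      rw [hq', if_pos hd] at hj hk
      rcases Nat.lt_succ_iff_lt_or_eq.1 hj with hj | rfl
      · rcases Nat.lt_succ_iff_lt_or_eq.1 hk with hk | rfl
        · rw [hQlt j hj, hQlt k hk] at he
          exact h.inj j k hj hk he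
        · rw [hQlt j hj, hQq] at he
          exact absurd he (hnew hd j hj)
      · rcases Nat.lt_succ_iff_lt_or_eq.1 hk with hk | rfl
        · rw [hQlt k hk, hQq] at he
          exact absurd he.symm (hnew hd k hk)
        · rfl
    · rw [hq', if_neg hd] at hj hk
      rw [hQlt j hj, hQlt k hk] at he
      exact h.inj j k hj hk he
  · intro x hx
    rw [halive] at hx
    obtain ⟨hxS, hxu⟩ := hsub x hx
    rw [hdegv]
    split_ifs with hxp
    · subst hxp
      constructor
      · intro hle
        by_cases hd : deg x.val - 1 = 1
        · exact ⟨q, by rw [hq', if_pos hd]; omega, by rw [hQ', if_pos hd, Function.update_self]⟩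
        · obtain ⟨j, hj, hjx⟩ := (h.leaf x hxS).1 (by omega)
          exact ⟨j, by omega, by rw [hQlt j hj, hjx]⟩
      · rintro ⟨j, hj, hjx⟩
        by_cases hd : deg x.val - 1 = 1
        · omega
        · rw [hq', if_neg hd] at hj
          rw [hQlt j hj] at hjx
          have := (h.leaf x hxS).2 ⟨j, hj, hjx⟩
          omega
    · rw [h.leaf x hxS]
      constructor
      · rintro ⟨j, hj, hjx⟩
        exact ⟨j, by omega, by rw [hQlt j hj, hjx]⟩
      · rintro ⟨j, hj, hjx⟩
        by_cases hjq : j < q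
        · exact ⟨j, hjq, by rw [← hQlt j hjq, hjx]⟩
        · rw [hq'] at hj
          split_ifs at hj with hd
          · obtain rfl : j = q := by omega
            rw [hQ', if_pos hd, Function.update_self] at hjx
            exact absurd (Fin.ext hjx.symm) hxp
          · omega
  · intro j hj
    rw [alive_congr (Q' := Q) fun k hk => hQlt k (by omega), hQlt j (by omega)]
    rcases Nat.lt_succ_iff_lt_or_eq.1 hj with hj | rfl
    · obtain ⟨u', p', h1, h2, h3, h4⟩ := h.done j hj
      refine ⟨u', p', h1, ?_, h3, h4⟩
      rw [Function.update_of_ne, h2]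
      intro he
      have := h.inj j i (by omega) hiq (by rw [h1, he])
      omega
    · refine ⟨u, p, rfl, Function.update_self _ _ _, ?_, ?_⟩
      · rw [alive_succ (u := u) rfl]
        exact Finset.mem_erase.2 ⟨hpu, hpS⟩
      · intro b hb
        rw [alive_succ (u := u) rfl] at hb
        obtain ⟨hbS, hbu⟩ := hsub b hb
        obtain ⟨w, hw, hpw⟩ := hpath b hbS hbu
        exact D.path u p b w hw hpw

/-- After `N - 1` steps one node is left. Its degree is at most one, so it is queued behind all
others, and the queue enumerates all nodes. -/
theorem finish (h : PruneInv D.tree D.bag (N - 1) deg nbr Q q par) {V : ℕ → Finset ℕ}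
    (hV : ∀ t : Fin N, V t.val = (D.bag t).image Fin.val) :
    ElimOrder N V Q par ∧ ∀ i < N, Q i < N := by
  classical
  have hN := D.nodes_pos
  have hcard : (alive N Q (N - 1)).card = N - (N - 1) :=
    card_alive (fun j hj => h.lt j (hj.trans_le h.le))
      fun j k hj hk => h.inj j k (hj.trans_le h.le) (hk.trans_le h.le)
  obtain ⟨r, hr⟩ := Finset.card_eq_one.1 (hcard.trans (by omega))
  have hrS : r ∈ alive N Q (N - 1) := by rw [hr]; simp
  have hdeg : deg r.val ≤ 1 := by
    rw [h.deg_eq r hrS]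
    refine (Finset.card_filter_le _ _).trans ?_
    rw [hcard]
    omega
  obtain ⟨j, hj, hjr⟩ := (h.leaf r hrS).1 hdeg
  have hjN : N - 1 ≤ j := by
    by_contra hcon
    exact mem_alive.1 hrS j (by omega) hjr
  have hlt : ∀ i < N, Q i < N := fun i hi => h.lt i (by omega)
  have hinj : ∀ i j, i < N → j < N → Q i = Q j → i = j := fun i j hi hj =>
    h.inj i j (by omega) (by omega)
  have hsurj : ∀ x : Fin N, ∃ k < N, Q k = x.val := by
    have hf : Function.Injective fun i : Fin N => (⟨Q i.val, hlt i i.2⟩ : Fin N) := by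
      intro a b hab
      exact Fin.ext (hinj a b a.2 b.2 (congrArg Fin.val hab))
    intro x
    obtain ⟨k, hk⟩ := Finite.injective_iff_surjective.1 hf x
    exact ⟨k.val, k.2, congrArg Fin.val hk⟩
  refine ⟨⟨hinj, ?_, ?_⟩, hlt⟩
  · intro i hi
    obtain ⟨u, p, h1, h2, h3, -⟩ := h.done i (by omega)
    obtain ⟨k, hk, hkp⟩ := hsurj p
    refine ⟨k, ?_, hk, by rw [h1, h2, hkp]⟩
    by_contra hcon
    exact mem_alive.1 h3 k (by omega) hkp
  · intro i k hik hk
    obtain ⟨u, p, h1, h2, -, h4⟩ := h.done i (by omega)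
    have hb : (⟨Q k, hlt k hk⟩ : Fin N) ∈ alive N Q (i + 1) := by
      rw [mem_alive]
      intro j hj he
      have := hinj j k (by omega) hk he
      omega
    have hsub := h4 _ hb
    have hk' := hV ⟨Q k, hlt k hk⟩
    simp only at hk'
    rw [h1, h2, hk', hV, hV]
    intro v hv
    obtain ⟨hv1, hv2⟩ := Finset.mem_inter.1 hv
    obtain ⟨x, hx, rfl⟩ := Finset.mem_image.1 hv1
    obtain ⟨y, hy, hyx⟩ := Finset.mem_image.1 hv2
    obtain rfl := Fin.ext hyx
    exact Finset.mem_image_of_mem _ (hsub (Finset.mem_inter.2 ⟨hx, hy⟩))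

end PruneInv

open Classical in
/-- Summing over the neighbours of a node by running through the list of edges. -/
theorem TreeDecomposition.Listing.sum_edges {n N : ℕ} {G : SimpleGraph (Fin n)}
    {D : TreeDecomposition G N} (L : D.Listing) (x : Fin N) (φ : Fin N → ℕ) :
    (L.edges.map fun e => (if e.1 = x then φ e.2 else 0) + if e.2 = x then φ e.1 else 0).sum =
      ∑ y ∈ Finset.univ.filter (D.tree.Adj x), φ y := by
  -- For an arbitrary list without loops, the scan is a sum over all `y` weighted by the
  -- multiplicity of the edge between `x` and `y`; in the listing this multiplicity is one or zero.
  have key : ∀ l : List (Fin N × Fin N), (∀ e ∈ l, e.1 ≠ e.2) →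
      (l.map fun e => (if e.1 = x then φ e.2 else 0) + if e.2 = x then φ e.1 else 0).sum =
        ∑ y, (l.map fun e => s(e.1, e.2)).count s(x, y) * φ y := by
    intro l hl
    induction l with
    | nil => simp
    | cons e l ih =>
      rw [List.map_cons, List.sum_cons, ih fun e he => hl e (by simp [he])]
      simp only [List.map_cons, List.count_cons, add_mul, Finset.sum_add_distrib]
      rw [add_comm]
      congr 1
      have hne := hl e (by simp)
      obtain ⟨a, b⟩ := e
      simp only at hne ⊢
      have : ∀ y, (if (s(a, b) == s(x, y)) = true then 1 else 0) * φ y =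
          (if a = x then (if y = b then φ y else 0) else 0) +
            if b = x then (if y = a then φ y else 0) else 0 := by
        intro y
        by_cases ha : a = x
        · have hb : b ≠ x := fun hb => hne (ha.trans hb.symm)
          subst ha
          by_cases hy : y = b
          · simp [hy, hb]
          · simp [hy, hb, Ne.symm hy]
        · by_cases hb : b = x
          · subst hb
            by_cases hy : y = a
            · simp [hy, ha, Sym2.eq_swap]
            · simp [hy, ha, Ne.symm hy]
          · simp [ha, hb]
      simp_rw [this]
      rw [Finset.sum_add_distrib]
      by_cases ha : a = x <;> by_cases hb : b = x <;> simp [ha, hb]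
  have hmem : ∀ e ∈ L.edges, D.tree.Adj e.1 e.2 := fun e he =>
    (SimpleGraph.mem_edgeSet _).1 ((L.mem_edges _).1 (List.mem_map_of_mem he))
  rw [key _ fun e he => (hmem e he).ne, Finset.sum_filter]
  refine Finset.sum_congr rfl fun y _ => ?_
  by_cases hy : D.tree.Adj x y
  · rw [if_pos hy, List.count_eq_one_of_mem L.edges_nodup ((L.mem_edges _).2
      ((SimpleGraph.mem_edgeSet _).2 hy)), one_mul]
  · rw [if_neg hy, List.count_eq_zero_of_not_mem fun h => hy
      ((SimpleGraph.mem_edgeSet _).1 ((L.mem_edges _).1 h)), zero_mul]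

/-- The number of edges is not part of the input, so the program relies on this value. -/
theorem TreeDecomposition.Listing.length_edges {n N : ℕ} {G : SimpleGraph (Fin n)}
    {D : TreeDecomposition G N} (L : D.Listing) : L.edges.length = N - 1 := by
  classical
  have h1 : (L.edges.map fun e => s(e.1, e.2)).toFinset = D.tree.edgeFinset := by
    ext e
    rw [List.mem_toFinset, L.mem_edges, SimpleGraph.mem_edgeFinset]
  have h2 := congrArg Finset.card h1
  rw [List.toFinset_card_of_nodup L.edges_nodup, List.length_map] at h2
  have h3 := D.isTree.card_edgeFinset
  rw [Fintype.card_fin] at h3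
  omega

/-! ### The leaf-pruning programs -/

namespace RealRAM

/-- The program that computes the degrees and the sums of the neighbours in the tree. -/
def edgeProgram : Program :=
  .forN 30 (.sub (.get 0 (.lit 2)) (.lit 1))
    (.seq (.setNat 40 (.lit 0) (.get 1 (.add (.var 30) (.var 30))))
    (.seq (.setNat 41 (.lit 0) (.get 1 (.add (.add (.var 30) (.var 30)) (.lit 1))))
    (.seq (.setNat 9 (.var 40) (.add (.get 9 (.var 40)) (.lit 1)))
    (.seq (.setNat 9 (.var 41) (.add (.get 9 (.var 41)) (.lit 1)))
    (.seq (.setNat 10 (.var 40) (.add (.get 10 (.var 40)) (.var 41)))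
    (.setNat 10 (.var 41) (.add (.get 10 (.var 41)) (.var 40))))))))

theorem edgeProgram_spec {N : ℕ} {u v : ℕ → ℕ} {s : State} (h0 : s.nat 0 2 = N)
    (hu : ∀ e < N - 1, s.nat 1 (e + e) = u e) (hv : ∀ e < N - 1, s.nat 1 (e + e + 1) = v e)
    (h9 : ∀ x, s.nat 9 x = 0) (h10 : ∀ x, s.nat 10 x = 0) :
    Spec edgeProgram s (100 * N + 20) fun s' =>
      (∀ x, s'.nat 9 x = ∑ e ∈ Finset.range (N - 1),
        ((if u e = x then 1 else 0) + if v e = x then 1 else 0)) ∧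
      ∀ x, s'.nat 10 x = ∑ e ∈ Finset.range (N - 1),
        ((if u e = x then v e else 0) + if v e = x then u e else 0) := by
  refine (Spec.forN (N - 1) 60 (fun j s' =>
      (∀ x, s'.nat 9 x = ∑ e ∈ Finset.range j,
        ((if u e = x then 1 else 0) + if v e = x then 1 else 0)) ∧
      ∀ x, s'.nat 10 x = ∑ e ∈ Finset.range j,
        ((if u e = x then v e else 0) + if v e = x then u e else 0)) rfl
    (fun s' hs => by simp [NatExp.eval, hs.nat 0 rfl, h0]) (by simp [h9, h10])
    fun j hj s' hs hj' hI => ?_).weaken ?_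
  · refine (Spec.straight _ _ rfl ?_).weaken (by decide)
    have eu : s'.nat 1 (j + j) = u j := by rw [hs.nat 1 rfl, hu j hj]
    have ev : s'.nat 1 (j + j + 1) = v j := by rw [hs.nat 1 rfl, hv j hj]
    constructor
    · intro x
      rw [Finset.sum_range_succ, ← hI.1 x]
      simp only [Program.exec, NatExp.eval, State.putNat_nat_self, ne_eq,
        Nat.reduceEqDiff, not_false_eq_true, State.putNat_nat_of_ne, hj', eu, ev,
        Function.update_apply, eq_comm (a := x)]
      split_ifs <;> simp_all
    · intro x
      rw [Finset.sum_range_succ, ← hI.2 x]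
      simp only [Program.exec, NatExp.eval, State.putNat_nat_self, ne_eq,
        Nat.reduceEqDiff, not_false_eq_true, State.putNat_nat_of_ne, hj', eu, ev,
        Function.update_apply, eq_comm (a := x)]
      split_ifs <;> simp_all
      all_goals omega
  · simp only [NatExp.cost]; omega

/-- Append the value of `e` to the queue. -/
def push (e : NatExp) : Program :=
  .seq (.setNat 11 (.var 12) e) (.setNat 12 (.lit 0) (.add (.var 12) (.lit 1)))

/-- The program that puts the leaves into the queue. -/
def queueProgram : Program :=
  .forN 30 (.get 0 (.lit 2)) (.ite (.natLt (.get 9 (.var 30)) (.lit 2)) (push (.var 30)) .skip)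

theorem queueProgram_spec {N : ℕ} {s : State} (h0 : s.nat 0 2 = N) (h12 : s.nat 12 0 = 0) :
    Spec queueProgram s (60 * N + 20) fun s' =>
      (∀ i < s'.nat 12 0, s'.nat 11 i < N) ∧
      (∀ i j, i < s'.nat 12 0 → j < s'.nat 12 0 → s'.nat 11 i = s'.nat 11 j → i = j) ∧
      ∀ x < N, s.nat 9 x ≤ 1 ↔ ∃ j < s'.nat 12 0, s'.nat 11 j = x := by
  refine (Spec.forN N 40 (fun k s' => (∀ i < s'.nat 12 0, s'.nat 11 i < k) ∧
      (∀ i j, i < s'.nat 12 0 → j < s'.nat 12 0 → s'.nat 11 i = s'.nat 11 j → i = j) ∧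
      ∀ x < k, s.nat 9 x ≤ 1 ↔ ∃ j < s'.nat 12 0, s'.nat 11 j = x) rfl
    (fun s' hs => by simp [NatExp.eval, hs.nat 0 rfl, h0]) (by simp [h12])
    fun k hk s' hs hk' hI => ?_).weaken ?_
  · refine (Spec.straight _ _ rfl ?_).weaken (by decide)
    obtain ⟨hlt, hinj, hleaf⟩ := hI
    have hiff : (Test.natLt (.get 9 (.var 30)) (.lit 2)).Holds s' ↔ s.nat 9 k ≤ 1 := by
      simp only [Test.Holds, NatExp.eval, hk', hs.nat 9 rfl]; omega
    by_cases h : s.nat 9 k ≤ 1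
    · rw [Program.exec_ite_pos (hiff.2 h)]
      simp only [push, Program.exec, NatExp.eval, State.putNat_nat_self, ne_eq,
        Nat.reduceEqDiff, not_false_eq_true, State.putNat_nat_of_ne, hk',
        Function.update_apply, if_true]
      generalize s'.nat 12 0 = q at *
      refine ⟨fun i hi => ?_, fun i j hi hj => ?_, fun x hx => ?_⟩
      · split_ifs with h1
        · omega
        · have := hlt i (by omega)
          omega
      · split_ifs with h1 h2 h2
        · omega
        · intro he
          have := hlt j (by omega)
          omega
        · intro he
          have := hlt i (by omega)
          omega
        · exact hinj i j (by omega) (by omega)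
      · rcases Nat.lt_succ_iff_lt_or_eq.1 hx with hx | rfl
        · rw [hleaf x hx]
          constructor
          · rintro ⟨j, hj, rfl⟩
            exact ⟨j, by omega, by rw [if_neg (by omega)]⟩
          · rintro ⟨j, hj, he⟩
            split_ifs at he with h1
            · omega
            · exact ⟨j, by omega, he⟩
        · exact iff_of_true h ⟨q, by omega, if_pos rfl⟩
    · rw [Program.exec_ite_neg (mt hiff.1 h)]
      simp only [Program.exec, ne_eq, Nat.reduceEqDiff, not_false_eq_true,
        State.putNat_nat_of_ne]
      refine ⟨fun i hi => (hlt i hi).trans (by omega), hinj, fun x hx => ?_⟩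
      rcases Nat.lt_succ_iff_lt_or_eq.1 hx with hx | rfl
      · exact hleaf x hx
      · refine iff_of_false h ?_
        rintro ⟨j, hj, he⟩
        have := hlt j hj
        omega
  · simp only [NatExp.cost]; omega

/-- The program that prunes the leaves one after the other. -/
def leafProgram : Program :=
  .forN 30 (.sub (.get 0 (.lit 2)) (.lit 1))
    (.seq (.setNat 40 (.lit 0) (.get 11 (.var 30)))
    (.seq (.setNat 41 (.lit 0) (.get 10 (.var 40)))
    (.seq (.setNat 13 (.var 40) (.var 41))
    (.seq (.setNat 9 (.var 41) (.sub (.get 9 (.var 41)) (.lit 1)))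
    (.seq (.setNat 10 (.var 41) (.sub (.get 10 (.var 41)) (.var 40)))
    (.ite (.natEq (.get 9 (.var 41)) (.lit 1)) (push (.var 41)) .skip))))))

theorem leafProgram_spec {n N : ℕ} {G : SimpleGraph (Fin n)} {D : TreeDecomposition G N}
    {s : State} (h0 : s.nat 0 2 = N)
    (h : PruneInv D.tree D.bag 0 (s.nat 9) (s.nat 10) (s.nat 11) (s.nat 12 0) (s.nat 13)) :
    Spec leafProgram s (100 * N + 20) fun s' =>
      PruneInv D.tree D.bag (N - 1) (s'.nat 9) (s'.nat 10) (s'.nat 11) (s'.nat 12 0)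
        (s'.nat 13) := by
  refine (Spec.forN (N - 1) 60 (fun i s' => PruneInv D.tree D.bag i (s'.nat 9) (s'.nat 10)
    (s'.nat 11) (s'.nat 12 0) (s'.nat 13)) rfl
    (fun s' hs => by simp [NatExp.eval, hs.nat 0 rfl, h0]) (by simpa using h)
    fun i hi s' hs hi' hI => ?_).weaken ?_
  · refine (Spec.straight _ _ rfl ?_).weaken (by decide)
    obtain ⟨hiq, u, p, hu, hp, hpu, hnext⟩ := hI.exists_step (by omega)
    have hpu' : p.val ≠ u.val := fun he => hpu (Fin.ext he)
    have := hnext _ _ _ _ rfl rfl rfl rfl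
    by_cases hd : s'.nat 9 p.val - 1 = 1
    · rw [if_pos hd, if_pos hd] at this
      convert this using 1 <;>
      simp [Program.exec, Test.Holds, push, NatExp.eval, hi', hu, hp, hd]
    · rw [if_neg hd, if_neg hd] at this
      convert this using 1 <;>
      simp [Program.exec, Test.Holds, NatExp.eval, hi', hu, hp, hd]
  · simp only [NatExp.cost]; omega

/-- The program that computes an elimination ordering. -/
def pruneProgram : Program := .seq edgeProgram (.seq queueProgram leafProgram)

theorem pruneProgram_spec {n N : ℕ} {G : SimpleGraph (Fin n)} {D : TreeDecomposition G N}
    (L : D.Listing) {V : ℕ → Finset ℕ} (hV : ∀ t : Fin N, V t.val = (D.bag t).image Fin.val)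
    {s : State} (h0 : s.nat 0 2 = N)
    (h1 : ∀ e (he : e < L.edges.length), s.nat 1 (e + e) = (L.edges[e]).1.val ∧
      s.nat 1 (e + e + 1) = (L.edges[e]).2.val)
    (h9 : ∀ x, s.nat 9 x = 0) (h10 : ∀ x, s.nat 10 x = 0) (h12 : s.nat 12 0 = 0) :
    Spec pruneProgram s (260 * N + 60) fun s' =>
      ElimOrder N V (s'.nat 11) (s'.nat 13) ∧ ∀ i < N, s'.nat 11 i < N := by
  classical
  have hlen := L.length_edges
  have hN := D.nodes_pos
  -- The constant `φ = 1` gives the degrees, the identity gives the sums of the neighbours.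
  have hsum : ∀ (x : Fin N) (φ : ℕ → ℕ), ∑ e ∈ Finset.range (N - 1),
      ((if s.nat 1 (e + e) = x.val then φ (s.nat 1 (e + e + 1)) else 0) +
        if s.nat 1 (e + e + 1) = x.val then φ (s.nat 1 (e + e)) else 0) =
      ∑ y ∈ Finset.univ.filter (D.tree.Adj x), φ y.val := by
    intro x φ
    rw [← L.sum_edges x fun y => φ y.val, ← hlen, Finset.sum_range, ← List.sum_ofFn]
    congr 1
    apply List.ext_getElem
    · simp
    · intro e he _
      simp only [List.length_ofFn] at he
      obtain ⟨e1, e2⟩ := h1 e he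
      simp [e1, e2, Fin.ext_iff]
  refine (Spec.seq (edgeProgram_spec h0 (fun _ _ => rfl) (fun _ _ => rfl) h9 h10)
    fun s₁ hs₁ h₁ => Spec.seq (queueProgram_spec (s := s₁) (N := N)
      (by rw [hs₁.nat 0 rfl, h0]) (by rw [hs₁.nat 12 rfl, h12]))
    fun s₂ hs₂ h₂ => (leafProgram_spec (D := D) (s := s₂)
      (by rw [hs₂.nat 0 rfl, hs₁.nat 0 rfl, h0]) ?_).post
    fun s₃ _ h₃ => h₃.finish hV).weaken (by omega)
  have halive : alive N (s₂.nat 11) 0 = Finset.univ := by ext x; simp [mem_alive]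
  obtain ⟨h₂a, h₂b, h₂c⟩ := h₂
  refine ⟨?_, ?_, ?_, Nat.zero_le _, h₂a, h₂b, ?_, by simp⟩
  · rw [halive]; exact SimpleGraph.pathClosed_univ
  · intro x _
    rw [halive, hs₂.nat 9 rfl, h₁.1, Finset.card_eq_sum_ones]
    convert hsum x (fun _ => 1)
  · intro x _
    rw [halive, hs₂.nat 10 rfl, h₁.2]
    convert hsum x (fun y => y)
  · intro x _
    rw [hs₂.nat 9 rfl]
    exact h₂c x x.2

end RealRAM

/-! ### Colouring the vertices -/

/-- The state of the greedy colouring of the bag `l`, when the vertices in `S` have colours and those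
in `S₀` had colours before; the colour `c` is represented by `c + 1`. -/
structure ColourInv (K : ℕ) (l : List ℕ) (S₀ : Finset ℕ) (col₀ : ℕ → ℕ) (S : Finset ℕ)
    (col used : ℕ → ℕ) : Prop where
  le : ∀ v, col v ≤ K
  pos : ∀ v, col v ≠ 0 ↔ v ∈ S
  old : ∀ v ∈ S₀, col v = col₀ v
  sub : S₀ ⊆ S
  used_iff : ∀ c < K, used c = 0 ↔ ∀ v ∈ l, col v ≠ c + 1
  inj : ∀ v ∈ l, ∀ w ∈ l, col v ≠ 0 → col v = col w → v = w

namespace ColourInv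

variable {K : ℕ} {l : List ℕ} {S₀ S : Finset ℕ} {col₀ col used : ℕ → ℕ}

theorem insert (h : ColourInv K l S₀ col₀ S col used) {v c : ℕ} (hv : v ∈ l) (hvS : v ∉ S)
    (hc : c < K) (hu : used c = 0) :
    ColourInv K l S₀ col₀ (Insert.insert v S) (Function.update col v (c + 1))
      (Function.update used c 1) := by
  have hfree := (h.used_iff c hc).1 hu
  refine ⟨fun w => ?_, fun w => ?_, fun w hw => ?_, h.sub.trans (Finset.subset_insert _ _),
    fun d hd => ?_, fun a ha b hb => ?_⟩
  · rw [Function.update_apply]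
    split_ifs
    · omega
    · exact h.le w
  · rw [Function.update_apply, Finset.mem_insert, ← h.pos w]
    split_ifs with hw <;> simp [hw]
  · rw [Function.update_of_ne, h.old w hw]
    rintro rfl
    exact hvS (h.sub hw)
  · have hcv : col v = 0 := by
      by_contra hne
      exact hvS ((h.pos v).1 hne)
    rw [Function.update_apply]
    split_ifs with hdc
    · subst hdc
      refine iff_of_false id ?_
      exact fun hcon => hcon v hv (Function.update_self _ _ _)
    · rw [h.used_iff d hd]
      refine forall₂_congr fun w _ => ?_
      rw [Function.update_apply]
      split_ifs with hw
      · rw [hw, hcv]; omega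
      · rfl
  · simp only [Function.update_apply]
    split_ifs with h1 h2 h2
    · exact fun _ _ => h1.trans h2.symm
    · exact fun _ he => absurd he.symm (hfree b hb)
    · exact fun _ he => absurd he (hfree a ha)
    · exact h.inj a ha b hb

/-- Pigeonhole: if all `K` colours occurred in the bag, the vertices carrying them together with the
uncoloured `v` would be `K + 1` members. -/
theorem exists_free (h : ColourInv K l S₀ col₀ S col used) {v : ℕ} (hl : l.length ≤ K)
    (hv : v ∈ l) (hvS : v ∉ S) : ∃ c < K, used c = 0 := by
  by_contra! hcon
  have hex : ∀ c < K, ∃ w ∈ l, col w = c + 1 := by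
    intro c hc
    have := mt (h.used_iff c hc).2 (hcon c hc)
    push Not at this
    exact this
  choose! f hf using hex
  have hsub : (Finset.range K).image f ⊆ l.toFinset.erase v := by
    intro w hw
    obtain ⟨c, hc, rfl⟩ := Finset.mem_image.1 hw
    obtain ⟨h1, h2⟩ := hf c (Finset.mem_range.1 hc)
    refine Finset.mem_erase.2 ⟨?_, List.mem_toFinset.2 h1⟩
    intro he
    exact hvS (he ▸ (h.pos (f c)).1 (by omega))
  have hcard := Finset.card_le_card hsub
  rw [Finset.card_image_of_injOn, Finset.card_range,
    Finset.card_erase_of_mem (List.mem_toFinset.2 hv)] at hcard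
  · have h1 := List.toFinset_card_le l
    have h2 : 0 < l.toFinset.card := Finset.card_pos.2 ⟨v, List.mem_toFinset.2 hv⟩
    omega
  · intro a ha b hb hab
    have h1 := (hf a (Finset.mem_range.1 ha)).2
    have h2 := (hf b (Finset.mem_range.1 hb)).2
    rw [hab] at h1
    omega

end ColourInv

namespace RealRAM

theorem getD_mem {l : List ℕ} {j : ℕ} (h : j < l.length) : l.getD j 0 ∈ l := by
  rw [List.getD_eq_getElem _ _ h]
  exact List.getElem_mem h

theorem mem_take_succ {l : List ℕ} {j v : ℕ} (h : j < l.length) :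
    v ∈ l.take (j + 1) ↔ v ∈ l.take j ∨ v = l.getD j 0 := by
  rw [List.getD_eq_getElem _ _ h, List.take_succ_eq_append_getElem h, List.mem_append,
    List.mem_singleton]

/-- The program that gives a free colour to the vertex in the variable `42`. -/
def chooseColour : Program :=
  .forN 31 (.var 4) (.ite (.and (.natEq (.get 14 (.var 42)) (.lit 0))
    (.natEq (.get 15 (.var 31)) (.lit 0)))
    (.seq (.setNat 14 (.var 42) (.add (.var 31) (.lit 1))) (.setNat 15 (.var 31) (.lit 1))) .skip)

/-- The loop runs through all colours and acts only while the vertex is uncoloured. So at any time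
the vertex has its colour, or all colours tried so far are in use. -/
theorem chooseColour_spec {K v : ℕ} {l : List ℕ} {S₀ S : Finset ℕ} {col₀ : ℕ → ℕ} {s : State}
    (h4 : s.nat 4 0 = K) (h42 : s.nat 42 0 = v) (hl : l.length ≤ K) (hv : v ∈ l)
    (h : ColourInv K l S₀ col₀ S (s.nat 14) (s.nat 15)) :
    Spec chooseColour s (50 * K + 20) fun s' =>
      ColourInv K l S₀ col₀ (insert v S) (s'.nat 14) (s'.nat 15) := by
  refine ((Spec.forN K 35 (fun i s' => ColourInv K l S₀ col₀ (insert v S) (s'.nat 14) (s'.nat 15) ∨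
    (v ∉ S ∧ ColourInv K l S₀ col₀ S (s'.nat 14) (s'.nat 15) ∧ ∀ c < i, s'.nat 15 c ≠ 0)) rfl
    (fun s' hs => by simp [NatExp.eval, hs.nat 4 rfl, h4]) ?_ fun i hi s' hs hi' hI => ?_).weaken
    ?_).post fun s' _ hI => ?_
  · by_cases hvS : v ∈ S
    · left
      rw [Finset.insert_eq_of_mem hvS]
      simpa using h
    · right
      exact ⟨hvS, by simpa using h, by simp⟩
  · refine (Spec.straight _ _ rfl ?_).weaken (by decide)
    have e42 : s'.nat 42 0 = v := by rw [hs.nat 42 rfl, h42]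
    rcases hI with hI | ⟨hvS, hI, hused⟩
    · left
      rw [Program.exec_ite_neg]
      · simpa [Program.exec] using hI
      · simp only [Test.Holds, NatExp.eval, e42]
        exact fun hh => (hI.pos v).2 (Finset.mem_insert_self _ _) hh.1
    · have hcv : s'.nat 14 v = 0 := by
        by_contra hne
        exact hvS ((hI.pos v).1 hne)
      by_cases hu : s'.nat 15 i = 0
      · left
        rw [Program.exec_ite_pos]
        · have := hI.insert hv hvS hi hu
          simpa [Program.exec, NatExp.eval, e42, hi'] using this
        · simp [Test.Holds, NatExp.eval, e42, hi', hcv, hu]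
      · right
        rw [Program.exec_ite_neg]
        · refine ⟨hvS, by simpa [Program.exec] using hI, fun c hc => ?_⟩
          rcases Nat.lt_succ_iff_lt_or_eq.1 hc with hc | rfl
          · simpa [Program.exec] using hused c hc
          · simpa [Program.exec] using hu
        · simp [Test.Holds, NatExp.eval, hi', hu]
  · simp only [NatExp.cost]; omega
  · rcases hI with hI | ⟨hvS, hI, hused⟩
    · exact hI
    · obtain ⟨c, hc, hc0⟩ := hI.exists_free hl hv hvS
      exact absurd hc0 (hused c hc)

/-- The program that marks the colours in the bag of the node in the variable `43`. -/
def markUsed : Program :=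
  .seq (.fillNat 31 (.var 4) 15 (.lit 0) (.lit 0))
  (.forBag 43 (.ite (.natLt (.lit 0) (.get 14 (.var 42)))
    (.setNat 15 (.sub (.get 14 (.var 42)) (.lit 1)) (.lit 1)) .skip))

theorem markUsed_spec {n m N K t : ℕ} {bg : ℕ → List ℕ} {α : ℕ → ℝ} {β : ℕ → ℕ → ℝ} {s : State}
    (hin : Input n m N bg α β s) (h4 : s.nat 4 0 = K) (h43 : s.nat 43 0 = t) (ht : t < N)
    (hl : (bg t).length ≤ K) :
    Spec markUsed s (80 * K + 50) fun s' =>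
      ∀ c < K, s'.nat 15 c = 0 ↔ ∀ v ∈ bg t, s.nat 14 v ≠ c + 1 := by
  refine (Spec.seq (c := K * 18 + 9) (c' := K * 58 + 16)
    (R := fun s' => ∀ c < K, s'.nat 15 c = 0) ?_ fun s₁ hs₁ h₁ => ?_).weaken (by omega)
  · refine (Spec.fillNat (i := 31) (d := 15) K 0 (fun _ => 0) (by decide)
      (fun s' hs _ => by simp [NatExp.eval, hs 4, h4])
      (fun j _ s' hs _ _ _ => by simp [NatExp.eval])).weaken ?_ |>.post ?_
    · simp [NatExp.cost]
    · intro s' _ h c hc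
      simpa using h.1 c hc
  · refine (Spec.forBag (hin.of_eq (hs₁.nat 0 rfl) (hs₁.nat 2 rfl) (hs₁.nat 3 rfl)
      (hs₁.real 0 rfl) (hs₁.real 1 rfl)) ht (by rw [hs₁.nat 43 rfl, h43]) 30
      (fun j s' => ∀ c < K, s'.nat 15 c = 0 ↔ ∀ v ∈ (bg t).take j, s.nat 14 v ≠ c + 1)
      rfl rfl rfl rfl (by decide) (by decide) ?_ ?_ ?_).weaken ?_ |>.post ?_
    · rintro j s' a x (rfl | rfl) h <;> simpa using h
    · simpa using h₁
    · intro j hj s' hs hv hI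
      refine (Spec.straight _ _ rfl ?_).weaken (by decide)
      have e14 : s'.nat 14 = s.nat 14 := by rw [hs.nat 14 rfl, hs₁.nat 14 rfl]
      have hiff : (Test.natLt (.lit 0) (.get 14 (.var 42))).Holds s' ↔
          0 < s.nat 14 ((bg t).getD j 0) := by simp [Test.Holds, NatExp.eval, e14, hv]
      have hsplit : ∀ c, (∀ v ∈ (bg t).take (j + 1), s.nat 14 v ≠ c + 1) ↔
          (∀ v ∈ (bg t).take j, s.nat 14 v ≠ c + 1) ∧ s.nat 14 ((bg t).getD j 0) ≠ c + 1 := by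
        intro c
        simp only [mem_take_succ hj, or_imp, forall_and, forall_eq]
      by_cases hc : 0 < s.nat 14 ((bg t).getD j 0)
      · rw [Program.exec_ite_pos (hiff.2 hc)]
        intro c hcK
        simp only [Program.exec, NatExp.eval, State.putNat_nat_self, hv, e14,
          Function.update_apply]
        rw [hsplit, ← hI c hcK]
        split_ifs with he
        · refine iff_of_false id fun hh => hh.2 (by omega)
        · exact ⟨fun h => ⟨h, by omega⟩, fun h => h.1⟩
      · rw [Program.exec_ite_neg (mt hiff.1 hc)]
        intro c hcK
        rw [hsplit, ← hI c hcK, Program.exec]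
        exact ⟨fun h => ⟨h, by omega⟩, fun h => h.1⟩
    · have := Nat.mul_le_mul_right 58 hl
      simpa using this
    · intro s' _ h
      rw [List.take_length] at h
      exact h

/-- The program that colours the bag of the node in the variable `43`. -/
def colourBag : Program := .seq markUsed (.forBag 43 chooseColour)

theorem colourBag_spec {n m N K t : ℕ} {bg : ℕ → List ℕ} {α : ℕ → ℝ} {β : ℕ → ℕ → ℝ} {s : State}
    (hin : Input n m N bg α β s) (h4 : s.nat 4 0 = K) (h43 : s.nat 43 0 = t) (ht : t < N)
    (hl : (bg t).length ≤ K) {S : Finset ℕ} (hle : ∀ v, s.nat 14 v ≤ K)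
    (hpos : ∀ v, s.nat 14 v ≠ 0 ↔ v ∈ S)
    (hinj : ∀ v ∈ bg t, ∀ w ∈ bg t, s.nat 14 v ≠ 0 → s.nat 14 v = s.nat 14 w → v = w) :
    Spec colourBag s (50 * (K * K) + 200 * K + 100) fun s' =>
      ColourInv K (bg t) S (s.nat 14) (S ∪ (bg t).toFinset) (s'.nat 14) (s'.nat 15) := by
  refine (Spec.seq (markUsed_spec hin h4 h43 ht hl) (c' := K * (50 * K + 20 + 28) + 16)
    fun s₁ hs₁ h₁ => ?_).weaken (by nlinarith)
  refine (Spec.forBag (hin.of_eq (hs₁.nat 0 rfl) (hs₁.nat 2 rfl) (hs₁.nat 3 rfl)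
    (hs₁.real 0 rfl) (hs₁.real 1 rfl)) ht (by rw [hs₁.nat 43 rfl, h43]) (50 * K + 20)
    (fun j s' => ColourInv K (bg t) S (s.nat 14) (S ∪ ((bg t).take j).toFinset) (s'.nat 14)
      (s'.nat 15))
    rfl rfl rfl rfl (by decide) (by decide) ?_ ?_ ?_).weaken ?_ |>.post ?_
  · rintro j s' a x (rfl | rfl) h <;> simpa using h
  · rw [hs₁.nat 14 rfl]
    simpa using ⟨hle, hpos, fun _ _ => rfl, subset_rfl, h₁, hinj⟩
  · intro j hj s' hs hv hI
    refine (chooseColour_spec (by rw [hs.nat 4 rfl, hs₁.nat 4 rfl, h4]) hv hl (getD_mem hj)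
      hI).post fun s'' _ h => ?_
    convert h using 1
    ext w
    simp only [Finset.mem_union, Finset.mem_insert, List.mem_toFinset, mem_take_succ hj]
    tauto
  · have := Nat.mul_le_mul_right (50 * K + 20 + 28) hl
    simpa using this
  · intro s' _ h
    rw [List.take_length] at h
    exact h

/-- The program that colours the vertices, from the root of the tree to the leaves. -/
def colourProgram : Program :=
  .forN 30 (.get 0 (.lit 2))
    (.seq (.setNat 43 (.lit 0) (.get 11 (.sub (.sub (.get 0 (.lit 2)) (.lit 1)) (.var 30))))
    colourBag)

theorem sq_le_three_pow (K : ℕ) : K * K ≤ 3 ^ K :=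
  (Nat.mul_le_mul_left K (Nat.lt_two_pow_self).le).trans (mul_two_pow_le K)

/-- The nodes are visited against the elimination order. By running intersection the vertices of a
bag that are already coloured lie in the bag of the parent, where their colours are distinct, so
greedy colouring succeeds with `K` colours. The quadratic cost per bag is below a multiple of `3 ^
K`. -/
theorem colourProgram_spec {n m N K : ℕ} {bg : ℕ → List ℕ} {α : ℕ → ℝ} {β : ℕ → ℕ → ℝ} {s : State}
    (hin : Input n m N bg α β s) (h4 : s.nat 4 0 = K) (hl : ∀ t < N, (bg t).length ≤ K)
    (h : ElimOrder N (fun t => (bg t).toFinset) (s.nat 11) (s.nat 13))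
    (hQ : ∀ i < N, s.nat 11 i < N) (h14 : ∀ v, s.nat 14 v = 0) :
    Spec colourProgram s (500 * (N * 3 ^ K) + 20) fun s' =>
      (∀ t < N, ∀ v ∈ bg t, s'.nat 14 v ≠ 0 ∧ s'.nat 14 v ≤ K) ∧
      ∀ t < N, ∀ v ∈ bg t, ∀ w ∈ bg t, s'.nat 14 v = s'.nat 14 w → v = w := by
  refine (Spec.forN N (50 * (K * K) + 200 * K + 120) (fun k s' => (∀ v, s'.nat 14 v ≤ K) ∧
      (∀ v, s'.nat 14 v ≠ 0 ↔ ∃ j < k, v ∈ bg (s.nat 11 (N - 1 - j))) ∧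
      ∀ j < k, ∀ v ∈ bg (s.nat 11 (N - 1 - j)), ∀ w ∈ bg (s.nat 11 (N - 1 - j)),
        s'.nat 14 v = s'.nat 14 w → v = w) rfl
    (fun s' hs => by simp [NatExp.eval, hs.nat 0 rfl, hin.nodes]) (by simp [h14])
    fun k hk s' hs hk' hI => ?_).weaken ?_ |>.post fun s' _ hI => ?_
  · obtain ⟨hle, hpos, hinj⟩ := hI
    set t := s.nat 11 (N - 1 - k) with ht
    refine (Spec.seq (c' := 50 * (K * K) + 200 * K + 100) (Spec.straight _ _ rfl (R := fun s'' =>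
      s'' = s'.putNat 43 0 t) (by
        simp [Program.exec, NatExp.eval, hs.nat 0 rfl, hin.nodes, hk', hs.nat 11 rfl, ht]))
      fun s₁ hs₁ h₁ => ?_).weaken (by simp only [Program.time, NatExp.cost]; omega)
    have hold : ∀ v ∈ bg t, ∀ j < k, v ∈ bg (s.nat 11 (N - 1 - j)) →
        v ∈ bg (s.nat 13 t) := by
      intro v hv j hj hvj
      have := h.inter (N - 1 - k) (N - 1 - j) (by omega) (by omega)
        (Finset.mem_inter.2 ⟨List.mem_toFinset.2 hv, List.mem_toFinset.2 hvj⟩)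
      exact List.mem_toFinset.1 this
    have e14 : s₁.nat 14 = s'.nat 14 := by rw [h₁]; exact State.putNat_nat_of_ne _ _ _ (by decide)
    refine (colourBag_spec (S := (Finset.range k).biUnion fun j =>
        (bg (s.nat 11 (N - 1 - j))).toFinset) (hin.of_eq ?_ ?_ ?_ ?_ ?_) (K := K) ?_ (t := t) ?_
      (hQ _ (by omega)) (hl _ (hQ _ (by omega))) ?_ ?_ ?_).post fun s₂ hs₂ h₂ => ?_
    · rw [hs₁.nat 0 rfl, hs.nat 0 rfl]
    · rw [hs₁.nat 2 rfl, hs.nat 2 rfl]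
    · rw [hs₁.nat 3 rfl, hs.nat 3 rfl]
    · rw [hs₁.real 0 rfl, hs.real 0 rfl]
    · rw [hs₁.real 1 rfl, hs.real 1 rfl]
    · rw [hs₁.nat 4 rfl, hs.nat 4 rfl, h4]
    · simp [h₁]
    · rw [e14]; exact hle
    · intro v
      rw [e14, hpos v]
      simp
    · intro v hv w hw hv0 he
      rw [e14] at hv0 he
      obtain ⟨j, hj, hvj⟩ := (hpos v).1 hv0
      obtain ⟨j', hj', hwj⟩ := (hpos w).1 (he ▸ hv0)
      -- A coloured vertex exists, so `k` is positive and the node, not being last in the order, has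
      -- a parent.
      obtain ⟨i, hi, hiN, hpar⟩ := h.par_mem (N - 1 - k) (by omega)
      have hv' := hold v hv j hj hvj
      have hw' := hold w hw j' hj' hwj
      have hi' : N - 1 - (N - 1 - i) = i := by omega
      rw [ht, hpar, ← hi'] at hv' hw'
      exact hinj (N - 1 - i) (by omega) v hv' w hw' he
    · rw [e14] at h₂
      simp only [State.putNat_nat_of_ne _ _ _ (by decide : (14 : ℕ) ≠ 30)]
      refine ⟨h₂.le, fun v => ?_, fun j hj v hv w hw he => ?_⟩
      · rw [h₂.pos v]
        simp only [Finset.mem_union, Finset.mem_biUnion, Finset.mem_range, List.mem_toFinset,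
          Nat.lt_succ_iff_lt_or_eq, or_and_right, exists_or, exists_eq_left, ht]
      · rcases Nat.lt_succ_iff_lt_or_eq.1 hj with hj | rfl
        · refine hinj j hj v hv w hw ?_
          rwa [h₂.old v, h₂.old w] at he
          · exact Finset.mem_biUnion.2 ⟨j, Finset.mem_range.2 hj, List.mem_toFinset.2 hw⟩
          · exact Finset.mem_biUnion.2 ⟨j, Finset.mem_range.2 hj, List.mem_toFinset.2 hv⟩
        · refine h₂.inj v hv w hw ((h₂.pos v).2 ?_) he
          exact Finset.mem_union_right _ (List.mem_toFinset.2 hv)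
  · have h1 := sq_le_three_pow K
    have h2 := le_three_pow K
    have h3 := one_le_three_pow K
    simp only [NatExp.cost]
    have : 50 * (K * K) + 200 * K + 120 + (1 + 1) + 10 ≤ 500 * 3 ^ K := by omega
    have := Nat.mul_le_mul_left N this
    rw [show 500 * (N * 3 ^ K) = N * (500 * 3 ^ K) by ring]
    omega
  · obtain ⟨hle, hpos, hinj⟩ := hI
    have hsurj : ∀ t < N, ∃ j < N, s.nat 11 (N - 1 - j) = t := by
      have hf : Function.Injective fun i : Fin N => (⟨s.nat 11 i.val, hQ i.val i.2⟩ : Fin N) := by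
        intro a b hab
        exact Fin.ext (h.inj a b a.2 b.2 (congrArg Fin.val hab))
      intro t ht
      obtain ⟨k, hk⟩ := Finite.injective_iff_surjective.1 hf ⟨t, ht⟩
      have hk2 := k.2
      exact ⟨N - 1 - k.val, by omega, by
        rw [show N - 1 - (N - 1 - k.val) = k.val by omega]; exact congrArg Fin.val hk⟩
    refine ⟨fun t ht v hv => ?_, fun t ht v hv w hw he => ?_⟩
    · obtain ⟨j, hj, rfl⟩ := hsurj t ht
      exact ⟨(hpos v).2 ⟨j, hj, hv⟩, hle v⟩
    · obtain ⟨j, hj, rfl⟩ := hsurj t ht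
      exact hinj j hj v hv w hw he

end RealRAM

/-! ### Masks of bags -/

/-- The list has no repetitions and the colours are distinct on it, so the new bit is not yet set
and adding the power of two sets it. -/
theorem mask_image_take_succ {l : List ℕ} (hl : l.Nodup) {col : ℕ → ℕ}
    (hc : ∀ v ∈ l, ∀ w ∈ l, col v = col w → v = w) (p : ℕ → Prop) [DecidablePred p] {j : ℕ}
    (hj : j < l.length) :
    mask (((l.take (j + 1)).toFinset.filter p).image col) =
      mask (((l.take j).toFinset.filter p).image col) +
        if p (l.getD j 0) then 2 ^ col (l.getD j 0) else 0 := by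
  have hv : l.getD j 0 = l[j] := List.getD_eq_getElem _ _ hj
  have htake : (l.take (j + 1)).toFinset = insert (l.getD j 0) (l.take j).toFinset := by
    ext w
    simp only [Finset.mem_insert, List.mem_toFinset, RealRAM.mem_take_succ hj]
    tauto
  rw [htake, Finset.filter_insert]
  split_ifs with hp
  · rw [Finset.image_insert, mask_insert, add_comm]
    intro hmem
    obtain ⟨w, hw, he⟩ := Finset.mem_image.1 hmem
    have hw' := List.mem_toFinset.1 (Finset.mem_filter.1 hw).1
    obtain rfl := hc _ (List.mem_of_mem_take hw') _ (RealRAM.getD_mem hj) he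
    rw [hv] at hw'
    obtain ⟨i, hi, hij⟩ := List.mem_iff_getElem.1 hw'
    rw [List.getElem_take] at hij
    rw [List.length_take] at hi
    have := (List.Nodup.getElem_inj_iff hl).1 hij
    omega
  · rw [add_zero]

namespace RealRAM

/-- The program that adds the colours of those vertices `v` in the bag of the node in the variable
`b` that satisfy `T` to the mask of the node in the variable `u`. -/
def bagMask (b u d : ℕ) (T : Test) : Program :=
  .forBag b (.ite T (.setNat d (.var u) (.add (.get d (.var u))
    (.get 5 (.sub (.get 14 (.var 42)) (.lit 1))))) .skip)

theorem bagMask_spec {n m N K t x : ℕ} {bg : ℕ → List ℕ} {α : ℕ → ℝ} {β : ℕ → ℕ → ℝ} {s : State}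
    (hin : Input n m N bg α β s) (hK : Sized K s) (ht : t < N) (hl : (bg t).length ≤ K)
    (hnd : (bg t).Nodup) {col : ℕ → ℕ} (hcol : ∀ v ∈ bg t, s.nat 14 v = col v + 1 ∧ col v < K)
    (hinj : ∀ v ∈ bg t, ∀ w ∈ bg t, col v = col w → v = w) {b u d : ℕ} {T : Test}
    (hb : b = 30 ∨ b = 43 ∨ b = 44) (hu : u = 30 ∨ u = 43) (hd : d = 18 ∨ d = 19 ∨ d = 20)
    (hbt : s.nat b 0 = t) (hux : s.nat u 0 = x) (p : ℕ → Prop) [DecidablePred p]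
    (hT : ∀ s', (∀ a, a ≠ 33 → a ≠ 42 → a ≠ d → s'.nat a = s.nat a) →
      (T.Holds s' ↔ p (s'.nat 42 0))) (hT' : T.cost ≤ 9) (h0 : s.nat d x = 0) :
    Spec (bagMask b u d T) s (60 * K + 20) fun s' =>
      s'.nat d x = mask (((bg t).toFinset.filter p).image col) ∧
      ∀ y ≠ x, s'.nat d y = s.nat d y := by
  have hne : ∀ s' i y, i = 33 ∨ i = 42 → (State.putNat s' i 0 y).nat d = s'.nat d := by
    intro s' i y hi
    exact State.putNat_nat_of_ne _ _ _ (by omega)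
  refine (Spec.forBag hin ht hbt 30 (fun j s' =>
      s'.nat d x = mask ((((bg t).take j).toFinset.filter p).image col) ∧
      ∀ y ≠ x, s'.nat d y = s.nat d y) ?_ ?_ ?_ ?_ (by omega) (by omega) ?_ ?_ ?_).weaken ?_
      |>.post ?_
  · simp [Program.writesNat]; omega
  · simp [Program.writesNat]; omega
  · simp [Program.writesNat]; omega
  · simp [Program.writesNat]; omega
  · intro j s' a y ha h
    rw [hne _ _ _ ha]
    exact h
  · simpa [mask_empty] using h0
  · intro j hj s' hs hv hI
    have hn : ∀ a, a ≠ 33 → a ≠ 42 → a ≠ d → s'.nat a = s.nat a := fun a h1 h2 h3 =>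
      hs.nat a (by simp [Program.forBag, Program.forN, Program.writesNat, h1, h2, h3])
    rw [mask_image_take_succ hnd hinj p hj]
    have hT1 := hT s' hn
    obtain ⟨hc1, hc2⟩ := hcol _ (getD_mem hj)
    rw [hv] at hT1
    refine (Spec.straight _ _ rfl ?_).weaken ?_
    · by_cases hp : p ((bg t).getD j 0)
      · rw [Program.exec_ite_pos (hT1.2 hp), if_pos hp]
        simp only [Program.exec, NatExp.eval, State.putNat_nat_self, hv,
          hn u (by omega) (by omega) (by omega), hux, hn 14 (by decide) (by decide) (by omega), hc1,
          hn 5 (by decide) (by decide) (by omega), Nat.add_sub_cancel, hK.pow2 _ hc2.le]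
        rw [Function.update_self, hI.1]
        exact ⟨rfl, fun y hy => by rw [Function.update_of_ne hy, hI.2 y hy]⟩
      · rw [Program.exec_ite_neg (mt hT1.1 hp), if_neg hp]
        exact hI
    · simp only [Program.time, NatExp.cost]; omega
  · have := Nat.mul_le_mul_right 58 hl
    omega
  · intro s' _ h
    rw [List.take_length] at h
    exact h

/-- The program that computes the masks of the bags. -/
def fullProgram : Program := .forN 30 (.get 0 (.lit 2)) (bagMask 30 30 18 (.natEq (.lit 0) (.lit 0)))

/-- The bags are lists without repetitions, and `col` is a colouring that is injective on each. -/
structure Coloured (n N K : ℕ) (bg : ℕ → List ℕ) (col : ℕ → ℕ) : Prop where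
  length_le : ∀ t < N, (bg t).length ≤ K
  nodup : ∀ t < N, (bg t).Nodup
  vert_lt : ∀ t < N, ∀ v ∈ bg t, v < n
  lt : ∀ t < N, ∀ v ∈ bg t, col v < K
  inj : ∀ t < N, ∀ v ∈ bg t, ∀ w ∈ bg t, col v = col w → v = w

theorem fullProgram_spec {n m N K : ℕ} {bg : ℕ → List ℕ} {α : ℕ → ℝ} {β : ℕ → ℕ → ℝ} {s : State}
    (hin : Input n m N bg α β s) (hK : Sized K s) {col : ℕ → ℕ} (hC : Coloured n N K bg col)
    (h14 : ∀ t < N, ∀ v ∈ bg t, s.nat 14 v = col v + 1) (h18 : ∀ t, s.nat 18 t = 0) :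
    Spec fullProgram s (N * (60 * K + 40) + 20) fun s' =>
      ∀ t < N, s'.nat 18 t = mask ((bg t).toFinset.image col) := by
  refine (Spec.forN N (60 * K + 20) (fun k s' =>
      (∀ t < k, s'.nat 18 t = mask ((bg t).toFinset.image col)) ∧
      ∀ t, k ≤ t → s'.nat 18 t = 0) rfl
    (fun s' hs => by simp [NatExp.eval, hs.nat 0 rfl, hin.nodes]) (by simp [h18])
    fun k hk s' hs hk' hI => ?_).weaken ?_ |>.post fun s' _ hI => hI.1
  · refine (bagMask_spec (hin.of_eq (hs.nat 0 rfl) (hs.nat 2 rfl) (hs.nat 3 rfl)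
      (hs.real 0 rfl) (hs.real 1 rfl)) (hK.of_eq (hs.nat 4 rfl) (hs.nat 5 rfl) (hs.nat 6 rfl)
      (hs.nat 7 rfl) (hs.nat 8 rfl)) hk (hC.length_le k hk) (hC.nodup k hk) (col := col)
      (fun v hv => ?_) (hC.inj k hk) (Or.inl rfl) (Or.inl rfl) (Or.inl rfl) hk' hk' (fun _ => True)
      (fun s'' _ => by simp [Test.Holds]) (by decide) (hI.2 k le_rfl)).post fun s'' _ h => ?_
    · rw [hs.nat 14 rfl, h14 k hk v hv]
      exact ⟨rfl, hC.lt k hk v hv⟩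
    · rw [State.putNat_nat_of_ne _ _ _ (by decide)]
      refine ⟨fun t ht => ?_, fun t ht => ?_⟩
      · rcases Nat.lt_succ_iff_lt_or_eq.1 ht with ht | rfl
        · rw [h.2 t ht.ne, hI.1 t ht]
        · simpa using h.1
      · rw [h.2 t (by omega), hI.2 t (by omega)]
  · simp only [NatExp.cost]
    have : N * (60 * K + 20 + (1 + 1) + 10) ≤ N * (60 * K + 40) := Nat.mul_le_mul_left _ (by omega)
    omega

/-- The program that computes the mask of the vertices in the bag of the node in the variable `b`
but not in that of the node in the variable `a`. -/
def diffMask (a b x d : ℕ) : Program :=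
  .seq (.forBag a (.setNat x (.var 42) (.add (.var 30) (.lit 1))))
    (bagMask b 43 d (.not (.natEq (.get x (.var 42)) (.add (.var 30) (.lit 1)))))

/-- The vertices of the bag to be excluded are stamped with `i + 1`, which exceeds all earlier
stamps, so the marks never have to be cleared. -/
theorem diffMask_spec {n m N K i t t' y : ℕ} {bg : ℕ → List ℕ} {α : ℕ → ℝ} {β : ℕ → ℕ → ℝ}
    {s : State} (hin : Input n m N bg α β s) (hK : Sized K s) {col : ℕ → ℕ}
    (hC : Coloured n N K bg col) (h14 : ∀ t < N, ∀ v ∈ bg t, s.nat 14 v = col v + 1) {a b x d : ℕ}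
    (hc : (a = 44 ∧ b = 43 ∧ x = 21 ∧ d = 19) ∨ (a = 43 ∧ b = 44 ∧ x = 23 ∧ d = 20))
    (ht : t < N) (ht' : t' < N) (ha : s.nat a 0 = t) (hb : s.nat b 0 = t') (hy : s.nat 43 0 = y)
    (h30 : s.nat 30 0 = i) (hx : ∀ v, s.nat x v ≤ i) (hd : s.nat d y = 0) :
    Spec (diffMask a b x d) s (120 * K + 40) fun s' =>
      s'.nat d y = mask (((bg t').toFinset \ (bg t).toFinset).image col) ∧
      (∀ y' ≠ y, s'.nat d y' = s.nat d y') ∧ ∀ v, s'.nat x v ≤ i + 1 := by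
  classical
  refine (Spec.seq (c := 60 * K + 20) (c' := 60 * K + 20) (R := fun s' =>
    (∀ v, s'.nat x v = i + 1 ↔ v ∈ bg t) ∧ ∀ v, s'.nat x v ≤ i + 1) ?_ fun s₁ hs₁ h₁ => ?_).weaken
    (by omega)
  · refine (Spec.forBag hin ht ha 30 (fun j s' =>
      (∀ v, s'.nat x v = i + 1 ↔ v ∈ (bg t).take j) ∧ ∀ v, s'.nat x v ≤ i + 1) ?_ ?_ ?_ ?_
      (by omega) (by omega) ?_ ?_ ?_).weaken ?_ |>.post ?_
    · simp [Program.writesNat]; omega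
    · simp [Program.writesNat]; omega
    · simp [Program.writesNat]; omega
    · simp [Program.writesNat]; omega
    · intro j s' a' z ha' h
      rw [State.putNat_nat_of_ne _ _ _ (by omega)]
      exact h
    · refine ⟨fun v => ?_, fun v => (hx v).trans (Nat.le_succ i)⟩
      have := hx v
      simp only [List.take_zero, List.not_mem_nil, iff_false]
      omega
    · intro j hj s' hs hv hI
      refine (Spec.straight _ _ rfl ?_).weaken (by simp [Program.time, NatExp.cost])
      have e30 : s'.nat 30 0 = i := by
        rw [hs.nat 30 (by simp [Program.forBag, Program.forN, Program.writesNat]; omega), h30]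
      simp only [Program.exec, NatExp.eval, State.putNat_nat_self, hv, e30]
      refine ⟨fun v => ?_, fun v => ?_⟩
      · rw [Function.update_apply, mem_take_succ hj]
        split_ifs with h
        · simp [h]
        · rw [hI.1 v, or_iff_left h]
      · rw [Function.update_apply]
        split_ifs
        · exact le_rfl
        · exact hI.2 v
    · have := Nat.mul_le_mul_right 58 (hC.length_le t ht)
      omega
    · intro s' _ h
      rw [List.take_length] at h
      exact h
  · have hn : ∀ c, c ≠ 33 → c ≠ 42 → c ≠ x → s₁.nat c = s.nat c := fun c h1 h2 h3 =>
      hs₁.nat c (by simp [Program.forBag, Program.forN, Program.writesNat, h1, h2, h3])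
    have hr : ∀ c, s₁.real c = s.real c := fun c => hs₁.real c rfl
    refine (bagMask_spec (K := K) (col := col) (hin.of_eq (hn 0 ?_ ?_ ?_) (hn 2 ?_ ?_ ?_)
      (hn 3 ?_ ?_ ?_) (hr 0) (hr 1)) (hK.of_eq (hn 4 ?_ ?_ ?_) (hn 5 ?_ ?_ ?_) (hn 6 ?_ ?_ ?_)
      (hn 7 ?_ ?_ ?_) (hn 8 ?_ ?_ ?_)) ht' (hC.length_le t' ht') (hC.nodup t' ht') (fun v hv => ?_)
      (hC.inj t' ht') ?_ (Or.inr rfl) ?_ (by rw [hn b (by omega) (by omega) (by omega), hb])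
      (by rw [hn 43 (by omega) (by omega) (by omega), hy]) (fun v => v ∉ bg t)
      (fun s' hs' => ?_) ?_ ?_).post fun s' hs' h' => ?_
    any_goals omega
    · rw [hn 14 (by omega) (by omega) (by omega), h14 t' ht' v hv]
      exact ⟨rfl, hC.lt t' ht' v hv⟩
    · simp only [Test.Holds, NatExp.eval, hs' x (by omega) (by omega) (by omega),
        hs' 30 (by omega) (by omega) (by omega), hn 30 (by omega) (by omega) (by omega), h30]
      rw [h₁.1]
    · simp [Test.cost, NatExp.cost]
    · rw [hn d (by omega) (by omega) (by omega), hd]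
    · refine ⟨?_, fun y' hy' => ?_, fun v => ?_⟩
      · rw [h'.1]
        congr 2
        ext v
        simp
      · rw [h'.2 y' hy', hn d (by omega) (by omega) (by omega)]
      · rw [hs'.nat x]
        · exact h₁.2 v
        · simp [bagMask, Program.forBag, Program.forN, Program.writesNat]; omega

/-- The program that computes the masks of the differences of neighbouring bags. -/
def diffProgram : Program :=
  .forN 30 (.sub (.get 0 (.lit 2)) (.lit 1))
    (.seq (.seq (.setNat 43 (.lit 0) (.get 11 (.var 30))) (.setNat 44 (.lit 0) (.get 13 (.var 43))))
    (.seq (diffMask 44 43 21 19) (diffMask 43 44 23 20)))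

/-- The two differences along an edge are computed in the same round and so use separate arrays of
stamps. -/
theorem diffProgram_spec {n m N K : ℕ} {bg : ℕ → List ℕ} {α : ℕ → ℝ} {β : ℕ → ℕ → ℝ} {s : State}
    (hin : Input n m N bg α β s) (hK : Sized K s) {col : ℕ → ℕ} (hC : Coloured n N K bg col)
    (h14 : ∀ t < N, ∀ v ∈ bg t, s.nat 14 v = col v + 1)
    (h : ElimOrder N (fun t => (bg t).toFinset) (s.nat 11) (s.nat 13))
    (hQ : ∀ i < N, s.nat 11 i < N) (h19 : ∀ t, s.nat 19 t = 0) (h20 : ∀ t, s.nat 20 t = 0)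
    (h21 : ∀ t, s.nat 21 t = 0) (h23 : ∀ t, s.nat 23 t = 0) :
    Spec diffProgram s (N * (240 * K + 120) + 20) fun s' => ∀ i, i + 1 < N →
      s'.nat 19 (s.nat 11 i) = mask (((bg (s.nat 11 i)).toFinset \
        (bg (s.nat 13 (s.nat 11 i))).toFinset).image col) ∧
      s'.nat 20 (s.nat 11 i) = mask (((bg (s.nat 13 (s.nat 11 i))).toFinset \
        (bg (s.nat 11 i)).toFinset).image col) := by
  refine (Spec.forN (N - 1) (240 * K + 95) (fun k s' =>
      (∀ i < k, s'.nat 19 (s.nat 11 i) = mask (((bg (s.nat 11 i)).toFinset \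
        (bg (s.nat 13 (s.nat 11 i))).toFinset).image col) ∧
      s'.nat 20 (s.nat 11 i) = mask (((bg (s.nat 13 (s.nat 11 i))).toFinset \
        (bg (s.nat 11 i)).toFinset).image col)) ∧
      (∀ i, k ≤ i → i < N → s'.nat 19 (s.nat 11 i) = 0 ∧ s'.nat 20 (s.nat 11 i) = 0) ∧
      (∀ v, s'.nat 21 v ≤ k) ∧ ∀ v, s'.nat 23 v ≤ k) rfl
    (fun s' hs => by simp [NatExp.eval, hs.nat 0 rfl, hin.nodes])
    (by simp [h19, h20, h21, h23]) fun k hk s' hs hk' hI => ?_).weaken ?_ |>.post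
    fun s' _ hI i hi => hI.1 i (by omega)
  · obtain ⟨hI1, hI2, hI3, hI4⟩ := hI
    obtain ⟨j, hkj, hj, hpar⟩ := h.par_mem k (by omega)
    set u := s.nat 11 k with hu
    have huN : u < N := hQ k (by omega)
    have hpN : s.nat 13 u < N := hpar ▸ hQ j hj
    set p := s.nat 13 u with hp
    refine (Spec.seq (c' := (120 * K + 40) + (120 * K + 40)) (Spec.straight _ _ rfl (R := fun s'' =>
      s''.nat 43 0 = u ∧ s''.nat 44 0 = p) (by
        simp [Program.exec, NatExp.eval, hk', hs.nat 11 rfl, hs.nat 13 rfl, hu, hp]))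
      fun s₁ hs₁ h₁ => Spec.seq (diffMask_spec (i := k) (y := u)
        (hin.of_eq ((hs₁.nat 0 rfl).trans (hs.nat 0 rfl)) ((hs₁.nat 2 rfl).trans (hs.nat 2 rfl))
          ((hs₁.nat 3 rfl).trans (hs.nat 3 rfl)) ((hs₁.real 0 rfl).trans (hs.real 0 rfl))
          ((hs₁.real 1 rfl).trans (hs.real 1 rfl)))
        (hK.of_eq ((hs₁.nat 4 rfl).trans (hs.nat 4 rfl)) ((hs₁.nat 5 rfl).trans (hs.nat 5 rfl))
          ((hs₁.nat 6 rfl).trans (hs.nat 6 rfl)) ((hs₁.nat 7 rfl).trans (hs.nat 7 rfl))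
          ((hs₁.nat 8 rfl).trans (hs.nat 8 rfl))) hC
        (fun t ht v hv => by rw [hs₁.nat 14 rfl, hs.nat 14 rfl, h14 t ht v hv])
        (Or.inl ⟨rfl, rfl, rfl, rfl⟩) hpN huN h₁.2 h₁.1 h₁.1 (by rw [hs₁.nat 30 rfl, hk'])
        (by rw [hs₁.nat 21 rfl]; exact hI3)
        (by rw [hs₁.nat 19 rfl]; exact (hI2 k le_rfl (by omega)).1))
      fun s₂ hs₂ h₂ => (diffMask_spec (i := k) (y := u)
        (hin.of_eq ((hs₂.nat 0 rfl).trans ((hs₁.nat 0 rfl).trans (hs.nat 0 rfl)))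
          ((hs₂.nat 2 rfl).trans ((hs₁.nat 2 rfl).trans (hs.nat 2 rfl)))
          ((hs₂.nat 3 rfl).trans ((hs₁.nat 3 rfl).trans (hs.nat 3 rfl)))
          ((hs₂.real 0 rfl).trans ((hs₁.real 0 rfl).trans (hs.real 0 rfl)))
          ((hs₂.real 1 rfl).trans ((hs₁.real 1 rfl).trans (hs.real 1 rfl))))
        (hK.of_eq ((hs₂.nat 4 rfl).trans ((hs₁.nat 4 rfl).trans (hs.nat 4 rfl)))
          ((hs₂.nat 5 rfl).trans ((hs₁.nat 5 rfl).trans (hs.nat 5 rfl)))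
          ((hs₂.nat 6 rfl).trans ((hs₁.nat 6 rfl).trans (hs.nat 6 rfl)))
          ((hs₂.nat 7 rfl).trans ((hs₁.nat 7 rfl).trans (hs.nat 7 rfl)))
          ((hs₂.nat 8 rfl).trans ((hs₁.nat 8 rfl).trans (hs.nat 8 rfl)))) hC
        (fun t ht v hv => by rw [hs₂.nat 14 rfl, hs₁.nat 14 rfl, hs.nat 14 rfl, h14 t ht v hv])
        (Or.inr ⟨rfl, rfl, rfl, rfl⟩) huN hpN (by rw [hs₂.nat 43 rfl, h₁.1])
        (by rw [hs₂.nat 44 rfl, h₁.2]) (by rw [hs₂.nat 43 rfl, h₁.1])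
        (by rw [hs₂.nat 30 rfl, hs₁.nat 30 rfl, hk'])
        (by rw [hs₂.nat 23 rfl, hs₁.nat 23 rfl]; exact hI4)
        (by rw [hs₂.nat 20 rfl, hs₁.nat 20 rfl]; exact (hI2 k le_rfl (by omega)).2)).post
      fun s₃ hs₃ h₃ => ?_).weaken (by simp only [Program.time, NatExp.cost]; omega)
    have hne : ∀ i, i < N → i ≠ k → s.nat 11 i ≠ u := fun i hi hik he =>
      hik (h.inj i k hi (by omega) he)
    simp only [State.putNat_nat_of_ne _ _ _ (by decide : (19 : ℕ) ≠ 30),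
      State.putNat_nat_of_ne _ _ _ (by decide : (20 : ℕ) ≠ 30),
      State.putNat_nat_of_ne _ _ _ (by decide : (21 : ℕ) ≠ 30),
      State.putNat_nat_of_ne _ _ _ (by decide : (23 : ℕ) ≠ 30)]
    have e19 : ∀ i, i < N → i ≠ k → s₃.nat 19 (s.nat 11 i) = s'.nat 19 (s.nat 11 i) := by
      intro i hi hik
      rw [hs₃.nat 19 rfl, h₂.2.1 _ (hne i hi hik), hs₁.nat 19 rfl]
    have e20 : ∀ i, i < N → i ≠ k → s₃.nat 20 (s.nat 11 i) = s'.nat 20 (s.nat 11 i) := by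
      intro i hi hik
      rw [h₃.2.1 _ (hne i hi hik), hs₂.nat 20 rfl, hs₁.nat 20 rfl]
    refine ⟨fun i hi => ?_, fun i hi hiN => ?_, ?_, h₃.2.2⟩
    · rcases Nat.lt_succ_iff_lt_or_eq.1 hi with hi | rfl
      · rw [e19 i (by omega) (by omega), e20 i (by omega) (by omega)]
        exact hI1 i hi
      · refine ⟨?_, h₃.1⟩
        rw [hs₃.nat 19 rfl]
        exact h₂.1
    · rw [e19 i (by omega) (by omega), e20 i (by omega) (by omega)]
      exact hI2 i (by omega) hiN
    · rw [hs₃.nat 21 rfl]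
      exact h₂.2.2
  · simp only [NatExp.cost]
    have : (N - 1) * (240 * K + 95 + (1 + 1 + 1 + 1) + 10) ≤ N * (240 * K + 120) :=
      Nat.mul_le_mul (by omega) (by omega)
    omega

end RealRAM

namespace RealRAM

/-! ### The causes -/

/-- The memory after the tables for the bags and the colours have been computed. -/
structure Ready (n m N K : ℕ) (bg : ℕ → List ℕ) (col : ℕ → ℕ) (α : ℕ → ℝ) (β : ℕ → ℕ → ℝ)
    (s : State) : Prop where
  input : Input n m N bg α β s
  sized : Sized K s
  coloured : Coloured n N K bg col
  col : ∀ t < N, ∀ v ∈ bg t, s.nat 14 v = col v + 1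
  row : ∀ i < n, s.nat 16 i = i * m
  place : ∀ t < N, s.nat 17 t = t * 2 ^ K
  card : ∀ C ⊆ Finset.range K, s.real 5 (mask C) = C.card

/-- Whether a program leaves all arrays with input data and with preliminary tables as they are. -/
def Program.harmless (P : Program) : Bool :=
  [0, 2, 3, 4, 5, 6, 7, 8, 14, 16, 17].all (fun a => !P.writesNat a) &&
    [0, 1, 5].all fun a => !P.writesReal a

/-- The condition on `P` is a computation on a concrete program, so `rfl` carries all preliminary
tables across a program at once. -/
theorem Ready.same {n m N K : ℕ} {bg : ℕ → List ℕ} {col : ℕ → ℕ} {α : ℕ → ℝ} {β : ℕ → ℕ → ℝ}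
    {s s' : State} {P : Program} (h : Ready n m N K bg col α β s) (hs : Same P s s')
    (hP : P.harmless = true) : Ready n m N K bg col α β s' := by
  simp only [Program.harmless, List.all_cons, List.all_nil, Bool.and_eq_true, Bool.not_eq_true',
    and_true] at hP
  obtain ⟨⟨h0, h2, h3, h4, h5, h6, h7, h8, h14, h16, h17⟩, r0, r1, r5⟩ := hP
  exact ⟨h.input.of_eq (hs.nat _ h0) (hs.nat _ h2) (hs.nat _ h3) (hs.real _ r0) (hs.real _ r1),
    h.sized.of_eq (hs.nat _ h4) (hs.nat _ h5) (hs.nat _ h6) (hs.nat _ h7) (hs.nat _ h8), h.coloured,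
    fun t ht v hv => by rw [hs.nat _ h14, h.col t ht v hv],
    fun i hi => by rw [hs.nat _ h16, h.row i hi], fun t ht => by rw [hs.nat _ h17, h.place t ht],
    fun C hC => by rw [hs.real _ r5, h.card C hC]⟩

theorem card_filter_range_succ (p : ℕ → Prop) [DecidablePred p] (j : ℕ) :
    ((Finset.range (j + 1)).filter p).card =
      ((Finset.range j).filter p).card + if p j then 1 else 0 := by
  rw [Finset.range_add_one, Finset.filter_insert]
  split_ifs
  · rw [Finset.card_insert_of_notMem (by simp)]
  · rfl

theorem card_filter_take_succ {l : List ℕ} (hl : l.Nodup) (p : ℕ → Prop) [DecidablePred p] {j : ℕ}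
    (hj : j < l.length) : ((l.take (j + 1)).toFinset.filter p).card =
      ((l.take j).toFinset.filter p).card + if p (l.getD j 0) then 1 else 0 := by
  have hv : l.getD j 0 = l[j] := List.getD_eq_getElem _ _ hj
  have htake : (l.take (j + 1)).toFinset = insert (l.getD j 0) (l.take j).toFinset := by
    ext w
    simp only [Finset.mem_insert, List.mem_toFinset, mem_take_succ hj]
    tauto
  rw [htake, Finset.filter_insert]
  split_ifs with hp
  · rw [Finset.card_insert_of_notMem]
    intro hmem
    have hw := List.mem_toFinset.1 (Finset.mem_filter.1 hmem).1
    rw [hv] at hw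
    obtain ⟨i, hi, hij⟩ := List.mem_iff_getElem.1 hw
    rw [List.getElem_take] at hij
    rw [List.length_take] at hi
    have := (List.Nodup.getElem_inj_iff hl).1 hij
    omega
  · rfl

/-- Whether the cause in the variable `30` can produce the observation in the variable `v`. -/
def possible (v : ℕ) : Test := .realLt (.lit 0) (.get 1 (.add (.get 16 (.var v)) (.var 30)))

theorem possible_iff {n m N K : ℕ} {bg : ℕ → List ℕ} {col : ℕ → ℕ} {α : ℕ → ℝ} {β : ℕ → ℕ → ℝ}
    {s : State} (hR : Ready n m N K bg col α β s) {v i z : ℕ} (hz : z < m) (hi : i < n)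
    (h30 : s.nat 30 0 = z) (hv : s.nat v 0 = i) : (possible v).Holds s ↔ 0 < β i z := by
  simp [possible, Test.Holds, RealExp.eval, NatExp.eval, h30, hv, hR.row i hi,
    hR.input.beta i hi z hz]

/-- Count the observations in the bag of the node in the variable `31` that are possible. -/
def countBag : Program :=
  .seq (.setNat 41 (.lit 0) (.lit 0))
    (.forBag 31 (.ite (possible 42) (.setNat 41 (.lit 0) (.add (.var 41) (.lit 1))) .skip))

open Classical in
theorem countBag_spec {n m N K : ℕ} {bg : ℕ → List ℕ} {col : ℕ → ℕ} {α : ℕ → ℝ} {β : ℕ → ℕ → ℝ}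
    {s : State} (hR : Ready n m N K bg col α β s) {z t : ℕ} (hz : z < m) (ht : t < N)
    (h30 : s.nat 30 0 = z) (h31 : s.nat 31 0 = t) :
    Spec countBag s (60 * K + 20) fun s' =>
      s'.nat 41 0 = ((bg t).toFinset.filter fun v => 0 < β v z).card := by
  refine (Spec.seq (Spec.straight _ _ rfl (R := fun s' => s'.nat 41 0 = 0)
    (by simp [Program.exec, NatExp.eval])) (c' := 60 * K + 16) fun s₁ hs₁ h₁ => ?_).weaken
    (by simp only [Program.time, NatExp.cost]; omega)
  have hR₁ := hR.same hs₁ rfl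
  refine (Spec.forBag hR₁.input ht (by rw [hs₁.nat 31 rfl, h31]) 32 (fun j s' =>
    s'.nat 41 0 = (((bg t).take j).toFinset.filter fun v => 0 < β v z).card) rfl rfl rfl rfl
    (by decide) (by decide) ?_ ?_ ?_).weaken ?_ |>.post ?_
  · rintro j s' a x (rfl | rfl) h <;> simpa using h
  · simpa using h₁
  · intro j hj s' hs hv hI
    have hiff := possible_iff (hR₁.same hs rfl) hz
      (hR.coloured.vert_lt t ht _ (getD_mem hj)) (by rw [hs.nat 30 rfl, hs₁.nat 30 rfl, h30]) hv
    refine (Spec.straight _ _ rfl ?_).weaken (by decide)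
    rw [card_filter_take_succ (hR.coloured.nodup t ht) _ hj, ← hI]
    by_cases hp : 0 < β ((bg t).getD j 0) z
    · rw [Program.exec_ite_pos (hiff.2 hp), if_pos hp]
      simp [Program.exec, NatExp.eval]
    · rw [Program.exec_ite_neg (mt hiff.1 hp), if_neg hp, Program.exec, add_zero]
  · have := Nat.mul_le_mul_right 60 (hR.coloured.length_le t ht)
    omega
  · intro s' _ h
    rw [List.take_length] at h
    exact h

/-- Count all observations that are possible. -/
def countAll : Program :=
  .seq (.setNat 40 (.lit 0) (.lit 0))
    (.forN 32 (.get 0 (.lit 0))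
      (.ite (possible 32) (.setNat 40 (.lit 0) (.add (.var 40) (.lit 1))) .skip))

open Classical in
theorem countAll_spec {n m N K : ℕ} {bg : ℕ → List ℕ} {col : ℕ → ℕ} {α : ℕ → ℝ} {β : ℕ → ℕ → ℝ}
    {s : State} (hR : Ready n m N K bg col α β s) {z : ℕ} (hz : z < m) (h30 : s.nat 30 0 = z) :
    Spec countAll s (60 * n + 20) fun s' =>
      s'.nat 40 0 = ((Finset.range n).filter fun v => 0 < β v z).card := by
  refine (Spec.seq (Spec.straight _ _ rfl (R := fun s' => s'.nat 40 0 = 0)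
    (by simp [Program.exec, NatExp.eval])) (c' := 60 * n + 9) fun s₁ hs₁ h₁ => ?_).weaken
    (by simp only [Program.time, NatExp.cost]; omega)
  have hR₁ := hR.same hs₁ rfl
  refine (Spec.forN n 40 (fun j s' =>
    s'.nat 40 0 = ((Finset.range j).filter fun v => 0 < β v z).card) rfl
    (fun s' hs => by simp [NatExp.eval, hs.nat 0 rfl, hR₁.input.verts]) ?_
    fun j hj s' hs hv hI => ?_).weaken ?_
  · simpa using h₁
  · have hiff := possible_iff (hR₁.same hs rfl) hz hj
      (by rw [hs.nat 30 rfl, hs₁.nat 30 rfl, h30]) hv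
    refine (Spec.straight _ _ rfl ?_).weaken (by decide)
    rw [card_filter_range_succ, ← hI]
    by_cases hp : 0 < β j z
    · rw [Program.exec_ite_pos (hiff.2 hp), if_pos hp]
      simp [Program.exec, NatExp.eval]
    · rw [Program.exec_ite_neg (mt hiff.1 hp), if_neg hp, Program.exec, add_zero]
      simp
  · simp only [NatExp.cost]; omega

/-- The program that finds, for each cause, a bag with all observations that it can produce. -/
def homeProgram : Program :=
  .forN 30 (.get 0 (.lit 1)) (.seq countAll (.forN 31 (.get 0 (.lit 2))
    (.seq countBag (.ite (.natEq (.var 40) (.var 41)) (.setNat 22 (.var 30) (.var 31)) .skip))))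

/-- A bag contains all observations that a cause can produce exactly if it contains as many of them
as there are altogether, so comparing two counts replaces a comparison of sets. -/
theorem homeProgram_spec {n m N K : ℕ} {bg : ℕ → List ℕ} {col : ℕ → ℕ} {α : ℕ → ℝ} {β : ℕ → ℕ → ℝ}
    {s : State} (hR : Ready n m N K bg col α β s)
    (hex : ∀ z < m, ∃ t < N, ∀ v < n, 0 < β v z → v ∈ bg t) :
    Spec homeProgram s (m * (60 * n + N * (60 * K + 60) + 60) + 20) fun s' =>
      ∀ z < m, s'.nat 22 z < N ∧ ∀ v < n, 0 < β v z → v ∈ bg (s'.nat 22 z) := by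
  classical
  refine (Spec.forN m (60 * n + N * (60 * K + 60) + 40) (fun k s' => ∀ z < k, s'.nat 22 z < N ∧
      ∀ v < n, 0 < β v z → v ∈ bg (s'.nat 22 z)) rfl
    (fun s' hs => by simp [NatExp.eval, hs.nat 0 rfl, hR.input.causes]) (by simp)
    fun k hk s' hs hk' hI => ?_).weaken ?_
  · have hR' := hR.same hs rfl
    refine (Spec.seq (countAll_spec hR' hk hk') (c' := N * (60 * K + 60) + 20)
      fun s₁ hs₁ h₁ => ?_).weaken (by omega)
    have hR₁ := hR'.same hs₁ rfl
    refine (Spec.forN N (60 * K + 40) (fun j s' => (∀ z < k, s'.nat 22 z = s₁.nat 22 z) ∧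
      ((∃ t < j, ∀ v < n, 0 < β v k → v ∈ bg t) → s'.nat 22 k < N ∧
        ∀ v < n, 0 < β v k → v ∈ bg (s'.nat 22 k))) rfl
      (fun s' hs => by simp [NatExp.eval, hs.nat 0 rfl, hR₁.input.nodes]) (by simp)
      fun j hj s₂ hs₂ hj' hI₂ => ?_).weaken ?_ |>.post fun s₃ _ h₃ => ?_
    · have e30 : s₂.nat 30 0 = k := by rw [hs₂.nat 30 rfl, hs₁.nat 30 rfl, hk']
      refine (Spec.seq (countBag_spec (hR₁.same hs₂ rfl) hk hj e30 hj')
        fun s₃ hs₃ h₃ => Spec.straight _ _ rfl ?_).weaken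
        (by simp only [Program.time, NatExp.cost, Test.cost]; omega)
      have hiff : (Test.natEq (.var 40) (.var 41)).Holds s₃ ↔
          ∀ v < n, 0 < β v k → v ∈ bg j := by
        have hsub : ((bg j).toFinset.filter fun v => 0 < β v k) ⊆
            (Finset.range n).filter fun v => 0 < β v k := by
          intro v hv
          simp only [Finset.mem_filter, List.mem_toFinset, Finset.mem_range] at hv ⊢
          exact ⟨hR.coloured.vert_lt j hj v hv.1, hv.2⟩
        simp only [Test.Holds, NatExp.eval, h₃, hs₃.nat 40 rfl, hs₂.nat 40 rfl, h₁]
        constructor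
        · intro he v hv hp
          have := Finset.eq_of_subset_of_card_le hsub he.le
          have hmem : v ∈ (Finset.range n).filter fun v => 0 < β v k :=
            Finset.mem_filter.2 ⟨Finset.mem_range.2 hv, hp⟩
          rw [← this] at hmem
          exact List.mem_toFinset.1 (Finset.mem_filter.1 hmem).1
        · intro hall
          congr 1
          refine (Finset.Subset.antisymm hsub fun v hv => ?_).symm
          obtain ⟨h1, h2⟩ := Finset.mem_filter.1 hv
          exact Finset.mem_filter.2 ⟨List.mem_toFinset.2 (hall v (Finset.mem_range.1 h1) h2), h2⟩
      rw [State.putNat_nat_of_ne _ _ _ (by decide)]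
      by_cases hall : ∀ v < n, 0 < β v k → v ∈ bg j
      · rw [Program.exec_ite_pos (hiff.2 hall)]
        simp only [Program.exec, NatExp.eval, hs₃.nat 30 rfl, hs₃.nat 31 rfl, e30, hj',
          State.putNat_nat_self]
        refine ⟨fun z hz => ?_, fun _ => ?_⟩
        · rw [Function.update_of_ne hz.ne, hs₃.nat 22 rfl, hI₂.1 z hz]
        · rw [Function.update_self]
          exact ⟨hj, hall⟩
      · rw [Program.exec_ite_neg (mt hiff.1 hall), Program.exec, hs₃.nat 22 rfl]
        refine ⟨hI₂.1, fun ⟨t, ht, hall'⟩ => hI₂.2 ⟨t, ?_, hall'⟩⟩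
        rcases Nat.lt_succ_iff_lt_or_eq.1 ht with ht | rfl
        · exact ht
        · exact absurd hall' hall
    · simp only [NatExp.cost]
      have : N * (60 * K + 40 + (1 + 1) + 10) ≤ N * (60 * K + 60) := Nat.mul_le_mul_left _ (by omega)
      omega
    · rw [State.putNat_nat_of_ne _ _ _ (by decide)]
      intro z hz
      rcases Nat.lt_succ_iff_lt_or_eq.1 hz with hz | rfl
      · rw [h₃.1 z hz, hs₁.nat 22 rfl]
        exact hI z hz
      · obtain ⟨t, ht, hall⟩ := hex z hk
        exact h₃.2 ⟨t, ht, hall⟩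
  · simp only [NatExp.cost]
    have : m * (60 * n + N * (60 * K + 60) + 40 + (1 + 1) + 10) ≤
      m * (60 * n + N * (60 * K + 60) + 60) := Nat.mul_le_mul_left _ (by omega)
    omega

end RealRAM

/-- The sum of `β v z` over the vertices `v` with colour `c` in the bag of `t`. -/
noncomputable def colourSum (bg : ℕ → List ℕ) (col : ℕ → ℕ) (β : ℕ → ℕ → ℝ) (t c z : ℕ) : ℝ :=
  ∑ v ∈ (bg t).toFinset.filter fun v => col v = c, β v z

/-- Colours are distinct within a bag, so the sum has a single term. Its form as a sum provides the
value zero at colours that the bag lacks. -/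
theorem colourSum_col {n N K : ℕ} {bg : ℕ → List ℕ} {col : ℕ → ℕ}
    (hC : RealRAM.Coloured n N K bg col) (β : ℕ → ℕ → ℝ) {t v : ℕ} (ht : t < N) (hv : v ∈ bg t)
    (z : ℕ) : colourSum bg col β t (col v) z = β v z := by
  rw [colourSum, Finset.sum_eq_single_of_mem v]
  · exact Finset.mem_filter.2 ⟨List.mem_toFinset.2 hv, rfl⟩
  · intro w hw hne
    obtain ⟨h1, h2⟩ := Finset.mem_filter.1 hw
    exact absurd (hC.inj t ht w (List.mem_toFinset.1 h1) v hv h2) hne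

theorem colourSum_of_forall_ne {bg : ℕ → List ℕ} {col : ℕ → ℕ} (β : ℕ → ℕ → ℝ) {t c : ℕ}
    (h : ∀ v ∈ bg t, col v ≠ c) (z : ℕ) : colourSum bg col β t c z = 0 := by
  rw [colourSum, Finset.sum_eq_zero]
  intro w hw
  obtain ⟨h1, h2⟩ := Finset.mem_filter.1 hw
  exact absurd h2 (h w (List.mem_toFinset.1 h1))

theorem sum_two_pow_le (K : ℕ) : ∑ c ∈ Finset.range K, 2 ^ c ≤ 2 ^ K := by
  rw [Nat.geomSum_eq le_rfl]
  have := Nat.one_le_two_pow (n := K)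
  omega

namespace RealRAM

open SetAlg

/-- The program that computes the table of colour sums of the cause in the variable `30` at the
node in the variable `43`. -/
def sumProgram : Program :=
  .seq (.fill 31 (.var 4) 3 (.lit 0) (.lit 0))
    (.forBag 43 (.setReal 3 (.sub (.get 14 (.var 42)) (.lit 1))
      (.get 1 (.add (.get 16 (.var 42)) (.var 30)))))

theorem sumProgram_spec {n m N K : ℕ} {bg : ℕ → List ℕ} {col : ℕ → ℕ} {α : ℕ → ℝ} {β : ℕ → ℕ → ℝ}
    {s : State} (hR : Ready n m N K bg col α β s) {z t : ℕ} (hz : z < m) (ht : t < N)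
    (h30 : s.nat 30 0 = z) (h43 : s.nat 43 0 = t) :
    Spec sumProgram s (90 * K + 40) fun s' =>
      ∀ c < K, s'.real 3 c = colourSum bg col β t c z := by
  refine (Spec.seq (c := 18 * K + 10) (c' := 60 * K + 16) (R := fun s' => ∀ c < K, s'.real 3 c = 0)
    ?_ fun s₁ hs₁ h₁ => ?_).weaken (by omega)
  · refine ((Spec.fill K 0 (fun _ => 0) (fun s' hs => by simp [NatExp.eval, hs 4, hR.sized.size])
      (fun j _ s' _ _ _ _ _ => by simp [NatExp.eval, RealExp.eval])).weaken ?_).post ?_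
    · simp only [NatExp.cost, RealExp.cost]; omega
    · intro s' _ h c hc
      simpa using h.1 c hc
  · have hR₁ := hR.same hs₁ rfl
    refine (Spec.forBag hR₁.input ht (by rw [hs₁.nat 43 rfl, h43]) 32 (fun j s' =>
      (∀ v ∈ (bg t).take j, s'.real 3 (col v) = β v z) ∧
      ∀ c < K, (∀ v ∈ (bg t).take j, col v ≠ c) → s'.real 3 c = 0) rfl rfl rfl rfl
      (by decide) (by decide) ?_ ?_ ?_).weaken ?_ |>.post ?_
    · rintro j s' a x _ h
      exact h
    · simpa using h₁
    · intro j hj s' hs hv hI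
      have hR' := hR₁.same hs rfl
      have hmem := getD_mem hj
      refine (Spec.straight _ _ rfl ?_).weaken (by decide)
      simp only [Program.exec, NatExp.eval, RealExp.eval, State.putReal_real_self, hv,
        hR'.col t ht _ hmem, Nat.add_sub_cancel, hR'.row _ (hR.coloured.vert_lt t ht _ hmem),
        hs.nat 30 rfl, hs₁.nat 30 rfl, h30,
        hR'.input.beta _ (hR.coloured.vert_lt t ht _ hmem) z hz]
      refine ⟨fun v hv => ?_, fun c hc hne => ?_⟩
      · rw [Function.update_apply]
        split_ifs with he
        · have hvb : v ∈ bg t := List.mem_of_mem_take hv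
          rw [hR.coloured.inj t ht v hvb _ hmem he]
        · rcases (mem_take_succ hj).1 hv with hv | rfl
          · exact hI.1 v hv
          · exact absurd rfl he
      · have h1 := hne _ ((mem_take_succ hj).2 (Or.inr rfl))
        rw [Function.update_of_ne h1.symm]
        exact hI.2 c hc fun v hv => hne v ((mem_take_succ hj).2 (Or.inl hv))
    · have := Nat.mul_le_mul_right 60 (hR.coloured.length_le t ht)
      omega
    · intro s' _ h c hc
      rw [List.take_length] at h
      by_cases hex : ∃ v ∈ bg t, col v = c
      · obtain ⟨v, hv, rfl⟩ := hex
        rw [h.1 v hv, colourSum_col hR.coloured β ht hv]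
      · push Not at hex
        rw [h.2 c hc hex, colourSum_of_forall_ne β hex]

/-- The program that computes the table of rising factorials times products of the entries of
array `3`. -/
def powerProgram : Program :=
  .seq (.setReal 4 (.lit 0) (.lit 1))
    (.forN 31 (.var 4) (.fill 32 (.get 5 (.var 31)) 4 (.get 5 (.var 31))
      (.mul (.get 4 (.var 32)) (.mul (.add (.lit 1) (.get 5 (.var 32))) (.get 3 (.var 31))))))

/-- Since `rising 1 k` is the factorial of `k`, a new largest colour multiplies an entry by the
number of colours plus one and by the value of the colour. The rounds double the table, hence the
time of order `2 ^ K`. -/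
theorem powerProgram_spec {n m N K : ℕ} {bg : ℕ → List ℕ} {col : ℕ → ℕ} {α : ℕ → ℝ}
    {β : ℕ → ℕ → ℝ} {s : State} (hR : Ready n m N K bg col α β s) :
    Spec powerProgram s (100 * 2 ^ K) fun s' =>
      ∀ C ⊆ Finset.range K, s'.real 4 (mask C) = invPow 1 (s.real 3) C := by
  refine (Spec.seq (Spec.straight _ _ rfl (R := fun s' => s'.real 4 0 = 1)
    (by simp [Program.exec, NatExp.eval, RealExp.eval])) (c' := 80 * 2 ^ K + 10)
    fun s₁ hs₁ h₁ => ?_).weaken ?_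
  · have hR₁ := hR.same hs₁ rfl
    refine (Spec.forN_of_cost K (fun c => 2 ^ c * 34 + 10)
      (fun c s' => ∀ C ⊆ Finset.range c, s'.real 4 (mask C) = invPow 1 (s.real 3) C) rfl
      (fun s' hs => by simp [NatExp.eval, hs.nat 4 rfl, hR₁.sized.size]) ?_
      fun c hc s' hs hc' hI => ?_).weaken ?_
    · intro C hC
      obtain rfl : C = ∅ := by simpa using hC
      rw [invPow_empty, mask_empty, State.putNat_real, h₁]
    · have hR' := hR₁.same hs rfl
      have e5 : s'.nat 5 c = 2 ^ c := hR'.sized.pow2 c hc.le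
      have e3 : s'.real 3 = s.real 3 := by rw [hs.real 3 rfl, hs₁.real 3 rfl]
      refine ((Spec.fill (2 ^ c) (2 ^ c)
        (fun x => s'.real 4 x * ((1 + s'.real 5 x) * s.real 3 c))
        (fun t ht => by simp [NatExp.eval, ht 31, ht 5, hc', e5])
        (fun j hj t ht htr h0 hlt hj' => by
          simp [NatExp.eval, RealExp.eval, ht 31, ht 5, hc', e5, hj', h0 j (Or.inl hj),
            htr 5, htr 3, e3])).post
        fun s₂ hs₂ h₂ => ?_).weaken ?_
      · rw [State.putNat_real]
        refine forall_subset_range_succ (fun C hC => ?_) fun C hC hcC => ?_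
        · rw [h₂.2 _ (Or.inl (mask_lt hC)), hI C hC]
        · rw [mask_insert hcC, h₂.1 _ (mask_lt hC), hI C hC,
            hR'.card C (hC.trans (Finset.range_subset_range.2 hc.le)), invPow, invPow,
            Finset.card_insert_of_notMem hcC, Finset.prod_insert hcC, rising_succ']
          ring
      · simp only [NatExp.cost, RealExp.cost]
        omega
    · have h1 := sum_two_pow_le K
      have h2 := (Nat.lt_two_pow_self (n := K)).le
      simp only [NatExp.cost, Finset.sum_add_distrib, ← Finset.sum_mul, Finset.sum_const,
        Finset.card_range, smul_eq_mul]
      omega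
  · have := Nat.one_le_two_pow (n := K)
    simp only [Program.time, NatExp.cost, RealExp.cost]
    omega

/-- The program that computes the tables of the cause in the variable `30`. -/
def causeProgram : Program :=
  .seq (.setNat 43 (.lit 0) (.get 22 (.var 30))) (.seq sumProgram powerProgram)

theorem causeProgram_spec {n m N K : ℕ} {bg : ℕ → List ℕ} {col : ℕ → ℕ} {α : ℕ → ℝ}
    {β : ℕ → ℕ → ℝ} {s : State} (hR : Ready n m N K bg col α β s) {z : ℕ} (hz : z < m)
    (h30 : s.nat 30 0 = z) (ht : s.nat 22 z < N) :
    Spec causeProgram s (300 * 2 ^ K) fun s' => s'.nat 43 0 = s.nat 22 z ∧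
      (∀ c < K, s'.real 3 c = colourSum bg col β (s.nat 22 z) c z) ∧
      ∀ C ⊆ Finset.range K, s'.real 4 (mask C) =
        invPow 1 (fun c => colourSum bg col β (s.nat 22 z) c z) C := by
  refine (Spec.seq (Spec.straight _ _ rfl (R := fun s' => s'.nat 43 0 = s.nat 22 z)
    (by simp [Program.exec, NatExp.eval, h30])) fun s₁ hs₁ h₁ => Spec.seq
    (sumProgram_spec (hR.same hs₁ rfl) hz ht (by rw [hs₁.nat 30 rfl, h30]) h₁)
    fun s₂ hs₂ h₂ => (powerProgram_spec ((hR.same hs₁ rfl).same hs₂ rfl)).post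
    fun s₃ hs₃ h₃ => ?_).weaken ?_
  · refine ⟨by rw [hs₃.nat 43 rfl, hs₂.nat 43 rfl, h₁], fun c hc => by rw [hs₃.real 3 rfl, h₂ c hc],
      fun C hC => ?_⟩
    rw [h₃ C hC, invPow, invPow]
    congr 1
    exact Finset.prod_congr rfl fun c hc => h₂ c (Finset.mem_range.1 (hC hc))
  · have h1 := (Nat.lt_two_pow_self (n := K))
    simp only [Program.time, NatExp.cost]
    omega

end RealRAM

/-! ### Logarithmic derivatives and the generating functions of the nodes -/

namespace RealRAM

open SetAlg

/-- The position of the entry of a table with the maximal colour `c` and the other colours `C`. -/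
theorem mask_insert_inj {c c' : ℕ} {C C' : Finset ℕ} (hC : C ⊆ Finset.range c)
    (hC' : C' ⊆ Finset.range c') (h : mask (insert c C) = mask (insert c' C')) :
    c = c' ∧ C = C' := by
  have he := mask_injective h
  have hc : c = c' := by
    have h1 : c ∈ insert c' C' := he ▸ Finset.mem_insert_self c C
    have h2 : c' ∈ insert c C := he ▸ Finset.mem_insert_self c' C'
    rcases Finset.mem_insert.1 h1 with h1 | h1
    · exact h1
    · rcases Finset.mem_insert.1 h2 with h2 | h2
      · exact h2.symm
      · have := Finset.mem_range.1 (hC' h1)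
        have := Finset.mem_range.1 (hC h2)
        omega
  subst hc
  refine ⟨rfl, ?_⟩
  have h1 : c ∉ C := fun h => by simpa using hC h
  have h2 : c ∉ C' := fun h => by simpa using hC' h
  rw [← Finset.erase_insert h1, he, Finset.erase_insert h2]

theorem place_inj {K t t' x x' : ℕ} (hx : x < 2 ^ K) (hx' : x' < 2 ^ K)
    (h : t * 2 ^ K + x = t' * 2 ^ K + x') : t = t' ∧ x = x' := by
  have hp : 0 < 2 ^ K := by positivity
  have h1 := congrArg (· / 2 ^ K) h
  simp only [mul_comm _ (2 ^ K), Nat.mul_add_div hp, Nat.div_eq_of_lt hx, Nat.div_eq_of_lt hx'] at h1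
  have : t = t' := by omega
  subst this
  exact ⟨rfl, by omega⟩

/-- Add the logarithmic derivatives of the cause in the variable `30`. -/
def addLog : Program :=
  .forN 31 (.var 4) (.accum 32 (.get 5 (.var 31)) (.natEq (.lit 0) (.lit 0)) 6
    (.add (.add (.get 17 (.var 43)) (.get 5 (.var 31))) (.var 32))
    (.mul (.mul (.get 0 (.var 30)) (.get 3 (.var 31))) (.get 4 (.var 32))))

/-- The derivative in direction `c` is needed only on sets of colours below `c`. Stored under
`insert c C`, the derivatives in all directions share `2 ^ K` cells, and a cause is added in `∑ 2 ^
c` steps. -/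
theorem addLog_spec {n m N K : ℕ} {bg : ℕ → List ℕ} {col : ℕ → ℕ} {α : ℕ → ℝ}
    {β : ℕ → ℕ → ℝ} {s : State} (hR : Ready n m N K bg col α β s) {z t : ℕ} (hz : z < m)
    (h30 : s.nat 30 0 = z) (ht : t < N) (h43 : s.nat 43 0 = t) :
    Spec addLog s (100 * 2 ^ K) fun s' => ∀ t', ∀ c < K, ∀ C ⊆ Finset.range c,
      s'.real 6 (t' * 2 ^ K + mask (insert c C)) = s.real 6 (t' * 2 ^ K + mask (insert c C)) +
        if t = t' then α z * s.real 3 c * s.real 4 (mask C) else 0 := by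
  have hlt : ∀ {c : ℕ}, c < K → ∀ {C : Finset ℕ}, C ⊆ Finset.range c →
      mask (insert c C) < 2 ^ K := by
    intro c hc C hC
    refine mask_lt (Finset.insert_subset (Finset.mem_range.2 hc) (hC.trans ?_))
    exact Finset.range_subset_range.2 hc.le
  refine (Spec.forN_of_cost K (fun c => 2 ^ c * 55 + 10)
    (fun k s' => ∀ t', ∀ c < K, ∀ C ⊆ Finset.range c,
      s'.real 6 (t' * 2 ^ K + mask (insert c C)) = s.real 6 (t' * 2 ^ K + mask (insert c C)) +
        if t = t' ∧ c < k then α z * s.real 3 c * s.real 4 (mask C) else 0) rfl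
      (fun s' hs => by simp [NatExp.eval, hs.nat 4 rfl, hR.sized.size]) (by simp)
      fun k hk s' hs hk' hI => ?_).weaken ?_ |>.post fun s' _ hI t' c hc C hC => ?_
  · have hR' := hR.same hs rfl
    have e5 : s'.nat 5 k = 2 ^ k := hR'.sized.pow2 k hk.le
    refine ((Spec.accum (2 ^ k) (fun _ => True) (fun j => t * 2 ^ K + 2 ^ k + j)
      (fun j => α z * s.real 3 k * s.real 4 j)
      (fun t ht => by simp [NatExp.eval, ht 31, ht 5, hk', e5])
      (fun j hj r hr hrr _ hj' => by
        simp [NatExp.eval, RealExp.eval, Test.Holds, hr 31, hr 5, hr 43, hr 17, hr 30, hk', e5, hj',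
          hs.nat 43 rfl, h43, hs.nat 30 rfl, h30, hR'.place t ht, hrr 0, hrr 3, hrr 4,
          hR'.input.alpha z hz, hs.real 3 rfl, hs.real 4 rfl])).post
      fun s₂ hs₂ h₂ => ?_).weaken ?_
    · rw [State.putNat_real]
      intro t' c hc C hC
      rw [h₂, hI t' c hc C hC, add_assoc]
      congr 1
      have hcC : c ∉ C := fun h => by simpa using hC h
      by_cases he : t = t' ∧ c = k
      · obtain ⟨rfl, rfl⟩ := he
        rw [if_neg (by omega), if_pos ⟨rfl, by omega⟩, zero_add,
          Finset.sum_eq_single_of_mem (mask C) (Finset.mem_range.2 (mask_lt hC)), if_pos]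
        · exact ⟨trivial, by rw [mask_insert hcC, add_assoc]⟩
        · intro j _ hne
          rw [if_neg]
          rintro ⟨-, h⟩
          rw [mask_insert hcC] at h
          omega
      · rw [Finset.sum_eq_zero, add_zero]
        · congr 1
          apply propext
          constructor
          · exact fun h => ⟨h.1, by omega⟩
          · exact fun h => ⟨h.1, by
              by_contra hcon
              exact he ⟨h.1, by omega⟩⟩
        · intro j hj
          rw [if_neg]
          rintro ⟨-, h⟩
          -- Round `k` writes only to cells whose largest colour is `k`, in the block of the node
          -- `t`.
          obtain ⟨D, hD, rfl⟩ := exists_mask_eq (Finset.mem_range.1 hj)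
          have hkD : k ∉ D := fun h => by simpa using hD h
          rw [add_assoc, ← mask_insert hkD] at h
          obtain ⟨h1, h2⟩ := place_inj (hlt hk hD) (hlt hc hC) h
          exact he ⟨h1, (mask_insert_inj hD hC h2).1.symm⟩
    · simp only [NatExp.cost, RealExp.cost, Test.cost]
      omega
  · have h1 := sum_two_pow_le K
    have h2 := Nat.lt_two_pow_self (n := K)
    simp only [NatExp.cost, Finset.sum_add_distrib, ← Finset.sum_mul, Finset.sum_const,
      Finset.card_range, smul_eq_mul]
    omega
  · rw [hI t' c hc C hC]
    simp [hc]

/-- The program that computes the tables of logarithmic derivatives. -/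
def logProgram : Program := .forN 30 (.get 0 (.lit 1)) (.seq causeProgram addLog)

theorem logProgram_spec {n m N K : ℕ} {bg : ℕ → List ℕ} {col : ℕ → ℕ} {α : ℕ → ℝ}
    {β : ℕ → ℕ → ℝ} {s : State} (hR : Ready n m N K bg col α β s)
    (hhome : ∀ z < m, s.nat 22 z < N) (h6 : ∀ x, s.real 6 x = 0) :
    Spec logProgram s (420 * (m * 2 ^ K) + 20) fun s' =>
      ∀ t < N, ∀ c < K, ∀ C ⊆ Finset.range c, s'.real 6 (t * 2 ^ K + mask (insert c C)) =
        ∑ z ∈ (Finset.range m).filter fun z => s.nat 22 z = t,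
          α z * colourSum bg col β t c z * invPow 1 (fun i => colourSum bg col β t i z) C := by
  refine (Spec.forN m (400 * 2 ^ K) (fun k s' => ∀ t, ∀ c < K, ∀ C ⊆ Finset.range c,
      s'.real 6 (t * 2 ^ K + mask (insert c C)) =
        ∑ z ∈ (Finset.range k).filter fun z => s.nat 22 z = t,
          α z * colourSum bg col β t c z * invPow 1 (fun i => colourSum bg col β t i z) C) rfl
    (fun s' hs => by simp [NatExp.eval, hs.nat 0 rfl, hR.input.causes]) (by simp [h6])
    fun k hk s' hs hk' hI => ?_).weaken ?_ |>.post fun s' _ hI t _ => hI t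
  · have hR' := hR.same hs rfl
    have e22 : s'.nat 22 = s.nat 22 := hs.nat 22 rfl
    refine (Spec.seq (causeProgram_spec hR' hk hk' (by rw [e22]; exact hhome k hk))
      fun s₁ hs₁ h₁ => (addLog_spec (hR'.same hs₁ rfl) hk (by rw [hs₁.nat 30 rfl, hk'])
        (by rw [e22]; exact hhome k hk) h₁.1).post fun s₂ hs₂ h₂ => ?_).weaken (by omega)
    rw [State.putNat_real]
    intro t c hc C hC
    have hCK : C ⊆ Finset.range K := hC.trans (Finset.range_subset_range.2 hc.le)
    rw [h₂ t c hc C hC, hs₁.real 6 rfl, hI t c hc C hC, Finset.range_add_one, Finset.filter_insert,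
      h₁.2.1 c hc, h₁.2.2 C hCK, e22]
    split_ifs with h
    · rw [Finset.sum_insert (by simp), add_comm, h]
    · rw [add_zero]
  · have := Nat.one_le_two_pow (n := K)
    simp only [NatExp.cost]
    have : m * (400 * 2 ^ K + (1 + 1) + 10) ≤ m * (420 * 2 ^ K) := Nat.mul_le_mul_left _ (by omega)
    rw [show 420 * (m * 2 ^ K) = m * (420 * 2 ^ K) by ring]
    omega

/-- The product of the generating functions of the causes whose home is `t`, in terms of colours. -/
noncomputable def nodeFun (m : ℕ) (bg : ℕ → List ℕ) (col home : ℕ → ℕ) (α : ℕ → ℝ)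
    (β : ℕ → ℕ → ℝ) (t : ℕ) : SetAlg :=
  genFun ((Finset.range m).filter fun z => home z = t) α (colourSum bg col β t)

/-- The program that computes the generating function of the node in the variable `30`. -/
def expNode : Program :=
  .seq (.setReal 7 (.get 17 (.var 30)) (.lit 1))
    (.forN 31 (.var 4) (.accum 32 (.get 6 (.var 31)) (.natEq (.lit 0) (.lit 0)) 7
      (.add (.add (.get 17 (.var 30)) (.get 5 (.var 31)))
        (.add (.get 7 (.var 32)) (.get 8 (.var 32))))
      (.mul (.get 6 (.add (.add (.get 17 (.var 30)) (.get 5 (.var 31))) (.get 7 (.var 32))))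
        (.get 7 (.add (.get 17 (.var 30)) (.get 8 (.var 32)))))))

/-- By `genFun_insert`, the entries with largest colour `c` are the convolution of the derivative in
direction `c` with the part of the table on colours below `c`. Round `c` takes `3 ^ c` steps,
however many causes have their home at the node. -/
theorem expNode_spec {n m N K : ℕ} {bg : ℕ → List ℕ} {col home : ℕ → ℕ} {α : ℕ → ℝ}
    {β : ℕ → ℕ → ℝ} {s : State} (hR : Ready n m N K bg col α β s) {t : ℕ} (ht : t < N)
    (h30 : s.nat 30 0 = t)
    (h6 : ∀ c < K, ∀ C ⊆ Finset.range c, s.real 6 (t * 2 ^ K + mask (insert c C)) =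
        ∑ z ∈ (Finset.range m).filter fun z => home z = t,
          α z * colourSum bg col β t c z * invPow 1 (fun i => colourSum bg col β t i z) C)
    (h7 : ∀ x, t * 2 ^ K ≤ x → s.real 7 x = 0) :
    Spec expNode s (150 * 3 ^ K) fun s' =>
      (∀ C ⊆ Finset.range K, s'.real 7 (t * 2 ^ K + mask C) = nodeFun m bg col home α β t C) ∧
      ∀ x, x < t * 2 ^ K ∨ t * 2 ^ K + 2 ^ K ≤ x → s'.real 7 x = s.real 7 x := by
  set E := nodeFun m bg col home α β t with hE
  set b := t * 2 ^ K with hb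
  refine (Spec.seq (Spec.straight _ _ rfl (R := fun s' =>
    s'.real 7 = Function.update (s.real 7) b 1)
    (by simp [Program.exec, NatExp.eval, RealExp.eval, h30, hR.place t ht, hb]))
    (c' := 130 * 3 ^ K + 10) fun s₁ hs₁ h₁ => ?_).weaken ?_
  · have hR₁ := hR.same hs₁ rfl
    refine (Spec.forN_of_cost K (fun c => 3 ^ c * 72 + 12)
      (fun c s' => (∀ C ⊆ Finset.range c, s'.real 7 (b + mask C) = E C) ∧
        ∀ x, x < b ∨ b + 2 ^ c ≤ x → s'.real 7 x = s.real 7 x) rfl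
      (fun s' hs => by simp [NatExp.eval, hs.nat 4 rfl, hR₁.sized.size]) ⟨?_, ?_⟩
      fun c hc s' hs hc' hI => ?_).weaken ?_
    · intro C hC
      obtain rfl : C = ∅ := by simpa using hC
      rw [hE, nodeFun, genFun_empty, mask_empty, State.putNat_real, h₁]
      simp
    · intro x hx
      rw [State.putNat_real, h₁, Function.update_of_ne (by omega)]
    · have hR' := hR₁.same hs rfl
      have e5 : s'.nat 5 c = 2 ^ c := hR'.sized.pow2 c hc.le
      have e6 : s'.nat 6 c = 3 ^ c := hR'.sized.pow3 c hc.le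
      have e30 : s'.nat 30 0 = t := by rw [hs.nat 30 rfl, hs₁.nat 30 rfl, h30]
      have eL : s'.real 6 = s.real 6 := by rw [hs.real 6 rfl, hs₁.real 6 rfl]
      have htern := hR'.sized.tern
      have hbd := fun {i : ℕ} (hi : i < 3 ^ c) => tern_bounds htern hc.le hi
      refine ((Spec.accum (3 ^ c) (fun _ => True)
        (fun i => b + 2 ^ c + (s'.nat 7 i + s'.nat 8 i))
        (fun i => s.real 6 (b + 2 ^ c + s'.nat 7 i) * s'.real 7 (b + s'.nat 8 i))
        (fun r hr => by simp [NatExp.eval, hr 31, hr 6, hc', e6])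
        (fun j hj r hr hrr hr7 hj' => ?_)).post fun s₂ hs₂ h₂ => ?_).weaken ?_
      · have hj1 := hbd hj
        -- A round reads the table below `b + 2 ^ c` and writes from that cell on.
        have e7 : r.real 7 (b + s'.nat 8 j) = s'.real 7 (b + s'.nat 8 j) :=
          hr7 _ fun i hi => by omega
        simp [NatExp.eval, RealExp.eval, Test.Holds, hr 31, hr 5, hr 7, hr 8, hr 17, hr 30, hc', e5,
          e30, hj', hR'.place t ht, hrr 6, eL, ← hb, e7]
      · rw [State.putNat_real]
        have hsupp : ∀ x, x < b + 2 ^ c ∨ b + 2 ^ c + 2 ^ c ≤ x → s₂.real 7 x = s'.real 7 x := by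
          intro x hx
          rw [h₂, Finset.sum_eq_zero, add_zero]
          intro i hi
          rw [if_neg]
          rintro ⟨-, h⟩
          have := hbd (Finset.mem_range.1 hi)
          omega
        refine ⟨?_, fun x hx => ?_⟩
        · refine forall_subset_range_succ (fun C hC => ?_) fun C hC hcC => ?_
          · have := mask_lt hC
            rw [hsupp _ (by omega), hI.1 C hC]
          · rw [mask_insert hcC, h₂, hI.2 _ (by omega), h7 _ (by omega), zero_add, hE, nodeFun,
              genFun_insert _ _ _ hcC, mul_apply, ← nodeFun, ← hE]
            have := htern.sum_conv hc.le (fun x => s.real 6 (b + 2 ^ c + x))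
              (fun x => s'.real 7 (b + x)) hC
            simp only [true_and]
            rw [← add_assoc, Finset.sum_congr rfl fun i _ => if_congr
              (show b + 2 ^ c + (s'.nat 7 i + s'.nat 8 i) = b + 2 ^ c + mask C ↔
                s'.nat 7 i + s'.nat 8 i = mask C by omega) rfl rfl, this]
            refine Finset.sum_congr rfl fun A hA => ?_
            have hA' := (Finset.mem_powerset.1 hA).trans hC
            have hcA : c ∉ A := fun h => by simpa using hA' h
            rw [hI.1 _ (Finset.sdiff_subset.trans hC), add_assoc, ← mask_insert hcA, h6 c hc A hA',
              sum_apply]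
            rfl
        · have : 2 ^ (c + 1) = 2 ^ c + 2 ^ c := by ring
          rw [hsupp _ (by omega), hI.2 x (by omega)]
      · simp only [NatExp.cost, RealExp.cost, Test.cost]
        omega
    · have h1 := sum_three_pow_le K
      have h2 := le_three_pow K
      simp only [NatExp.cost, Finset.sum_add_distrib, ← Finset.sum_mul, Finset.sum_const,
        Finset.card_range, smul_eq_mul]
      omega
  · have := one_le_three_pow K
    simp only [Program.time, NatExp.cost, RealExp.cost]
    omega

/-- The program that computes the generating functions of all nodes. -/
def expProgram : Program := .forN 30 (.get 0 (.lit 2)) expNode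

theorem expProgram_spec {n m N K : ℕ} {bg : ℕ → List ℕ} {col home : ℕ → ℕ} {α : ℕ → ℝ}
    {β : ℕ → ℕ → ℝ} {s : State} (hR : Ready n m N K bg col α β s)
    (h6 : ∀ t < N, ∀ c < K, ∀ C ⊆ Finset.range c, s.real 6 (t * 2 ^ K + mask (insert c C)) =
        ∑ z ∈ (Finset.range m).filter fun z => home z = t,
          α z * colourSum bg col β t c z * invPow 1 (fun i => colourSum bg col β t i z) C)
    (h7 : ∀ x, s.real 7 x = 0) :
    Spec expProgram s (170 * (N * 3 ^ K) + 20) fun s' => ∀ t < N, ∀ C ⊆ Finset.range K,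
      s'.real 7 (t * 2 ^ K + mask C) = nodeFun m bg col home α β t C := by
  refine (Spec.forN N (150 * 3 ^ K) (fun k s' => (∀ t < k, ∀ C ⊆ Finset.range K,
      s'.real 7 (t * 2 ^ K + mask C) = nodeFun m bg col home α β t C) ∧
      ∀ x, k * 2 ^ K ≤ x → s'.real 7 x = 0) rfl
    (fun s' hs => by simp [NatExp.eval, hs.nat 0 rfl, hR.input.nodes]) (by simp [h7])
    fun k hk s' hs hk' hI => ?_).weaken ?_ |>.post fun s' _ hI => hI.1
  · refine (expNode_spec (hR.same hs rfl) hk hk' (home := home)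
      (by rw [hs.real 6 rfl]; exact h6 k hk) hI.2).post fun s₁ _ h₁ => ?_
    rw [State.putNat_real]
    refine ⟨fun t ht C hC => ?_, fun x hx => ?_⟩
    · rcases Nat.lt_succ_iff_lt_or_eq.1 ht with ht | rfl
      · have h1 := mask_lt hC
        have h2 : (t + 1) * 2 ^ K ≤ k * 2 ^ K := Nat.mul_le_mul_right _ ht
        rw [add_mul, one_mul] at h2
        rw [h₁.2 _ (by omega), hI.1 t ht C hC]
      · exact h₁.1 C hC
    · have := Nat.one_le_two_pow (n := K)
      rw [add_mul, one_mul] at hx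
      rw [h₁.2 _ (by omega), hI.2 x (by omega)]
  · have := one_le_three_pow K
    simp only [NatExp.cost]
    have : N * (150 * 3 ^ K + (1 + 1) + 10) ≤ N * (170 * 3 ^ K) := Nat.mul_le_mul_left _ (by omega)
    rw [show 170 * (N * 3 ^ K) = N * (170 * 3 ^ K) by ring]
    omega

end RealRAM

namespace RealRAM

open SetAlg

/-! ### The two passes over the tree -/

/-- The memory after the ordering, the masks and the homes of the causes have been computed. -/
structure Ordered (n m N K : ℕ) (bg : ℕ → List ℕ) (col : ℕ → ℕ) (α : ℕ → ℝ) (β : ℕ → ℕ → ℝ)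
    (Q par home : ℕ → ℕ) (s : State) : Prop where
  ready : Ready n m N K bg col α β s
  order : ElimOrder N (fun t => (bg t).toFinset) Q par
  lt : ∀ i < N, Q i < N
  home_lt : ∀ z < m, home z < N
  queue_eq : s.nat 11 = Q
  par_eq : s.nat 13 = par
  home_eq : s.nat 22 = home
  full : ∀ t < N, s.nat 18 t = mask ((bg t).toFinset.image col)
  lower : ∀ i, i + 1 < N → s.nat 19 (Q i) =
    mask (((bg (Q i)).toFinset \ (bg (par (Q i))).toFinset).image col)
  upper : ∀ i, i + 1 < N → s.nat 20 (Q i) =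
    mask (((bg (par (Q i))).toFinset \ (bg (Q i)).toFinset).image col)

/-- Whether a program leaves the ordering, the masks and the homes of the causes as they are. -/
def Program.gentle (P : Program) : Bool :=
  P.harmless && [11, 13, 18, 19, 20, 22].all fun a => !P.writesNat a

section

variable {n m N K : ℕ} {bg : ℕ → List ℕ} {col Q par home : ℕ → ℕ} {α : ℕ → ℝ} {β : ℕ → ℕ → ℝ}
  {s s' : State}

theorem Ordered.same {P : Program} (h : Ordered n m N K bg col α β Q par home s)
    (hs : Same P s s') (hP : P.gentle = true) : Ordered n m N K bg col α β Q par home s' := by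
  simp only [Program.gentle, List.all_cons, List.all_nil, Bool.and_eq_true, Bool.not_eq_true',
    and_true] at hP
  obtain ⟨h0, h11, h13, h18, h19, h20, h22⟩ := hP
  exact ⟨h.ready.same hs h0, h.order, h.lt, h.home_lt, by rw [hs.nat _ h11, h.queue_eq],
    by rw [hs.nat _ h13, h.par_eq], by rw [hs.nat _ h22, h.home_eq],
    fun t ht => by rw [hs.nat _ h18, h.full t ht], fun i hi => by rw [hs.nat _ h19, h.lower i hi],
    fun i hi => by rw [hs.nat _ h20, h.upper i hi]⟩

/-- The tables stored in an array. -/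
def TabEq (K N : ℕ) (r : ℕ → ℝ) (f : ℕ → SetAlg) : Prop := ∀ t < N, tab K r (t * 2 ^ K) = f t

theorem TabEq.update {r r' : ℕ → ℝ} {f : ℕ → SetAlg} (h : TabEq K N r f) {p : ℕ} {g : SetAlg}
    (hg : tab K r' (p * 2 ^ K) = g)
    (hr : ∀ x, x < p * 2 ^ K ∨ p * 2 ^ K + 2 ^ K ≤ x → r' x = r x) :
    TabEq K N r' (Function.update f p g) := by
  intro t ht
  by_cases htp : t = p
  · rw [htp, Function.update_self, hg]
  · rw [Function.update_of_ne htp, ← h t ht]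
    refine tab_congr fun x hx => hr _ ?_
    rcases Nat.lt_or_gt_of_ne htp with hlt | hlt
    · have := Nat.mul_le_mul_right (2 ^ K) hlt
      rw [Nat.succ_mul] at this
      omega
    · have := Nat.mul_le_mul_right (2 ^ K) hlt
      rw [Nat.succ_mul] at this
      omega

theorem Ordered.stable_place (h : Ordered n m N K bg col α β Q par home s) {a t : ℕ} (ha : a ≠ 32)
    (ht : t < N) (hat : s.nat a 0 = t) : Stable 32 s (.get 17 (.var a)) (t * 2 ^ K) :=
  ⟨fun s' hs => by simp [NatExp.eval, hs 17, hs a ha, hat, h.ready.place t ht],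
    by simp [NatExp.cost]⟩

theorem stable_lit (s : State) (x : ℕ) : Stable 32 s (.lit x) x :=
  ⟨fun _ _ => rfl, by simp [NatExp.cost]⟩

theorem stable_get {b a t x : ℕ} (ha : a ≠ 32) (hb : b ≠ 32) (hat : s.nat a 0 = t)
    (hx : s.nat b t = x) : Stable 32 s (.get b (.var a)) x :=
  ⟨fun s' hs => by simp [NatExp.eval, hs b hb, hs a ha, hat, hx], by simp [NatExp.cost]⟩

theorem Ordered.image_subset (h : Ordered n m N K bg col α β Q par home s) {t : ℕ} (ht : t < N)
    {S : Finset ℕ} (hS : S ⊆ (bg t).toFinset) : S.image col ⊆ Finset.range K := by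
  intro c hc
  obtain ⟨v, hv, rfl⟩ := Finset.mem_image.1 hc
  exact Finset.mem_range.2 (h.ready.coloured.lt t ht v (List.mem_toFinset.1 (hS hv)))

theorem Ordered.par_lt (h : Ordered n m N K bg col α β Q par home s) {i : ℕ} (hi : i + 1 < N) :
    par (Q i) < N ∧ par (Q i) ≠ Q i := by
  obtain ⟨j, hj, hjN, he⟩ := h.order.par_mem i hi
  rw [he]
  refine ⟨h.lt j hjN, fun hh => ?_⟩
  have := h.order.inj j i hjN (by omega) hh
  omega

/-- One step of the upward pass, at the node in the variable `43` with the parent in `44`. -/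
def upStep : Program :=
  .seq (message 10 7 (.lit 0) (.get 17 (.var 43)) (.get 19 (.var 43)))
  (.seq (copy 8 7 (.get 17 (.var 43)) (.get 17 (.var 44)))
  (conv 7 8 10 (.get 17 (.var 44)) (.get 17 (.var 43)) (.lit 0)))

/-- The table of the parent before the multiplication is saved at the place of the child, which is
free since a node has only one parent. The copy serves both as an operand of the convolution and for
undoing the step later. -/
theorem upStep_spec (h : Ordered n m N K bg col α β Q par home s) {i : ℕ} (hi : i + 1 < N)
    (h43 : s.nat 43 0 = Q i) (h44 : s.nat 44 0 = par (Q i)) {F : ℕ → SetAlg}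
    (hF : TabEq K N (s.real 7) F) {S : ℕ → SetAlg} (hS : TabEq K N (s.real 8) S) :
    Spec upStep s (320 * 3 ^ K) fun s' =>
      TabEq K N (s'.real 7) (Function.update F (par (Q i)) (F (par (Q i)) *
        contract (((bg (Q i)).toFinset \ (bg (par (Q i))).toFinset).image col) (F (Q i)))) ∧
      TabEq K N (s'.real 8) (Function.update S (Q i) (F (par (Q i)))) := by
  have hu := h.lt i (by omega)
  obtain ⟨hp, hpu⟩ := h.par_lt hi
  refine (Spec.seq (message_spec h.ready.sized (stable_lit s 0)
    (h.stable_place (by decide) hu h43) (stable_get (by decide) (by decide) h43 (h.lower i hi))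
    (h.image_subset hu Finset.sdiff_subset) (by decide)) fun s₁ hs₁ h₁ => ?_).weaken
    (c' := 320 * 3 ^ K) (c := 140 * 3 ^ K + (40 * 3 ^ K + 140 * 3 ^ K)) (by omega)
  have hO₁ := h.same hs₁ rfl
  have h43₁ : s₁.nat 43 0 = Q i := by rw [hs₁.nat 43 rfl, h43]
  have h44₁ : s₁.nat 44 0 = par (Q i) := by rw [hs₁.nat 44 rfl, h44]
  refine Spec.seq (copy_spec hO₁.ready.sized (hO₁.stable_place (by decide) hu h43₁)
    (hO₁.stable_place (by decide) hp h44₁) (by decide)) fun s₂ hs₂ h₂ => ?_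
  have hO₂ := hO₁.same hs₂ rfl
  have h43₂ : s₂.nat 43 0 = Q i := by rw [hs₂.nat 43 rfl, h43₁]
  have h44₂ : s₂.nat 44 0 = par (Q i) := by rw [hs₂.nat 44 rfl, h44₁]
  refine (conv_spec hO₂.ready.sized (hO₂.stable_place (by decide) hp h44₂)
    (hO₂.stable_place (by decide) hu h43₂) (stable_lit s₂ 0) (by decide) (by decide)).post
    fun s₃ hs₃ h₃ => ?_
  have hsave : tab K (s₂.real 8) (Q i * 2 ^ K) = F (par (Q i)) := by
    rw [h₂.1, hs₁.real 7 rfl, hF _ hp]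
  refine ⟨TabEq.update hF ?_ fun x hx => ?_, ?_⟩
  · rw [h₃.1, hsave, hs₂.real 10 rfl, h₁.1, hF _ hu]
  · rw [h₃.2 x hx, hs₂.real 7 rfl, hs₁.real 7 rfl]
  · rw [hs₃.real 8 rfl]
    exact hS.update hsave fun x hx => by rw [h₂.2 x hx, hs₁.real 8 rfl]

/-- The upward pass. -/
def upProgram : Program :=
  .forN 30 (.sub (.get 0 (.lit 2)) (.lit 1))
    (.seq (.seq (.setNat 43 (.lit 0) (.get 11 (.var 30))) (.setNat 44 (.lit 0) (.get 13 (.var 43))))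
      upStep)

theorem upProgram_spec (h : Ordered n m N K bg col α β Q par home s) {E : ℕ → SetAlg}
    (hE : TabEq K N (s.real 7) E) :
    Spec upProgram s (350 * (N * 3 ^ K) + 20) fun s' =>
      TabEq K N (s'.real 7) (ElimOrder.up (fun t => (bg t).toFinset) Q par col E (N - 1)) ∧
      ∀ i, i + 1 < N → tab K (s'.real 8) (Q i * 2 ^ K) =
        ElimOrder.up (fun t => (bg t).toFinset) Q par col E i (par (Q i)) := by
  refine (Spec.forN (N - 1) (320 * 3 ^ K + 10) (fun k s' =>
      TabEq K N (s'.real 7) (ElimOrder.up (fun t => (bg t).toFinset) Q par col E k) ∧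
      ∀ i < k, tab K (s'.real 8) (Q i * 2 ^ K) =
        ElimOrder.up (fun t => (bg t).toFinset) Q par col E i (par (Q i))) rfl
    (fun s' hs => by simp [NatExp.eval, hs.nat 0 rfl, h.ready.input.nodes]) ⟨hE, by simp⟩
    fun k hk s' hs hk' hI => ?_).weaken ?_ |>.post fun s' _ hI =>
      ⟨hI.1, fun i hi => hI.2 i (by omega)⟩
  · have hO := h.same hs rfl
    refine (Spec.seq (Spec.straight _ _ rfl (R := fun s'' =>
      s''.nat 43 0 = Q k ∧ s''.nat 44 0 = par (Q k)) (by
        simp [Program.exec, NatExp.eval, hk', hO.queue_eq, hO.par_eq]))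
      fun s₁ hs₁ h₁ => (upStep_spec (hO.same hs₁ rfl) (i := k) (by omega) h₁.1 h₁.2
        (F := ElimOrder.up (fun t => (bg t).toFinset) Q par col E k)
        (by rw [hs₁.real 7 rfl]; exact hI.1) (S := fun t => tab K (s₁.real 8) (t * 2 ^ K))
        fun _ _ => rfl).post fun s₂ _ h₂ => ?_).weaken
        (by simp only [Program.time, NatExp.cost]; omega)
    refine ⟨h₂.1, fun i hi => ?_⟩
    rw [State.putNat_real, h₂.2 _ (h.lt i (by omega))]
    rcases Nat.lt_succ_iff_lt_or_eq.1 hi with hi | rfl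
    · rw [Function.update_of_ne, hs₁.real 8 rfl, hI.2 i hi]
      intro he
      have := h.order.inj i k (by omega) (by omega) he
      omega
    · rw [Function.update_self]
  · have := one_le_three_pow K
    simp only [NatExp.cost]
    have : (N - 1) * (320 * 3 ^ K + 10 + (1 + 1 + 1 + 1) + 10) ≤ N * (350 * 3 ^ K) :=
      Nat.mul_le_mul (by omega) (by omega)
    rw [show 350 * (N * 3 ^ K) = N * (350 * 3 ^ K) by ring]
    omega

/-- One step of the downward pass, at the node in the variable `43` with the parent in `44`. -/
def downNode : Program :=
  .seq (copy 7 8 (.get 17 (.var 44)) (.get 17 (.var 43)))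
  (.seq (message 10 7 (.lit 0) (.get 17 (.var 43)) (.get 19 (.var 43)))
  (.seq (conv 11 7 9 (.lit 0) (.get 17 (.var 44)) (.get 17 (.var 44)))
  (.seq (copy 12 9 (.lit 0) (.get 17 (.var 44)))
  (.seq (conv 9 12 10 (.get 17 (.var 44)) (.lit 0) (.lit 0))
  (message 9 11 (.get 17 (.var 43)) (.lit 0) (.get 20 (.var 43)))))))

/-- `F'` is `F` with the multiplication at the parent undone, obtained by copying back. The product
of the two tables of the parent is formed before its complementary table absorbs the message of the
child, so that the child does not receive its own message. -/
theorem downNode_spec (h : Ordered n m N K bg col α β Q par home s) {i : ℕ} (hi : i + 1 < N)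
    (h43 : s.nat 43 0 = Q i) (h44 : s.nat 44 0 = par (Q i)) {F F' H : ℕ → SetAlg}
    (hF : TabEq K N (s.real 7) F) (hH : TabEq K N (s.real 9) H) {S : SetAlg}
    (hS : tab K (s.real 8) (Q i * 2 ^ K) = S) (hF' : F' = Function.update F (par (Q i)) S) :
    Spec downNode s (640 * 3 ^ K) fun s' => TabEq K N (s'.real 7) F' ∧
      TabEq K N (s'.real 9)
        (ElimOrder.downStep (fun t => (bg t).toFinset) par col F' H (Q i)) := by
  have hu := h.lt i (by omega)
  obtain ⟨hp, hpu⟩ := h.par_lt hi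
  refine (Spec.seq (copy_spec h.ready.sized (h.stable_place (by decide) hp h44)
    (h.stable_place (by decide) hu h43) (by decide)) fun s₁ hs₁ h₁ => ?_).weaken
    (c' := 640 * 3 ^ K) (c := 40 * 3 ^ K + (140 * 3 ^ K + (140 * 3 ^ K + (40 * 3 ^ K +
      (140 * 3 ^ K + 140 * 3 ^ K))))) (by omega)
  have hO₁ := h.same hs₁ rfl
  have h43₁ : s₁.nat 43 0 = Q i := by rw [hs₁.nat 43 rfl, h43]
  have h44₁ : s₁.nat 44 0 = par (Q i) := by rw [hs₁.nat 44 rfl, h44]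
  have hF₁ : TabEq K N (s₁.real 7) F' := by
    rw [hF']
    exact hF.update (h₁.1.trans hS) h₁.2
  refine Spec.seq (message_spec hO₁.ready.sized (stable_lit s₁ 0)
    (hO₁.stable_place (by decide) hu h43₁)
    (stable_get (by decide) (by decide) h43₁ (hO₁.lower i hi))
    (hO₁.image_subset hu Finset.sdiff_subset) (by decide)) fun s₂ hs₂ h₂ => ?_
  have hO₂ := hO₁.same hs₂ rfl
  have h43₂ : s₂.nat 43 0 = Q i := by rw [hs₂.nat 43 rfl, h43₁]
  have h44₂ : s₂.nat 44 0 = par (Q i) := by rw [hs₂.nat 44 rfl, h44₁]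
  refine Spec.seq (conv_spec hO₂.ready.sized (stable_lit s₂ 0)
    (hO₂.stable_place (by decide) hp h44₂) (hO₂.stable_place (by decide) hp h44₂) (by decide)
    (by decide)) fun s₃ hs₃ h₃ => ?_
  have hO₃ := hO₂.same hs₃ rfl
  have h43₃ : s₃.nat 43 0 = Q i := by rw [hs₃.nat 43 rfl, h43₂]
  have h44₃ : s₃.nat 44 0 = par (Q i) := by rw [hs₃.nat 44 rfl, h44₂]
  refine Spec.seq (copy_spec hO₃.ready.sized (stable_lit s₃ 0)
    (hO₃.stable_place (by decide) hp h44₃) (by decide)) fun s₄ hs₄ h₄ => ?_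
  have hO₄ := hO₃.same hs₄ rfl
  have h43₄ : s₄.nat 43 0 = Q i := by rw [hs₄.nat 43 rfl, h43₃]
  have h44₄ : s₄.nat 44 0 = par (Q i) := by rw [hs₄.nat 44 rfl, h44₃]
  refine Spec.seq (conv_spec hO₄.ready.sized (hO₄.stable_place (by decide) hp h44₄)
    (stable_lit s₄ 0) (stable_lit s₄ 0) (by decide) (by decide)) fun s₅ hs₅ h₅ => ?_
  have hO₅ := hO₄.same hs₅ rfl
  have h43₅ : s₅.nat 43 0 = Q i := by rw [hs₅.nat 43 rfl, h43₄]
  refine (message_spec hO₅.ready.sized (hO₅.stable_place (by decide) hu h43₅) (stable_lit s₅ 0)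
    (stable_get (by decide) (by decide) h43₅ (hO₅.upper i hi))
    (hO₅.image_subset hp Finset.sdiff_subset) (by decide)).post fun s₆ hs₆ h₆ => ?_
  have e9₂ : s₂.real 9 = s.real 9 := by rw [hs₂.real 9 rfl, hs₁.real 9 rfl]
  have e9₃ : s₃.real 9 = s.real 9 := by rw [hs₃.real 9 rfl, e9₂]
  have e9₄ : s₄.real 9 = s.real 9 := by rw [hs₄.real 9 rfl, e9₃]
  refine ⟨by rw [hs₆.real 7 rfl, hs₅.real 7 rfl, hs₄.real 7 rfl, hs₃.real 7 rfl, hs₂.real 7 rfl]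
             exact hF₁, ?_⟩
  rw [ElimOrder.downStep]
  refine (hH.update (r' := s₅.real 9) ?_ fun x hx => ?_).update ?_ h₆.2
  · rw [h₅.1, h₄.1, e9₃, hH _ hp, hs₄.real 10 rfl, hs₃.real 10 rfl, h₂.1, hF₁ _ hu]
  · rw [h₅.2 x hx, e9₄]
  · rw [h₆.1, hs₅.real 11 rfl, hs₄.real 11 rfl, h₃.1, e9₂, hH _ hp, hs₂.real 7 rfl, hF₁ _ hp]

/-- The downward pass. -/
def downProgram : Program :=
  .seq (.setReal 9 (.get 17 (.get 11 (.sub (.get 0 (.lit 2)) (.lit 1)))) (.lit 1))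
  (.forN 30 (.sub (.get 0 (.lit 2)) (.lit 1))
    (.seq (.seq (.setNat 43 (.lit 0) (.get 11 (.sub (.sub (.get 0 (.lit 2)) (.lit 2)) (.var 30))))
      (.setNat 44 (.lit 0) (.get 13 (.var 43)))) downNode))

/-- The upward stages are revisited in reverse, with only the current one in memory; in the end
array `7` again holds the original tables. -/
theorem downProgram_spec (h : Ordered n m N K bg col α β Q par home s) (hN : 0 < N)
    {E : ℕ → SetAlg}
    (hF : TabEq K N (s.real 7) (ElimOrder.up (fun t => (bg t).toFinset) Q par col E (N - 1)))
    (hS : ∀ i, i + 1 < N → tab K (s.real 8) (Q i * 2 ^ K) =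
        ElimOrder.up (fun t => (bg t).toFinset) Q par col E i (par (Q i)))
    (h9 : ∀ x, s.real 9 x = 0) :
    Spec downProgram s (700 * (N * 3 ^ K) + 40) fun s' =>
      TabEq K N (s'.real 7) E ∧
      TabEq K N (s'.real 9)
        (ElimOrder.down (fun t => (bg t).toFinset) N Q par col E (N - 1)) := by
  refine (Spec.seq (Spec.straight _ _ rfl (R := fun s' =>
    s'.real 9 = Function.update (s.real 9) (Q (N - 1) * 2 ^ K) 1) (by
      simp [Program.exec, NatExp.eval, RealExp.eval, h.queue_eq, h.ready.input.nodes,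
        h.ready.place _ (h.lt (N - 1) (by omega))])) (c' := 700 * (N * 3 ^ K) + 20)
    fun s₁ hs₁ h₁ => ?_).weaken (by simp only [Program.time, NatExp.cost, RealExp.cost]; omega)
  have hO₁ := h.same hs₁ rfl
  have e7 : s₁.real 7 = s.real 7 := hs₁.real 7 rfl
  have e8 : s₁.real 8 = s.real 8 := hs₁.real 8 rfl
  refine (Spec.forN (N - 1) (640 * 3 ^ K + 20) (fun k s' =>
      TabEq K N (s'.real 7)
        (ElimOrder.up (fun t => (bg t).toFinset) Q par col E (N - 1 - k)) ∧
      TabEq K N (s'.real 9) (ElimOrder.down (fun t => (bg t).toFinset) N Q par col E k)) rfl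
    (fun s' hs => by simp [NatExp.eval, hs.nat 0 rfl, hO₁.ready.input.nodes]) ⟨?_, ?_⟩
    fun k hk s' hs hk' hI => ?_).weaken ?_ |>.post fun s' _ hI => ?_
  · rw [State.putNat_real, e7]
    exact hF
  · have h0 : TabEq K N (s.real 9) fun _ => 0 := fun t _ =>
      tab_eq (fun _ _ => rfl) fun C _ => by rw [h9]; rfl
    have := h0.update (r' := s₁.real 9) (p := Q (N - 1)) (g := 1)
      (tab_eq (supp_one _) fun C hC => ?_) fun x hx => ?_
    · rw [State.putNat_real]
      intro t ht
      rw [this t ht, ElimOrder.down, Function.update_apply]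
    · rw [h₁, one_apply, Function.update_apply]
      by_cases hC0 : C = ∅
      · rw [hC0, mask_empty, if_pos rfl, if_pos (by simp)]
      · rw [if_neg, if_neg hC0, h9]
        intro he
        refine hC0 (mask_injective ?_)
        rw [mask_empty]
        omega
    · rw [h₁, Function.update_of_ne]
      have := Nat.one_le_two_pow (n := K)
      omega
  · have hO := hO₁.same hs rfl
    have e8' : s'.real 8 = s.real 8 := by rw [hs.real 8 rfl, e8]
    refine (Spec.seq (Spec.straight _ _ rfl (R := fun s'' =>
      s''.nat 43 0 = Q (N - 2 - k) ∧ s''.nat 44 0 = par (Q (N - 2 - k))) (by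
        simp [Program.exec, NatExp.eval, hk', hO.queue_eq, hO.par_eq, hO.ready.input.nodes]))
      fun s₂ hs₂ h₂ => (downNode_spec (hO.same hs₂ rfl) (i := N - 2 - k) (by omega) h₂.1 h₂.2
        (F' := ElimOrder.up (fun t => (bg t).toFinset) Q par col E (N - 2 - k))
        (by rw [hs₂.real 7 rfl]; exact hI.1) (by rw [hs₂.real 9 rfl]; exact hI.2)
        (by rw [hs₂.real 8 rfl, e8']) ?_).post
        fun s₃ _ h₃ => ?_).weaken (by simp only [Program.time, NatExp.cost]; omega)
    -- Stages `i` and `i + 1` differ at the parent only, so restoring the saved table there gives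
    -- stage `i` back.
    · rw [show N - 1 - k = N - 2 - k + 1 by omega, ElimOrder.up, Function.update_idem,
        hS _ (by omega), Function.update_eq_self]
    · rw [State.putNat_real, show N - 1 - (k + 1) = N - 2 - k by omega, ElimOrder.down]
      exact h₃
  · have := one_le_three_pow K
    simp only [NatExp.cost]
    have : (N - 1) * (640 * 3 ^ K + 20 + (1 + 1 + 1 + 1) + 10) ≤ N * (700 * 3 ^ K) :=
      Nat.mul_le_mul (by omega) (by omega)
    rw [show 700 * (N * 3 ^ K) = N * (700 * 3 ^ K) by ring]
    omega
  · rw [Nat.sub_self] at hI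
    exact hI

/-- The program that multiplies the two tables of each node. -/
def joinProgram : Program :=
  .forN 30 (.get 0 (.lit 2))
    (conv 12 7 9 (.get 17 (.var 30)) (.get 17 (.var 30)) (.get 17 (.var 30)))

theorem joinProgram_spec (h : Ordered n m N K bg col α β Q par home s) {E H : ℕ → SetAlg}
    (hE : TabEq K N (s.real 7) E) (hH : TabEq K N (s.real 9) H) :
    Spec joinProgram s (160 * (N * 3 ^ K) + 20) fun s' =>
      TabEq K N (s'.real 12) fun t => E t * H t := by
  refine (Spec.forN N (140 * 3 ^ K) (fun k s' => ∀ t < k, tab K (s'.real 12) (t * 2 ^ K) = E t * H t)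
    rfl (fun s' hs => by simp [NatExp.eval, hs.nat 0 rfl, h.ready.input.nodes]) (by simp)
    fun k hk s' hs hk' hI => ?_).weaken ?_
  · have hO := h.same hs rfl
    have hp := hO.stable_place (by decide) hk hk'
    refine (conv_spec hO.ready.sized hp hp hp (by decide) (by decide)).post fun s₁ hs₁ h₁ => ?_
    have hT : TabEq K N (s'.real 12) fun t => tab K (s'.real 12) (t * 2 ^ K) := fun _ _ => rfl
    intro t ht
    rw [State.putNat_real, hT.update h₁.1 h₁.2 t (by omega)]
    rcases Nat.lt_succ_iff_lt_or_eq.1 ht with ht | rfl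
    · rw [Function.update_of_ne ht.ne, hI t ht]
    · rw [Function.update_self, hs.real 7 rfl, hs.real 9 rfl, hE t hk, hH t hk]
  · have := one_le_three_pow K
    simp only [NatExp.cost]
    have : N * (140 * 3 ^ K + (1 + 1) + 10) ≤ N * (160 * 3 ^ K) := Nat.mul_le_mul_left _ (by omega)
    rw [show 160 * (N * 3 ^ K) = N * (160 * 3 ^ K) by ring]
    omega

end

end RealRAM

namespace RealRAM

open SetAlg

section

variable {n m N K : ℕ} {bg : ℕ → List ℕ} {col Q par home : ℕ → ℕ} {α : ℕ → ℝ} {β : ℕ → ℕ → ℝ}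
  {s s' : State}

/-! ### The output -/

/-- The weight of the cause `z`, computed from the tables `R` at its home. -/
noncomputable def homeWeight (bg : ℕ → List ℕ) (col home : ℕ → ℕ) (α : ℕ → ℝ) (β : ℕ → ℕ → ℝ)
    (R : ℕ → SetAlg) (z : ℕ) : ℝ :=
  α z * (invPow 1 (fun c => colourSum bg col β (home z) c z) * R (home z))
    ((bg (home z)).toFinset.image col)

theorem invPow_eq_zero (a : ℝ) {b : ℕ → ℝ} {A S : Finset ℕ} (hb : ∀ i ∉ S, b i = 0)
    (h : ¬ A ⊆ S) : invPow a b A = 0 := by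
  obtain ⟨i, hi, hiS⟩ := Finset.not_subset.1 h
  rw [invPow, Finset.prod_eq_zero hi (hb i hiS), mul_zero]

theorem colourSum_eq_zero (bg : ℕ → List ℕ) (col : ℕ → ℕ) (β : ℕ → ℕ → ℝ) (t z : ℕ) :
    ∀ c ∉ (bg t).toFinset.image col, colourSum bg col β t c z = 0 := fun _ hc =>
  colourSum_of_forall_ne β (fun v hv he =>
    hc (Finset.mem_image.2 ⟨v, List.mem_toFinset.2 hv, he⟩)) z

/-- Compute the weight of the cause in the variable `30`. -/
def weightProgram : Program :=
  .seq causeProgram (.accum 32 (.get 5 (.var 4)) (.natEq (.lit 0) (.lit 0)) 14 (.var 30)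
    (.mul (.get 0 (.var 30)) (.mul (.get 4 (.var 32))
      (.get 12 (.sub (.add (.get 17 (.var 43)) (.get 18 (.var 43))) (.var 32))))))

/-- Only the coefficient at the full bag is needed, so a sum over single masks replaces a
convolution; the mask of a complement is a difference of numbers. -/
theorem weightProgram_spec (h : Ordered n m N K bg col α β Q par home s) {R : ℕ → SetAlg}
    (hR : TabEq K N (s.real 12) R) {z : ℕ} (hz : z < m) (h30 : s.nat 30 0 = z) :
    Spec weightProgram s (360 * 2 ^ K) fun s' => ∀ y, s'.real 14 y =
      s.real 14 y + if z = y then homeWeight bg col home α β R z else 0 := by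
  have ht := h.home_lt z hz
  refine (Spec.seq (causeProgram_spec h.ready hz h30 (by rw [h.home_eq]; exact ht))
    (c' := 60 * 2 ^ K) fun s₁ hs₁ h₁ => ?_).weaken (by omega)
  have hO := h.same hs₁ rfl
  rw [h.home_eq] at h₁
  set t := home z with hthome
  set full := (bg t).toFinset.image col with hfull
  refine ((Spec.accum (2 ^ K) (fun _ => True) (fun _ => z)
    (fun x => α z * (s₁.real 4 x * s.real 12 (t * 2 ^ K + mask full - x)))
    (fun r hr => by simp [NatExp.eval, hr 4, hr 5, hO.ready.sized.size, hO.ready.sized.pow2])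
    (fun j hj r hr hrr _ hj' => by
      simp [NatExp.eval, RealExp.eval, Test.Holds, hr 30, hr 43, hr 17, hr 18, hj', hs₁.nat 30 rfl,
        h30, hO.ready.place t ht, hrr 0, hrr 4, hrr 12, hO.ready.input.alpha z hz, hs₁.real 12 rfl,
        hO.full t ht, h₁.1, ← hfull])).post fun s₂ _ h₂ => ?_).weaken ?_
  · intro y
    rw [h₂ y, hs₁.real 14 rfl]
    congr 1
    simp only [true_and]
    split_ifs with hzy
    · rw [sum_mask K fun x => α z * (s₁.real 4 x * s.real 12 (t * 2 ^ K + mask full - x)),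
        ← Finset.mul_sum, homeWeight, mul_apply]
      congr 1
      have hfK : full ⊆ Finset.range K := h.image_subset ht le_rfl
      symm
      refine Finset.sum_subset_zero_on_sdiff (Finset.powerset_mono.2 hfK) (fun C hC => ?_)
        fun C hC => ?_
      -- For a set with colours outside the bag the subtraction addresses a meaningless cell, but
      -- the other factor is zero because the colour sums vanish there.
      · obtain ⟨h1, h2⟩ := Finset.mem_sdiff.1 hC
        rw [h₁.2.2 C (Finset.mem_powerset.1 h1), invPow_eq_zero 1
          (colourSum_eq_zero bg col β t z) fun hh => h2 (Finset.mem_powerset.2 hh),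
          zero_mul]
      · have hCf := Finset.mem_powerset.1 hC
        rw [h₁.2.2 C (hCf.trans hfK), ← hR t ht,
          tab_apply _ _ (Finset.sdiff_subset.trans hfK), mask_sdiff hCf, Nat.add_sub_assoc
          (mask_mono hCf)]
    · simp
  · have := Nat.one_le_two_pow (n := K)
    simp only [NatExp.cost, RealExp.cost, Test.cost]
    omega

/-- The program that computes the posterior means from the tables of all nodes. -/
def outProgram : Program :=
  .seq (.forN 30 (.get 0 (.lit 1)) weightProgram)
  (.seq (.accum 30 (.get 0 (.lit 1)) (.natEq (.lit 0) (.lit 0)) 13 (.lit 0) (.get 14 (.var 30)))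
  (.fill 30 (.get 0 (.lit 1)) 2 (.lit 0) (.div (.get 14 (.var 30)) (.get 13 (.lit 0)))))

theorem outProgram_spec (h : Ordered n m N K bg col α β Q par home s) {R : ℕ → SetAlg}
    (hR : TabEq K N (s.real 12) R) (h13 : s.real 13 0 = 0) (h14 : ∀ z, s.real 14 z = 0) :
    Spec outProgram s (500 * (m * 2 ^ K) + 60) fun s' => ∀ z < m, s'.real 2 z =
      homeWeight bg col home α β R z / ∑ z' ∈ Finset.range m, homeWeight bg col home α β R z' := by
  set W := homeWeight bg col home α β R with hW
  have h2 := Nat.one_le_two_pow (n := K)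
  refine (Spec.seq (c := 400 * (m * 2 ^ K) + 20) (c' := 60 * m + 40) (R := fun s' =>
    ∀ z < m, s'.real 14 z = W z) ?_ fun s₁ hs₁ h₁ => ?_).weaken ?_
  · refine (Spec.forN m (360 * 2 ^ K) (fun k s' => ∀ z, s'.real 14 z = if z < k then W z else 0) rfl
      (fun s' hs => by simp [NatExp.eval, hs.nat 0 rfl, h.ready.input.causes]) (by simp [h14])
      fun k hk s' hs hk' hI => ?_).weaken ?_ |>.post fun s' _ hI z hz => by rw [hI z, if_pos hz]
    · refine (weightProgram_spec (h.same hs rfl) (by rw [hs.real 12 rfl]; exact hR) hk hk').post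
        fun s₁ _ h₁ z => ?_
      rw [State.putNat_real, h₁ z, hI z]
      rcases lt_trichotomy z k with hz | rfl | hz
      · rw [if_pos hz, if_neg (by omega), if_pos (by omega), add_zero]
      · rw [if_neg (lt_irrefl _), if_pos rfl, if_pos (by omega), zero_add]
      · rw [if_neg (by omega), if_neg (by omega), if_neg (by omega), add_zero]
    · simp only [NatExp.cost]
      have : m * (360 * 2 ^ K + (1 + 1) + 10) ≤ m * (400 * 2 ^ K) :=
        Nat.mul_le_mul_left _ (by omega)
      rw [show 400 * (m * 2 ^ K) = m * (400 * 2 ^ K) by ring]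
      omega
  · have hO := h.same hs₁ rfl
    refine (Spec.seq (Spec.accum m (fun _ => True) (fun _ => 0) W
      (fun r hr => by simp [NatExp.eval, hr 0, hO.ready.input.causes])
      (fun j hj r hr hrr _ hj' => by
        simp [NatExp.eval, RealExp.eval, Test.Holds, hj', hrr 14, h₁ j hj]))
      fun s₂ hs₂ h₂ => (Spec.fill m 0 (fun z => W z / ∑ z' ∈ Finset.range m, W z')
        (fun r hr => by simp [NatExp.eval, hr 0, hs₂.nat 0 rfl, hO.ready.input.causes])
        fun j hj r hr hrr _ _ hj' => ?_).post fun s₃ _ h₃ z hz => ?_).weaken ?_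
    · have h13' := h₂ 0
      simp only [and_self, if_true, hs₁.real 13 rfl, h13, zero_add] at h13'
      simp [NatExp.eval, RealExp.eval, hj', hrr 14, hrr 13, hs₂.real 14 rfl, h₁ j hj, h13']
    · have := h₃.1 z hz
      rwa [zero_add] at this
    · simp only [NatExp.cost, RealExp.cost, Test.cost]
      omega
  · have : m * 1 ≤ m * 2 ^ K := Nat.mul_le_mul_left _ h2
    omega

/-! ### Correctness of the weights -/

theorem supp_nodeFun (t : ℕ) :
    Supp (nodeFun m bg col home α β t) ((bg t).toFinset.image col) := by
  rw [nodeFun, genFun]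
  exact supp_prod fun z _ A hA => invPow_eq_zero (A := A) (α z) (b := fun i => colourSum bg col β t i z)
    (colourSum_eq_zero bg col β t z) hA

/-- The elimination lemmas ask for injectivity at every node number, so the bags beyond `N` are
taken to be empty. -/
theorem injOn_col (hC : Coloured n N K bg col) (hnil : ∀ t, N ≤ t → bg t = []) (t : ℕ) :
    Set.InjOn col ((bg t).toFinset : Set ℕ) := by
  intro v hv w hw he
  simp only [List.coe_toFinset, Set.mem_ofPred_eq] at hv hw
  rcases Nat.lt_or_ge t N with ht | ht
  · exact hC.inj t ht v hv w hw he
  · rw [hnil t ht] at hv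
    simp at hv

/-- The cause can produce nothing outside the bag, so both sides vanish on sets that leave it; on
subsets of the bag the colouring is injective and preserves the size and the factors. -/
theorem invPow_eq_pull (hC : Coloured n N K bg col) {t z : ℕ} (ht : t < N) (a : ℝ)
    (hz : ∀ v, v ∉ bg t → β v z = 0) : invPow a (fun v => β v z) =
      pull col (bg t).toFinset (invPow a fun c => colourSum bg col β t c z) := by
  ext A
  by_cases hA : A ⊆ (bg t).toFinset
  · have hinj : Set.InjOn col (A : Set ℕ) := fun v hv w hw he =>
      hC.inj t ht v (List.mem_toFinset.1 (hA hv)) w (List.mem_toFinset.1 (hA hw)) he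
    rw [pull_apply _ _ hA, invPow, invPow, Finset.card_image_of_injOn hinj,
      Finset.prod_image hinj]
    congr 1
    exact Finset.prod_congr rfl fun v hv => (colourSum_col hC β ht
      (List.mem_toFinset.1 (hA hv)) z).symm
  · rw [supp_pull _ _ _ A hA]
    exact invPow_eq_zero _ (fun v hv => hz v fun h => hv (List.mem_toFinset.2 h)) hA

/-- Grouped by home, the generating function is a product of functions supported in the bags, one
per node. The extra factor of the cause lives in the bag of its home, so `pull_mul_prod_apply` reads
the coefficient there. -/
theorem homeWeight_eq (h : Ordered n m N K bg col α β Q par home s)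
    (hnil : ∀ t, N ≤ t → bg t = []) (hβ : ∀ z < m, ∀ v, v ∉ bg (home z) → β v z = 0)
    (hcover : ∀ v < n, ∃ t < N, v ∈ bg t) {z : ℕ} (hz : z < m) :
    homeWeight bg col home α β (fun t => nodeFun m bg col home α β t *
      ElimOrder.down (fun t => (bg t).toFinset) N Q par col (nodeFun m bg col home α β) (N - 1) t)
      z = LDA.weight n m α β z := by
  have hC := h.ready.coloured
  have hrange : Finset.range n = (Finset.range N).biUnion fun t => (bg t).toFinset := by
    ext v
    simp only [Finset.mem_range, Finset.mem_biUnion, List.mem_toFinset]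
    exact ⟨hcover v, fun ⟨t, ht, hv⟩ => hC.vert_lt t ht v hv⟩
  have hgen : genFun (Finset.range m) α β = ∏ t ∈ Finset.range N,
      pull col (bg t).toFinset (nodeFun m bg col home α β t) := by
    rw [genFun, ← Finset.prod_fiberwise_of_maps_to (g := home) (t := Finset.range N)
      fun z hz => Finset.mem_range.2 (h.home_lt z (Finset.mem_range.1 hz))]
    refine Finset.prod_congr rfl fun t ht => ?_
    rw [nodeFun, genFun, pull_prod (injOn_col hC hnil t)]
    refine Finset.prod_congr rfl fun z' hz' => ?_
    obtain ⟨h1, h2⟩ := Finset.mem_filter.1 hz'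
    exact invPow_eq_pull hC (Finset.mem_range.1 ht) _ fun v hv =>
      hβ z' (Finset.mem_range.1 h1) v (h2 ▸ hv)
  rw [homeWeight, LDA.weight, hrange, hgen, invPow_eq_pull hC (h.home_lt z hz) 1 (hβ z hz),
    h.order.pull_mul_prod_apply (injOn_col hC hnil) supp_nodeFun h.lt (home z) (h.home_lt z hz)]

end

end RealRAM

namespace RealRAM

open SetAlg

/-! ### The whole program -/

/-- The lists in `bg` have no repetitions, and `K` is the maximum of their lengths. -/
structure BagLists (n N K : ℕ) (bg : ℕ → List ℕ) : Prop where
  length_le : ∀ t < N, (bg t).length ≤ K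
  exists_length : ∃ t < N, (bg t).length = K
  nodup : ∀ t < N, (bg t).Nodup
  vert_lt : ∀ t < N, ∀ v ∈ bg t, v < n

/-- All memory cells except for those of the input are zero. -/
structure Blank (s : State) : Prop where
  nat : ∀ a, 4 ≤ a → ∀ x, s.nat a x = 0
  real : ∀ a, 2 ≤ a → ∀ x, s.real a x = 0

section

variable {n m N K : ℕ} {bg : ℕ → List ℕ} {α : ℕ → ℝ} {β : ℕ → ℕ → ℝ} {s : State}

/-- The program that computes the tables that depend on the sizes only. -/
def tableProgram : Program :=
  .seq sizeProgram (.seq powProgram (.seq ternProgram (.seq cardProgram placeProgram)))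

theorem tableProgram_spec (hin : Input n m N bg α β s) (hB : BagLists n N K bg) (h0 : Blank s) :
    Spec tableProgram s (100 * N + 40 * n + 500 * 3 ^ K) fun s' => Sized K s' ∧
      (∀ C ⊆ Finset.range K, s'.real 5 (mask C) = C.card) ∧
      (∀ t ≤ N, s'.nat 17 t = t * 2 ^ K) ∧ ∀ i ≤ n, s'.nat 16 i = i * m := by
  refine (Spec.seq (sizeProgram_spec hin (h0.nat 4 le_rfl 0) hB.length_le hB.exists_length)
    fun s₁ hs₁ h₁ => Spec.seq (powProgram_spec h₁) fun s₂ hs₂ h₂ => Spec.seq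
    (ternProgram_spec (by rw [hs₂.nat 4 rfl, h₁]) h₂.1 h₂.2
      (by rw [hs₂.nat 7 rfl, hs₁.nat 7 rfl, h0.nat 7 (by decide)])
      (by rw [hs₂.nat 8 rfl, hs₁.nat 8 rfl, h0.nat 8 (by decide)])) fun s₃ hs₃ h₃ => ?_).weaken
    (c := (60 * N + 9) + ((60 * K + 30) + (220 * 3 ^ K + (90 * 3 ^ K + (40 * N + 40 * n + 30)))))
    ?_
  · have hK : Sized K s₃ := ⟨by rw [hs₃.nat 4 rfl, hs₂.nat 4 rfl, h₁],
      fun c hc => by rw [hs₃.nat 5 rfl, h₂.1 c hc], fun c hc => by rw [hs₃.nat 6 rfl, h₂.2 c hc], h₃⟩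
    refine Spec.seq (cardProgram_spec hK
      (by rw [hs₃.real 5 rfl, hs₂.real 5 rfl, hs₁.real 5 rfl, h0.real 5 (by decide)]))
      fun s₄ hs₄ h₄ => ?_
    have hK₄ := hK.of_eq (hs₄.nat 4 rfl) (hs₄.nat 5 rfl) (hs₄.nat 6 rfl) (hs₄.nat 7 rfl)
      (hs₄.nat 8 rfl)
    have e : ∀ a, sizeProgram.writesNat a = false → powProgram.writesNat a = false →
        ternProgram.writesNat a = false → cardProgram.writesNat a = false → s₄.nat a = s.nat a :=
      fun a h1 h2 h3 h4 => by rw [hs₄.nat a h4, hs₃.nat a h3, hs₂.nat a h2, hs₁.nat a h1]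
    have e' : ∀ a, cardProgram.writesReal a = false → s₄.real a = s.real a :=
      fun a h4 => by rw [hs₄.real a h4, hs₃.real a rfl, hs₂.real a rfl, hs₁.real a rfl]
    refine (placeProgram_spec (hin.of_eq (e 0 rfl rfl rfl rfl) (e 2 rfl rfl rfl rfl)
      (e 3 rfl rfl rfl rfl) (e' 0 rfl) (e' 1 rfl)) hK₄
      (by rw [e 17 rfl rfl rfl rfl, h0.nat 17 (by decide)])
      (by rw [e 16 rfl rfl rfl rfl, h0.nat 16 (by decide)])).post fun s₅ hs₅ h₅ => ?_
    exact ⟨hK₄.of_eq (hs₅.nat 4 rfl) (hs₅.nat 5 rfl) (hs₅.nat 6 rfl) (hs₅.nat 7 rfl)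
      (hs₅.nat 8 rfl), fun C hC => by rw [hs₅.real 5 rfl, h₄ C hC], h₅⟩
  · have h1 := le_three_pow K
    have h2 := one_le_three_pow K
    omega

/-- The program that computes the tables, the elimination ordering and the colouring. -/
def readyProgram : Program := .seq tableProgram (.seq pruneProgram colourProgram)

theorem readyProgram_spec (hin : Input n m N bg α β s) (hB : BagLists n N K bg) (h0 : Blank s)
    {G : SimpleGraph (Fin n)} {D : TreeDecomposition G N} (L : D.Listing)
    (hV : ∀ t : Fin N, (bg t).toFinset = (D.bag t).image Fin.val)
    (h1 : ∀ e (he : e < L.edges.length), s.nat 1 (e + e) = (L.edges[e]).1.val ∧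
      s.nat 1 (e + e + 1) = (L.edges[e]).2.val) :
    Spec readyProgram s (360 * N + 40 * n + 500 * 3 ^ K + 500 * (N * 3 ^ K) + 80) fun s' =>
      Ready n m N K bg (fun v => s'.nat 14 v - 1) α β s' ∧
      ElimOrder N (fun t => (bg t).toFinset) (s'.nat 11) (s'.nat 13) ∧
      ∀ i < N, s'.nat 11 i < N := by
  refine (Spec.seq (tableProgram_spec hin hB h0) fun s₁ hs₁ h₁ => Spec.seq
    (pruneProgram_spec L (V := fun t => (bg t).toFinset) hV (by rw [hs₁.nat 0 rfl, hin.nodes])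
      (by rw [hs₁.nat 1 rfl]; exact h1) (by rw [hs₁.nat 9 rfl]; exact h0.nat 9 (by decide))
      (by rw [hs₁.nat 10 rfl]; exact h0.nat 10 (by decide))
      (by rw [hs₁.nat 12 rfl]; exact h0.nat 12 (by decide) 0)) fun s₂ hs₂ h₂ => ?_).weaken
    (c := (100 * N + 40 * n + 500 * 3 ^ K) + ((260 * N + 60) + (500 * (N * 3 ^ K) + 20)))
    (by omega)
  have hK₂ := h₁.1.of_eq (hs₂.nat 4 rfl) (hs₂.nat 5 rfl) (hs₂.nat 6 rfl) (hs₂.nat 7 rfl)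
    (hs₂.nat 8 rfl)
  have hin₁ := hin.of_eq (hs₁.nat 0 rfl) (hs₁.nat 2 rfl) (hs₁.nat 3 rfl) (hs₁.real 0 rfl)
    (hs₁.real 1 rfl)
  have hin₂ := hin₁.of_eq (hs₂.nat 0 rfl) (hs₂.nat 2 rfl) (hs₂.nat 3 rfl) (hs₂.real 0 rfl)
    (hs₂.real 1 rfl)
  refine (colourProgram_spec hin₂ hK₂.size hB.length_le h₂.1 h₂.2
    (by rw [hs₂.nat 14 rfl, hs₁.nat 14 rfl]; exact h0.nat 14 (by decide))).post
    fun s₃ hs₃ h₃ => ?_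
  have hpos : ∀ t < N, ∀ v ∈ bg t, s₃.nat 14 v = s₃.nat 14 v - 1 + 1 ∧ s₃.nat 14 v - 1 < K := by
    intro t ht v hv
    have := h₃.1 t ht v hv
    omega
  refine ⟨⟨hin₂.of_eq (hs₃.nat 0 rfl) (hs₃.nat 2 rfl) (hs₃.nat 3 rfl) (hs₃.real 0 rfl)
    (hs₃.real 1 rfl), hK₂.of_eq (hs₃.nat 4 rfl) (hs₃.nat 5 rfl) (hs₃.nat 6 rfl) (hs₃.nat 7 rfl)
    (hs₃.nat 8 rfl), ⟨hB.length_le, hB.nodup, hB.vert_lt, fun t ht v hv => (hpos t ht v hv).2,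
    fun t ht v hv w hw he => ?_⟩, fun t ht v hv => (hpos t ht v hv).1, fun i hi => ?_,
    fun t ht => ?_, fun C hC => ?_⟩, ?_, ?_⟩
  · refine h₃.2 t ht v hv w hw ?_
    rw [(hpos t ht v hv).1, (hpos t ht w hw).1, he]
  · rw [hs₃.nat 16 rfl, hs₂.nat 16 rfl, h₁.2.2.2 i hi.le]
  · rw [hs₃.nat 17 rfl, hs₂.nat 17 rfl, h₁.2.2.1 t ht.le]
  · rw [hs₃.real 5 rfl, hs₂.real 5 rfl, h₁.2.1 C hC]
  · rw [hs₃.nat 11 rfl, hs₃.nat 13 rfl]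
    exact h₂.1
  · rw [hs₃.nat 11 rfl]
    exact h₂.2

/-- The program that computes everything that does not depend on the numbers `α`, `β`, except for
the signs of the latter. -/
def orderProgram : Program := .seq readyProgram (.seq fullProgram (.seq diffProgram homeProgram))

theorem orderProgram_spec (hin : Input n m N bg α β s) (hB : BagLists n N K bg) (h0 : Blank s)
    {G : SimpleGraph (Fin n)} {D : TreeDecomposition G N} (L : D.Listing)
    (hV : ∀ t : Fin N, (bg t).toFinset = (D.bag t).image Fin.val)
    (h1 : ∀ e (he : e < L.edges.length), s.nat 1 (e + e) = (L.edges[e]).1.val ∧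
      s.nat 1 (e + e + 1) = (L.edges[e]).2.val)
    (hex : ∀ z < m, ∃ t < N, ∀ v < n, 0 < β v z → v ∈ bg t) :
    Spec orderProgram s (360 * N + 40 * n + 500 * 3 ^ K + 500 * (N * 3 ^ K) + 80 +
      (N * (60 * K + 40) + 20 + (N * (240 * K + 120) + 20 +
        (m * (60 * n + N * (60 * K + 60) + 60) + 20)))) fun s' =>
      ∃ col Q par home, Ordered n m N K bg col α β Q par home s' ∧
        ∀ z < m, ∀ v < n, 0 < β v z → v ∈ bg (home z) := by
  refine Spec.seq (readyProgram_spec hin hB h0 L hV h1) fun s₁ hs₁ h₁ => ?_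
  obtain ⟨hR₁, hE, hQ⟩ := h₁
  refine Spec.seq (fullProgram_spec hR₁.input hR₁.sized hR₁.coloured hR₁.col
    (by rw [hs₁.nat 18 rfl]; exact h0.nat 18 (by decide))) fun s₂ hs₂ h₂ => ?_
  have hR₂ := hR₁.same hs₂ rfl
  refine Spec.seq (diffProgram_spec hR₂.input hR₂.sized hR₂.coloured hR₂.col
    (by rw [hs₂.nat 11 rfl, hs₂.nat 13 rfl]; exact hE) (by rw [hs₂.nat 11 rfl]; exact hQ)
    (by rw [hs₂.nat 19 rfl, hs₁.nat 19 rfl]; exact h0.nat 19 (by decide))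
    (by rw [hs₂.nat 20 rfl, hs₁.nat 20 rfl]; exact h0.nat 20 (by decide))
    (by rw [hs₂.nat 21 rfl, hs₁.nat 21 rfl]; exact h0.nat 21 (by decide))
    (by rw [hs₂.nat 23 rfl, hs₁.nat 23 rfl]; exact h0.nat 23 (by decide))) fun s₃ hs₃ h₃ => ?_
  have hR₃ := hR₂.same hs₃ rfl
  refine (homeProgram_spec hR₃ hex).post fun s₄ hs₄ h₄ => ?_
  rw [hs₂.nat 11 rfl, hs₂.nat 13 rfl] at h₃
  refine ⟨_, s₁.nat 11, s₁.nat 13, s₄.nat 22, ⟨hR₃.same hs₄ rfl, hE, hQ, fun z hz => (h₄ z hz).1,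
    ?_, ?_, rfl, fun t ht => ?_, fun i hi => ?_, fun i hi => ?_⟩, fun z hz => (h₄ z hz).2⟩
  · rw [hs₄.nat 11 rfl, hs₃.nat 11 rfl, hs₂.nat 11 rfl]
  · rw [hs₄.nat 13 rfl, hs₃.nat 13 rfl, hs₂.nat 13 rfl]
  · rw [hs₄.nat 18 rfl, hs₃.nat 18 rfl, h₂ t ht]
  · rw [hs₄.nat 19 rfl, (h₃ i hi).1]
  · rw [hs₄.nat 20 rfl, (h₃ i hi).2]

/-- The program that computes the posterior means. -/
def posteriorProgram : Program :=
  .seq orderProgram (.seq logProgram (.seq expProgram (.seq upProgram (.seq downProgram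
    (.seq joinProgram outProgram)))))

/-- Ordering, colouring, node tables and passes take a multiple of `N * 3 ^ K` plus lower terms, and
`N ≤ n`. The search for homes takes time of order `m * (n + N * (K + 1))`, which `K ≤ 2 ^ K` brings
below a multiple of `m * n * 2 ^ K`. -/
theorem posteriorProgram_spec (hn : 1 ≤ n) (hN : N ≤ n) (hin : Input n m N bg α β s)
    (hB : BagLists n N K bg) (h0 : Blank s)
    {G : SimpleGraph (Fin n)} {D : TreeDecomposition G N} (L : D.Listing)
    (hV : ∀ t : Fin N, (bg t).toFinset = (D.bag t).image Fin.val)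
    (h1 : ∀ e (he : e < L.edges.length), s.nat 1 (e + e) = (L.edges[e]).1.val ∧
      s.nat 1 (e + e + 1) = (L.edges[e]).2.val)
    (hex : ∀ z < m, ∃ t < N, ∀ v < n, 0 < β v z → v ∈ bg t)
    (hnil : ∀ t, N ≤ t → bg t = []) (hcover : ∀ v < n, ∃ t < N, v ∈ bg t)
    (hβ : ∀ z < m, ∀ v < n, 0 ≤ β v z) (hβ' : ∀ z, ∀ v, n ≤ v → β v z = 0) :
    Spec posteriorProgram s (5000 * (n * 3 ^ K + m * n * 2 ^ K)) fun s' => ∀ z < m,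
      s'.real 2 z = LDA.weight n m α β z / ∑ z' ∈ Finset.range m, LDA.weight n m α β z' := by
  refine (Spec.seq (c' := 420 * (m * 2 ^ K) + 20 + (170 * (N * 3 ^ K) + 20 +
      (350 * (N * 3 ^ K) + 20 + (700 * (N * 3 ^ K) + 40 + (160 * (N * 3 ^ K) + 20 +
      (500 * (m * 2 ^ K) + 60))))))
    (orderProgram_spec hin hB h0 L hV h1 hex) fun s₁ hs₁ h₁ => ?_).weaken ?_
  · obtain ⟨col, Q, par, home, hO₁, hhome⟩ := h₁
    refine Spec.seq (logProgram_spec hO₁.ready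
      (by rw [hO₁.home_eq]; exact hO₁.home_lt)
      (by rw [hs₁.real 6 rfl]; exact h0.real 6 (by decide))) fun s₂ hs₂ h₂ => ?_
    have hO₂ := hO₁.same hs₂ rfl
    rw [hO₁.home_eq] at h₂
    refine Spec.seq (expProgram_spec hO₂.ready h₂
      (by rw [hs₂.real 7 rfl, hs₁.real 7 rfl]; exact h0.real 7 (by decide))) fun s₃ hs₃ h₃ => ?_
    have hO₃ := hO₂.same hs₃ rfl
    have hE : TabEq K N (s₃.real 7) (nodeFun m bg col home α β) := fun t ht =>
      tab_eq ((supp_nodeFun t).mono (hO₃.image_subset ht le_rfl)) (h₃ t ht)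
    refine Spec.seq (upProgram_spec hO₃ hE) fun s₄ hs₄ h₄ => ?_
    have hO₄ := hO₃.same hs₄ rfl
    refine Spec.seq (downProgram_spec hO₄ D.nodes_pos h₄.1 h₄.2
      (by rw [hs₄.real 9 rfl, hs₃.real 9 rfl, hs₂.real 9 rfl, hs₁.real 9 rfl]
          exact h0.real 9 (by decide))) fun s₅ hs₅ h₅ => ?_
    have hO₅ := hO₄.same hs₅ rfl
    refine Spec.seq (joinProgram_spec hO₅ h₅.1 h₅.2) fun s₆ hs₆ h₆ => ?_
    have hO₆ := hO₅.same hs₆ rfl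
    refine (outProgram_spec hO₆ h₆
      (by rw [hs₆.real 13 rfl, hs₅.real 13 rfl, hs₄.real 13 rfl, hs₃.real 13 rfl, hs₂.real 13 rfl,
            hs₁.real 13 rfl]
          exact h0.real 13 (by decide) 0)
      (by rw [hs₆.real 14 rfl, hs₅.real 14 rfl, hs₄.real 14 rfl, hs₃.real 14 rfl, hs₂.real 14 rfl,
            hs₁.real 14 rfl]
          exact h0.real 14 (by decide))).post fun s₇ _ h₇ z hz => ?_
    have hvan : ∀ z < m, ∀ v, v ∉ bg (home z) → β v z = 0 := by
      intro z hz v hv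
      rcases Nat.lt_or_ge v n with hvn | hvn
      · exact le_antisymm (not_lt.1 fun hp => hv (hhome z hz v hvn hp)) (hβ z hz v hvn)
      · exact hβ' z v hvn
    have hw := fun {z : ℕ} (hz : z < m) => homeWeight_eq hO₆ hnil hvan hcover hz
    rw [h₇ z hz, hw hz, Finset.sum_congr rfl fun z' hz' => hw (Finset.mem_range.1 hz')]
  · have a1 : 1 ≤ 3 ^ K := one_le_three_pow K
    have a2 : 1 ≤ 2 ^ K := Nat.one_le_two_pow
    have a3 : K ≤ 2 ^ K := (Nat.lt_two_pow_self).le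
    have a4 : K ≤ 3 ^ K := le_three_pow K
    have b1 : N * 3 ^ K ≤ n * 3 ^ K := Nat.mul_le_mul_right _ hN
    have b2 : n * 1 ≤ n * 3 ^ K := Nat.mul_le_mul_left _ a1
    have b3 : 1 * 3 ^ K ≤ n * 3 ^ K := Nat.mul_le_mul_right _ hn
    have b4 : N * (60 * K + 40) ≤ n * (100 * 3 ^ K) := Nat.mul_le_mul hN (by omega)
    have b5 : N * (240 * K + 120) ≤ n * (360 * 3 ^ K) := Nat.mul_le_mul hN (by omega)
    have b6 : N * (60 * K + 60) ≤ n * (120 * 2 ^ K) := Nat.mul_le_mul hN (by omega)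
    have b7 : n * 1 ≤ n * 2 ^ K := Nat.mul_le_mul_left _ a2
    have b8 : m * (60 * n + N * (60 * K + 60) + 60) ≤ m * (240 * (n * 2 ^ K)) := by
      refine Nat.mul_le_mul_left _ ?_
      rw [show n * (120 * 2 ^ K) = 120 * (n * 2 ^ K) by ring] at b6
      omega
    have b9 : m * 2 ^ K * 1 ≤ m * 2 ^ K * n := Nat.mul_le_mul_left _ hn
    rw [show m * (240 * (n * 2 ^ K)) = 240 * (m * 2 ^ K * n) by ring] at b8
    rw [show n * (100 * 3 ^ K) = 100 * (n * 3 ^ K) by ring] at b4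
    rw [show n * (360 * 3 ^ K) = 360 * (n * 3 ^ K) by ring] at b5
    rw [show m * n * 2 ^ K = m * 2 ^ K * n by ring]
    omega

end

end RealRAM

/-! ### The input -/

/-- The offset is the total length of the preceding pieces, the form in which the input records
where a bag begins. -/
theorem getD_flatMap {γ δ : Type*} (f : γ → List δ) (d : δ) :
    ∀ (l : List γ) (t : ℕ) (ht : t < l.length) (j : ℕ), j < (f l[t]).length →
      (l.flatMap f).getD (((l.take t).map fun x => (f x).length).sum + j) d = (f l[t]).getD j d
  | [], t, ht, _, _ => absurd ht (by simp)
  | x :: l, 0, _, j, hj => by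
    simp only [List.getElem_cons_zero] at hj
    simp [List.flatMap_cons, List.getElem?_append_left hj]
  | x :: l, t + 1, ht, j, hj => by
    have ht' : t < l.length := by simpa using ht
    simp only [List.getElem_cons_succ] at hj ⊢
    rw [← getD_flatMap f d l t ht' j hj, List.flatMap_cons, List.take_succ_cons, List.map_cons,
      List.sum_cons, List.getD_append_right _ _ _ _ (by omega)]
    congr 1
    omega

theorem getD_flatMap_pair {γ δ : Type*} (f g : γ → δ) (d : δ) (l : List γ) (t : ℕ)
    (ht : t < l.length) :
    (l.flatMap fun x => [f x, g x]).getD (t + t) d = f l[t] ∧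
      (l.flatMap fun x => [f x, g x]).getD (t + t + 1) d = g l[t] := by
  have hsum : ((l.take t).map fun x => [f x, g x].length).sum = t + t := by
    simp only [List.length_cons, List.length_nil, List.map_const', List.length_take,
      List.sum_replicate, smul_eq_mul, min_eq_left ht.le]
    omega
  have h0 := getD_flatMap (fun x => [f x, g x]) d l t ht 0 (by simp)
  have h1 := getD_flatMap (fun x => [f x, g x]) d l t ht 1 (by simp)
  rw [hsum] at h0 h1
  exact ⟨by simpa using h0, by simpa using h1⟩

namespace RealRAM

/-- The bags as lists of natural numbers. -/
def natBags {n N : ℕ} {G : SimpleGraph (Fin n)} {D : TreeDecomposition G N} (L : D.Listing)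
    (t : ℕ) : List ℕ :=
  if h : t < N then (L.bags ⟨t, h⟩).map Fin.val else []

/-- Extend a vector by zero. -/
noncomputable def extend {m : ℕ} (α : Fin m → ℝ) (z : ℕ) : ℝ := if h : z < m then α ⟨z, h⟩ else 0

theorem extend_val {m : ℕ} (α : Fin m → ℝ) (z : Fin m) : extend α z = α z := dif_pos z.2

/-- Extend a matrix by zero. -/
noncomputable def extendMatrix {n m : ℕ} (β : Fin n → Fin m → ℝ) (i z : ℕ) : ℝ :=
  if h : i < n then extend (β ⟨i, h⟩) z else 0

theorem extendMatrix_val {n m : ℕ} (β : Fin n → Fin m → ℝ) (i : Fin n) (z : Fin m) :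
    extendMatrix β i z = β i z := by
  rw [extendMatrix, dif_pos i.2, extend_val]

section

variable {n m N : ℕ} (α : Fin m → ℝ) (β : Fin n → Fin m → ℝ) {G : SimpleGraph (Fin n)}
  {D : TreeDecomposition G N} (L : D.Listing)

theorem blank_input : Blank (input α β L) := by
  constructor
  · intro a ha x
    match a, ha with
    | a + 4, _ => rfl
  · intro a ha x
    match a, ha with
    | a + 2, _ => rfl

theorem input_input :
    Input n m N (natBags L) (extend α) (extendMatrix β) (input α β L) := by
  refine ⟨rfl, rfl, rfl, fun t ht => ?_, fun t ht j hj => ?_, fun z hz => ?_, fun i hi z hz => ?_⟩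
  · have hlen : t < (List.finRange N).length := by simpa using ht
    simp only [input]
    rw [if_pos (by omega), if_pos (by omega), List.take_succ_eq_append_getElem hlen, List.map_append,
      List.sum_append, natBags, dif_pos ht]
    simp
  · have hlen : t < (List.finRange N).length := by simpa using ht
    have hg : (List.finRange N)[t] = ⟨t, ht⟩ := by simp
    have := getD_flatMap (fun t => (L.bags t).map Fin.val) 0 (List.finRange N) t hlen j
    rw [natBags, dif_pos ht] at hj ⊢
    rw [hg] at this
    have := this hj
    simp only [List.length_map] at this
    simp only [input]
    rw [if_pos (by omega), this]
  · rfl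
  · have hlt : i * m + z < n * m := by
      calc i * m + z < i * m + m := by omega
        _ = (i + 1) * m := by ring
        _ ≤ n * m := Nat.mul_le_mul_right _ hi
    -- `finProdFinEquiv` numbers the entries of a matrix row by row.
    have he : finProdFinEquiv.symm ⟨i * m + z, hlt⟩ = ((⟨i, hi⟩, ⟨z, hz⟩) : Fin n × Fin m) := by
      rw [Equiv.symm_apply_eq]
      ext
      simp [finProdFinEquiv]
      ring
    simp only [input]
    rw [dif_pos hlt, he, extendMatrix, dif_pos hi, extend, dif_pos hz]

theorem edges_input (e : ℕ) (he : e < L.edges.length) :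
    (input α β L).nat 1 (e + e) = (L.edges[e]).1.val ∧
      (input α β L).nat 1 (e + e + 1) = (L.edges[e]).2.val :=
  getD_flatMap_pair (fun e : Fin N × Fin N => e.1.val) (fun e => e.2.val) 0 L.edges e he

theorem natBags_toFinset (t : Fin N) : (natBags L t).toFinset = (D.bag t).image Fin.val := by
  rw [natBags, dif_pos t.2]
  ext v
  simp [L.mem_bags]

theorem mem_natBags (t : Fin N) (v : Fin n) : v.val ∈ natBags L t ↔ v ∈ D.bag t := by
  rw [natBags, dif_pos t.2, List.mem_map]
  constructor
  · rintro ⟨w, hw, he⟩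
    exact Fin.ext he ▸ (L.mem_bags t w).1 hw
  · exact fun h => ⟨v, (L.mem_bags t v).2 h, rfl⟩

theorem length_natBags (t : Fin N) : (natBags L t).length = (D.bag t).card := by
  rw [natBags, dif_pos t.2, List.length_map, ← List.toFinset_card_of_nodup (L.bags_nodup t)]
  congr 1
  ext v
  simp [L.mem_bags]

/-- The width is a truncated difference; a vertex exists and lies in some bag, so the largest bag is
nonempty and `D.width + 1` is its true size. -/
theorem bagLists_natBags (hn : 1 ≤ n) : BagLists n N (D.width + 1) (natBags L) := by
  have hne : (Finset.univ : Finset (Fin N)).Nonempty := ⟨⟨0, D.nodes_pos⟩, Finset.mem_univ _⟩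
  obtain ⟨t, -, ht⟩ := Finset.exists_mem_eq_sup Finset.univ hne fun t => (D.bag t).card
  obtain ⟨t₀, ht₀⟩ := D.cover ⟨0, hn⟩
  have hle : ∀ t, (D.bag t).card ≤ Finset.univ.sup fun t => (D.bag t).card := fun t =>
    Finset.le_sup (f := fun t => (D.bag t).card) (Finset.mem_univ t)
  have hpos : 0 < (D.bag t₀).card := Finset.card_pos.2 ⟨_, ht₀⟩
  have hw : D.width + 1 = Finset.univ.sup fun t => (D.bag t).card := by
    have := hle t₀
    rw [TreeDecomposition.width]
    omega
  refine ⟨fun t ht => ?_, ⟨t, t.2, ?_⟩, fun t ht => ?_, fun t ht v hv => ?_⟩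
  · rw [length_natBags L ⟨t, ht⟩, hw]
    exact hle _
  · rw [length_natBags, hw, ht]
  · rw [natBags, dif_pos ht]
    exact (L.bags_nodup _).map Fin.val_injective
  · rw [natBags, dif_pos ht] at hv
    obtain ⟨w, -, rfl⟩ := List.mem_map.1 hv
    exact w.2

end

end RealRAM

/-! ### The posterior means in the stated time -/

theorem theorem4 :
    ∃ (P : RealRAM.Program) (C : ℕ),
      ∀ (n m w : ℕ), 1 ≤ n →
      ∀ (α : Fin m → ℝ) (β : Fin n → Fin m → ℝ),
        (∀ z, 0 < α z) → (∀ i z, 0 ≤ β i z) → 0 < LDA.evidence α β →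
        treeWidth (LDA.interactionGraph β) = w →
        (∃ N ≤ n, ∃ D : TreeDecomposition (LDA.interactionGraph β) N, D.width = w) ∧
        ∀ N ≤ n, ∀ D : TreeDecomposition (LDA.interactionGraph β) N, D.width = w →
          ∀ L : D.Listing,
            ∃ (k : ℕ) (s : RealRAM.State),
              RealRAM.Runs P (RealRAM.input α β L) k s ∧
              k ≤ C * (n * 3 ^ w + m * n * 2 ^ w) ∧
              ∀ z : Fin m, s.real 2 z = LDA.posteriorMean α β z := by
  refine ⟨RealRAM.posteriorProgram, 15000, fun n m w hn α β hα hβ _ hw => ⟨?_, ?_⟩⟩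
  · rw [← hw]
    exact TreeDecomposition.exists_width_eq_treeWidth hn _
  intro N hN D hD L
  have hex : ∀ z < m, ∃ t < N, ∀ v < n, 0 < RealRAM.extendMatrix β v z →
      v ∈ RealRAM.natBags L t := by
    classical
    intro z hz
    -- Any two observations that `z` can produce are joined because of `z` itself, so together they
    -- form a clique and fit into one bag, a possible home for `z`.
    obtain ⟨t, ht⟩ := D.clique (Finset.univ.filter fun i => 0 < β i ⟨z, hz⟩) (by
      intro i hi j hj hne
      simp only [Finset.coe_filter, Finset.mem_univ, true_and, Set.mem_ofPred_eq] at hi hj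
      exact ⟨hne, ⟨z, hz⟩, hi, hj⟩)
    refine ⟨t, t.2, fun v hv hp => (RealRAM.mem_natBags L t ⟨v, hv⟩).2 (ht ?_)⟩
    rw [Finset.mem_filter]
    exact ⟨Finset.mem_univ _, (RealRAM.extendMatrix_val β ⟨v, hv⟩ ⟨z, hz⟩) ▸ hp⟩
  obtain ⟨k, s, hrun, hk, hs⟩ := RealRAM.posteriorProgram_spec hn hN
    (RealRAM.input_input α β L) (RealRAM.bagLists_natBags L hn) (RealRAM.blank_input α β L) L
    (RealRAM.natBags_toFinset L) (RealRAM.edges_input α β L) hex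
    (fun t ht => dif_neg (by omega))
    (fun v hv => by
      obtain ⟨t, ht⟩ := D.cover ⟨v, hv⟩
      exact ⟨t, t.2, (RealRAM.mem_natBags L t ⟨v, hv⟩).2 ht⟩)
    (fun z hz v hv => by
      rw [show v = (⟨v, hv⟩ : Fin n).val from rfl, show z = (⟨z, hz⟩ : Fin m).val from rfl,
        RealRAM.extendMatrix_val]
      exact hβ _ _)
    (fun z v hv => dif_neg (by omega))
  refine ⟨k, s, hrun, hk.trans ?_, fun z => ?_⟩
  -- The tables have `K = w + 1` colours, which costs factors three and two over the powers with
  -- exponent `w`; this is why the constant is three times `5000`.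
  · rw [hD, pow_succ, pow_succ, show n * (3 ^ w * 3) = 3 * (n * 3 ^ w) by ring,
      show m * n * (2 ^ w * 2) = 2 * (m * n * 2 ^ w) by ring]
    omega
  · rw [hs z z.2, ← LDA.posteriorMean_eq (RealRAM.extend α) (RealRAM.extendMatrix β)
      fun z hz => by rw [RealRAM.extend, dif_pos hz]; exact hα _]
    congr 1
    · ext z
      exact RealRAM.extend_val α z
    · ext i z
      exact RealRAM.extendMatrix_val β i z
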